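/- **Proposition 3.1 (Unique solvability).** Let $d\ge 2$ and let $\Omega\subset\mathbb R^d$ be a polygonal/polyhedral domain: a nonempty connected open set with $\operatorname{int}\overline\Omega=\Omega$, equipped with a conforming partition $\mathcal T_h$ into finitely many nondegenerate $d$-simplices $K$ (triangles if $d=2$, tetrahedra if $d=3$), i.e. $\overline\Omega=\bigcup_{K}\overline K$ and any two closed elements meet exactly in the (possibly empty) simplex spanned by their common vertices. Let $\Gamma=\partial\Omega$, let $\mathcal E(K)$ be the set of faces of $K$, let $\mathcal E_h=\bigcup_K\mathcal E(K)$, and let $\mathbf n$ be the unit outward normal on each $\partial K$. Let $\kappa\in L^\infty(\Omega)$ be bounded below by a positive constant a.e., $f\in L^2(\Omega)$, $u_0\in L^2(\Gamma)$. Let $k\ge 0$ be an integer, $\mathcal P_k$ the polynomials of degree at most $k$, $\widetilde{\mathcal P}_k$ the homogeneous polynomials of degree $k$, $\mathcal{RT}_k(K)=\mathcal P_k(K)^d\oplus \mathbf x\,\widetilde{\mathcal P}_k(K)$, and $$\mathbf V_h=\prod_{K}\mathcal{RT}_k(K),\quad W_h=\prod_{K}\mathcal P_k(K),\quad M_h=\prod_{e\in\mathcal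 E_h}\mathcal P_k(e),\quad \mathbf V_h^{\mathrm{div}}=\mathbf V_h\cap\mathbf H(\mathrm{div},\Omega),$$ $$M_h^\circ=\{\mu\in M_h:\mu|_e=0\ \forall e\subset\Gamma\},\qquad M_h^\Gamma=\{\mu\in M_h:\mu|_e=0\ \forall e\not\subset\Gamma\},$$ where elements of $\mathbf V_h$ and $W_h$ are also regarded as functions defined almost everywhere on $\Omega$. Write $(a,b)_D=\int_D ab$ (with the dot product for vector fields), $(a,b)_{\mathcal T_h}=\sum_K(a,b)_K$ with differential operators applied element by element, $\langle\lambda,\mu\rangle_S=\int_S\lambda\mu$ (surface integral), $\langle\mathbf q\cdot\mathbf n,\mu\rangle_{\partial\mathcal T_h}=\sum_K\langle\mathbf q|_K\cdot\mathbf n,\mu\rangle_{\partial K}$ and $\langle\mathbf q\cdot\mathbf n,\mu\rangle_{\partial\mathcal T_h\setminus\Gamma}=\sum_K\langle\mathbf q|_K\cdot\mathbf n,\mu\rangle_{\partial K\setminus\Gamma}$. The hybridized system (H) is: find $(\mathbf q_h,u_h,\widehat u_h)\in\mathbf V_h\times W_h\times M_h$ such that $$\begin{aligned} (\kappa^{-1}\mathbf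 q_h,\mathbf r)_{\mathcal T_h}-(u_h,\mathrm{div}\,\mathbf r)_{\mathcal T_h}+\langle\widehat u_h,\mathbf r\cdot\mathbf n\rangle_{\partial\mathcal T_h}&=0 &&\forall\mathbf r\in\mathbf V_h,\\ (\mathrm{div}\,\mathbf q_h,w)_{\mathcal T_h}&=(f,w)_{\mathcal T_h}&&\forall w\in W_h,\\ \langle\mathbf q_h\cdot\mathbf n,\mu\rangle_{\partial\mathcal T_h\setminus\Gamma}&=0&&\forall\mu\in M_h^\circ,\\ \langle\widehat u_h,\mu\rangle_\Gamma&=\langle u_0,\mu\rangle_\Gamma&&\forall\mu\in M_h^\Gamma. \end{aligned}$$ The Galerkin system (G) is: find $(\mathbf q_h,u_h)\in\mathbf V_h^{\mathrm{div}}\times W_h$ such that $$\begin{aligned} (\kappa^{-1}\mathbf q_h,\mathbf r)_\Omega-(u_h,\mathrm{div}\,\mathbf r)_\Omega&=-\langle u_0,\mathbf r\cdot\mathbf n\rangle_\Gamma&&\forall\mathbf r\in\mathbf V_h^{\mathrm{div}},\\ (\mathrm{div}\,\mathbf q_h,v)_\Omega&=(f,v)_\Omega&&\forall v\in W_h. \end{aligned}$$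 Then: (a) system (H) has exactly one solution; (b) if $(\mathbf q_h,u_h,\widehat u_h)$ solves (H), then $(\mathbf q_h,u_h)$ solves (G) (in particular $\mathbf q_h\in\mathbf V_h^{\mathrm{div}}$); (c) if $(\mathbf q_h,u_h)$ solves (G), then there is $\widehat u_h\in M_h$ such that $(\mathbf q_h,u_h,\widehat u_h)$ solves (H). -/

import Mathlib

open MeasureTheory Set
open scoped ContDiff

noncomputable section

namespace RTHybrid

/-- The Euclidean space `ℝ^d`. -/
abbrev Space (d : ℕ) : Type := EuclideanSpace ℝ (Fin d)

/-- The closed simplex spanned by a finite set of vertices. -/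
abbrev hull {d : ℕ} (s : Finset (Space d)) : Set (Space d) :=
  convexHull ℝ (s : Set (Space d))

/-- The open simplex: the interior in `ℝ^d` of the closed one. -/
def cell {d : ℕ} (K : Finset (Space d)) : Set (Space d) := interior (hull K)

/-- A conforming partition of `Ω ⊆ ℝ^d` into finitely many nondegenerate `d`-simplices
(triangles for `d = 2`, tetrahedra for `d = 3`). An element is given by its set of `d + 1`
vertices. Two closed elements meet only in the face spanned by their common vertices (nothing
if there is none), and the closed elements cover the closure of `Ω`. -/
structure Triangulation {d : ℕ} (Ω : Set (Space d)) where
  /-- the elements, as sets of vertices -/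
  elems : Finset (Finset (Space d))
  card_eq : ∀ K ∈ elems, K.card = d + 1
  indep : ∀ K ∈ elems, AffineIndependent ℝ (fun x : K => (x : Space d))
  conforming : ∀ K ∈ elems, ∀ L ∈ elems,
    hull K ∩ hull L ⊆ convexHull ℝ ((K : Set (Space d)) ∩ (L : Set (Space d)))
  cover : ⋃ K ∈ elems, hull K = closure Ω

open Classical in
/-- The set of all faces (edges for `d = 2`) of the elements: the `d`-point subsets of the vertex
sets of the elements. A face shared by two elements occurs once. -/
def Triangulation.faces {d : ℕ} {Ω : Set (Space d)} (T : Triangulation Ω) :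
    Finset (Finset (Space d)) :=
  T.elems.biUnion fun K => K.powersetCard d

/-! ### Normal vectors -/

/-- The barycenter of a finite set of points. -/
def barycenter {d : ℕ} (s : Finset (Space d)) : Space d :=
  (s.card : ℝ)⁻¹ • ∑ x ∈ s, x

/-- The unit normal to the face `e` of the simplex `K`, exterior to `K`: the component orthogonal
to the hyperplane of `e` of the vector from the barycenter of `K` to the barycenter of `e`,
normalized. -/
def outwardNormal {d : ℕ} (K e : Finset (Space d)) : Space d :=
  NormedSpace.normalize
    ((vectorSpan ℝ (e : Set (Space d)))ᗮ.starProjection (barycenter e - barycenter K))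

/-! ### Polynomial spaces -/

/-- Polynomials in `d` variables. -/
abbrev Poly (d : ℕ) : Type := MvPolynomial (Fin d) ℝ

/-- The space `P_k` of polynomials of total degree at most `k`. Polynomials on a nondegenerate
simplex are identified with polynomials. -/
def Pk (d k : ℕ) : Submodule ℝ (Poly d) := MvPolynomial.restrictTotalDegree (Fin d) ℝ k

/-- Multiplication of a scalar polynomial by the vector field `m(x) = x`. -/
def mulPosition (d : ℕ) : Poly d →ₗ[ℝ] (Fin d → Poly d) :=
  LinearMap.pi fun i => LinearMap.mulLeft ℝ (MvPolynomial.X i)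

/-- The Raviart-Thomas space `RT_k = (P_k)^d + m P̃_k`, where `P̃_k` are the homogeneous
polynomials of degree `k`. -/
def RT (d k : ℕ) : Submodule ℝ (Fin d → Poly d) :=
  Submodule.pi Set.univ (fun _ => Pk d k) ⊔
    (MvPolynomial.homogeneousSubmodule (Fin d) ℝ k).map (mulPosition d)

/-- The value at a point, as a linear functional on polynomials. -/
def evalAt {d : ℕ} (x : Space d) : Poly d →ₗ[ℝ] ℝ :=
  (MvPolynomial.aeval (fun i => x i) : Poly d →ₐ[ℝ] ℝ).toLinearMap

/-- The value at a point of a polynomial vector field. -/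
def vecEvalAt {d : ℕ} (x : Space d) (q : Fin d → Poly d) : Space d :=
  WithLp.toLp 2 fun i => evalAt x (q i)

/-- The divergence of a polynomial vector field. -/
def polyDiv {d : ℕ} (q : Fin d → Poly d) : Poly d := ∑ i, MvPolynomial.pderiv i (q i)

/-- The space `P_k(e)`, as a space of functions on the (closed) face `e`. Restrictions to a
hyperplane of polynomials of degree at most `k` in `d` variables are the polynomials of degree at
most `k` in `d - 1` tangential coordinates. -/
def facePk {d : ℕ} (k : ℕ) (e : Finset (Space d)) : Submodule ℝ (hull e → ℝ) :=
  (Pk d k).map (LinearMap.pi fun x : hull e => evalAt (x : Space d))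

section Discrete

variable {d : ℕ} {Ω : Set (Space d)}

/-- `V_h = ∏_K RT_k(K)`. -/
abbrev Vh (T : Triangulation Ω) (k : ℕ) : Type := ∀ _ : T.elems, RT d k

/-- `W_h = ∏_K P_k(K)`. -/
abbrev Wh (T : Triangulation Ω) (k : ℕ) : Type := ∀ _ : T.elems, Pk d k

/-- `M_h = ∏_e P_k(e)`. -/
abbrev Mh (T : Triangulation Ω) (k : ℕ) : Type := ∀ e : T.faces, facePk k e.1

/-- A face lies on the boundary `Γ = ∂Ω`; otherwise it is an interior face. -/
def OnBoundary (Ω : Set (Space d)) (e : Finset (Space d)) : Prop := hull e ⊆ frontier Ω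

/-- `M_h° = {μ ∈ M_h : μ = 0 on Γ}`. -/
def MhInterior (T : Triangulation Ω) (k : ℕ) : Set (Mh T k) :=
  {μ | ∀ e : T.faces, OnBoundary Ω e.1 → μ e = 0}

/-- `M_h^Γ = {μ ∈ M_h : μ = 0 on every interior face}`. -/
def MhBoundary (T : Triangulation Ω) (k : ℕ) : Set (Mh T k) :=
  {μ | ∀ e : T.faces, ¬ OnBoundary Ω e.1 → μ e = 0}

/-- The surface integral over a face of a function on that face, with respect to the
`(d-1)`-dimensional surface measure. -/
def faceIntegral (e : Finset (Space d)) (g : hull e → ℝ) : ℝ :=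
  ∫ x, g x ∂(Measure.comap Subtype.val (μHE[d - 1] : Measure (Space d)))

/-- The normal component on the face `e` of the element `K` of a polynomial vector field. -/
def normalTrace (K e : Finset (Space d)) (q : Fin d → Poly d) (x : Space d) : ℝ :=
  inner ℝ (vecEvalAt x q) (outwardNormal K e)

/-! ### The forms of the hybridized system -/

/-- `(κ⁻¹ q, r)_{T_h}` -/
def massForm {T : Triangulation Ω} {k : ℕ} (κ : Space d → ℝ) (q r : Vh T k) : ℝ :=
  ∑ K : T.elems, ∫ x in cell K.1,
    (κ x)⁻¹ * inner ℝ (vecEvalAt x (q K).1) (vecEvalAt x (r K).1)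

/-- `(w, div q)_{T_h}`, with the divergence taken element by element -/
def divForm {T : Triangulation Ω} {k : ℕ} (w : Wh T k) (q : Vh T k) : ℝ :=
  ∑ K : T.elems, ∫ x in cell K.1, evalAt x (w K).1 * evalAt x (polyDiv (q K).1)

/-- `(f, w)_{T_h}` -/
def loadForm {T : Triangulation Ω} {k : ℕ} (f : Space d → ℝ) (w : Wh T k) : ℝ :=
  ∑ K : T.elems, ∫ x in cell K.1, f x * evalAt x (w K).1

open Classical in
/-- `⟨μ, q·n⟩_{∂T_h}`: sum over all elements of the integral over the whole boundary -/
def traceForm {T : Triangulation Ω} {k : ℕ} (μ : Mh T k) (q : Vh T k) : ℝ :=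
  ∑ K : T.elems, ∑ e : T.faces with e.1 ⊆ K.1,
    faceIntegral e.1 fun x => (μ e).1 x * normalTrace K.1 e.1 (q K).1 x

open Classical in
/-- `⟨q·n, μ⟩_{∂T_h ∖ Γ}`: the same sum without the boundary faces -/
def interiorTraceForm {T : Triangulation Ω} {k : ℕ} (q : Vh T k) (μ : Mh T k) : ℝ :=
  ∑ K : T.elems, ∑ e : T.faces with e.1 ⊆ K.1 ∧ ¬ OnBoundary Ω e.1,
    faceIntegral e.1 fun x => normalTrace K.1 e.1 (q K).1 x * (μ e).1 x

open Classical in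
/-- `⟨lam, μ⟩_Γ` for two discrete functions on the skeleton -/
def boundaryForm {T : Triangulation Ω} {k : ℕ} (lam μ : Mh T k) : ℝ :=
  ∑ e : T.faces with OnBoundary Ω e.1, faceIntegral e.1 fun x => (lam e).1 x * (μ e).1 x

open Classical in
/-- `⟨u₀, μ⟩_Γ` -/
def boundaryLoad {T : Triangulation Ω} {k : ℕ} (u₀ : Space d → ℝ) (μ : Mh T k) : ℝ :=
  ∑ e : T.faces with OnBoundary Ω e.1, faceIntegral e.1 fun x => u₀ x * (μ e).1 x

open Classical in
/-- `⟨u₀, q·n⟩_Γ` -/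
def boundaryFluxLoad {T : Triangulation Ω} {k : ℕ} (u₀ : Space d → ℝ) (q : Vh T k) : ℝ :=
  ∑ K : T.elems, ∑ e : T.faces with e.1 ⊆ K.1 ∧ OnBoundary Ω e.1,
    faceIntegral e.1 fun x => u₀ x * normalTrace K.1 e.1 (q K).1 x

/-- The hybridized (Arnold-Brezzi) system for `(q, u, û) ∈ V_h × W_h × M_h`. -/
structure IsHybridSolution (T : Triangulation Ω) (k : ℕ) (κ f u₀ : Space d → ℝ)
    (q : Vh T k) (u : Wh T k) (uhat : Mh T k) : Prop where
  flux : ∀ r : Vh T k, massForm κ q r - divForm u r + traceForm uhat r = 0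
  balance : ∀ w : Wh T k, divForm w q = loadForm f w
  continuity : ∀ μ ∈ MhInterior T k, interiorTraceForm q μ = 0
  dirichlet : ∀ μ ∈ MhBoundary T k, boundaryForm uhat μ = boundaryLoad u₀ μ

/-! ### The space `H(div, Ω)` and the conforming Galerkin equations -/

/-- `g` is the distributional divergence of `q` in `Ω`: `∫_Ω q·∇φ = -∫_Ω g φ` for all
`φ ∈ C_c^∞(Ω)`. -/
def HasWeakDiv (Ω : Set (Space d)) (q : Space d → Space d) (g : Space d → ℝ) : Prop :=
  ∀ φ : Space d → ℝ, ContDiff ℝ ∞ φ → HasCompactSupport φ → tsupport φ ⊆ Ω →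
    ∫ x in Ω, fderiv ℝ φ x (q x) = - ∫ x in Ω, g x * φ x

/-- `q ∈ L²(Ω)^d` and its distributional divergence is in `L²(Ω)`. -/
def MemHdiv (Ω : Set (Space d)) (q : Space d → Space d) : Prop :=
  MemLp q 2 (volume.restrict Ω) ∧
    ∃ g : Space d → ℝ, MemLp g 2 (volume.restrict Ω) ∧ HasWeakDiv Ω q g

open Classical in
/-- The divergence of an element of `H(div, Ω)` (unique up to null sets); zero by convention
for vector fields with no `L²` divergence. -/
def weakDiv (Ω : Set (Space d)) (q : Space d → Space d) : Space d → ℝ :=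
  if h : ∃ g : Space d → ℝ, MemLp g 2 (volume.restrict Ω) ∧ HasWeakDiv Ω q g
  then h.choose else 0

/-- The function on `Ω`, defined up to a null set, that is `u_K` on each (open) element `K`. -/
def scalarFun {T : Triangulation Ω} {k : ℕ} (u : Wh T k) (x : Space d) : ℝ :=
  ∑ K : T.elems, (cell K.1).indicator (fun y => evalAt y (u K).1) x

/-- The vector field on `Ω`, defined up to a null set, that is `q_K` on each (open)
element `K`. -/
def vectorFun {T : Triangulation Ω} {k : ℕ} (q : Vh T k) (x : Space d) : Space d :=
  ∑ K : T.elems, (cell K.1).indicator (fun y => vecEvalAt y (q K).1) x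

/-- `V_h^div = V_h ∩ H(div, Ω)`. -/
def VhDiv (T : Triangulation Ω) (k : ℕ) : Set (Vh T k) :=
  {q | MemHdiv Ω (vectorFun q)}

/-- The conforming Raviart-Thomas Galerkin equations for `(q, u) ∈ V_h^div × W_h`. -/
structure IsGalerkinSolution (T : Triangulation Ω) (k : ℕ) (κ f u₀ : Space d → ℝ)
    (q : Vh T k) (u : Wh T k) : Prop where
  mem : q ∈ VhDiv T k
  flux : ∀ r ∈ VhDiv T k,
    (∫ x in Ω, (κ x)⁻¹ * inner ℝ (vectorFun q x) (vectorFun r x)) -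
      ∫ x in Ω, scalarFun u x * weakDiv Ω (vectorFun r) x = - boundaryFluxLoad u₀ r
  balance : ∀ v : Wh T k,
    ∫ x in Ω, weakDiv Ω (vectorFun q) x * scalarFun v x = ∫ x in Ω, f x * scalarFun v x

end Discrete

end RTHybrid

end

/-! System (H) is a square linear system on a finite-dimensional space, so (a) reduces to uniqueness
for zero data. Testing with the solution itself gives `(κ⁻¹ q, q) = 0`, hence `q = 0`. What remains
is a rigidity statement: if `(u, div r) = ⟨μ, r·n⟩` for every `r ∈ V_h` and `μ` vanishes on `Γ`,
then `u = 0` and `μ = 0`.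

Rigidity is proved with the fields `p (x - a)`, where `a` is a vertex of `K` and `p ∈ P_k`. Such a
field is tangential to every face through `a`, and its normal component on the opposite face is `p`
times the height. Green's formula becomes `∫_K ∇u·(x - a) p = h_a ∫_{e_a} (u - μ) p`
(`integral_radial_deriv`). Taking `p = -λ_a ∇u·a`, with `λ_a` the barycentric coordinate of `a`,
removes the face term. The sum over `a` is then the integral of the variance of the numbers `∇u·a`
under the weights `λ_a`, so `∇u = 0` on each element (`fderiv_eq_zero_of_rigid`). Taking `p = u - μ`
next gives `μ = u` on every face (`trace_eq_of_rigid`). Finally Green's formula for `u²` and the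
position field gives `d ‖u‖² = Σ_e ∫_e μ² [x·n] = 0`: `x` has no normal jump on interior faces, and
`μ` is zero on the others (`eq_zero_of_rigid`).

The link between (H) and (G) is that a piecewise polynomial field lies in `H(div, Ω)` exactly when
its normal jumps vanish on the faces not contained in `Γ` (`memHdiv_iff`). The third equation of (H)
says the same, since the jump of a Raviart-Thomas field is itself an admissible multiplier. For `r ∈
V_h^div` the trace term sees only `Γ`, where the Dirichlet equation replaces `û` by `u₀`; this is
(b).

For (c), (G) has at most one solution. The flux is handled by energy. For the scalar, the
surjectivity of the divergence `V_h^div → W_h` is read off from (a) with `κ = 1`. A solution of (G)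
must then be the one that (b) produces from (H), and its `û` can be used.

The analytic base is the divergence theorem on a simplex for the Hausdorff surface measure
(`IsSimplex.integral_fderiv`), obtained from the fundamental theorem of calculus along edges. -/

namespace RTHybrid

open scoped Classical

/-! ### Simplices -/

section Simplex

variable {d : ℕ} {K e : Finset (Space d)} {a b x y : Space d}

/-- `K` is the vertex set of a nondegenerate `d`-simplex in `ℝ^d`. -/
structure IsSimplex (K : Finset (Space d)) : Prop where
  card_eq : K.card = d + 1
  indep : AffineIndependent ℝ (fun x : K => (x : Space d))

theorem isSimplex_of_mem {Ω : Set (Space d)} (T : Triangulation Ω) (hK : K ∈ T.elems) :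
    IsSimplex K := ⟨T.card_eq K hK, T.indep K hK⟩

theorem IsSimplex.card_erase (hK : IsSimplex K) (ha : a ∈ K) : (K.erase a).card = d := by
  rw [Finset.card_erase_of_mem ha, hK.card_eq]; simp

theorem inner_outwardNormal_of_mem_vectorSpan {v : Space d}
    (hv : v ∈ vectorSpan ℝ (e : Set (Space d))) : inner ℝ v (outwardNormal K e) = 0 := by
  unfold outwardNormal NormedSpace.normalize
  rw [inner_smul_right]
  have := Submodule.starProjection_apply_mem (vectorSpan ℝ (e : Set (Space d)))ᗮ
    (barycenter e - barycenter K)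
  rw [(Submodule.mem_orthogonal _ _).1 this v hv, mul_zero]

theorem sub_mem_vectorSpan_of_mem_hull (hx : x ∈ hull e) (hy : y ∈ hull e) :
    x - y ∈ vectorSpan ℝ (e : Set (Space d)) := by
  rw [← direction_affineSpan]
  exact AffineSubspace.vsub_mem_direction (convexHull_subset_affineSpan _ hx)
    (convexHull_subset_affineSpan _ hy)

theorem inner_sub_outwardNormal (hx : x ∈ hull e) (hy : y ∈ hull e) :
    inner ℝ (x - y) (outwardNormal K e) = 0 :=
  inner_outwardNormal_of_mem_vectorSpan (sub_mem_vectorSpan_of_mem_hull hx hy)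

theorem barycenter_mem_hull (he : e.Nonempty) : barycenter e ∈ hull e := by
  rw [Finset.mem_convexHull']
  refine ⟨fun _ => (e.card : ℝ)⁻¹, fun _ _ => by positivity, ?_, ?_⟩
  · have : (e.card : ℝ) ≠ 0 := by exact_mod_cast he.card_ne_zero
    simp [this]
  · rw [barycenter, Finset.smul_sum]

theorem IsSimplex.erase_nonempty (hK : IsSimplex K) (hd : d ≠ 0) (ha : a ∈ K) :
    (K.erase a).Nonempty := by
  rw [← Finset.card_pos, hK.card_erase ha]; omega

/-- The barycenter of `K` lies on the segment from `a` to the barycenter of the opposite face. The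
vector that defines the normal may therefore be replaced by one starting at `a`. -/
theorem IsSimplex.barycenter_sub (hK : IsSimplex K) (hd : d ≠ 0) (ha : a ∈ K) :
    barycenter (K.erase a) - barycenter K =
      ((d : ℝ) + 1)⁻¹ • (barycenter (K.erase a) - a) := by
  have h1 : ∑ x ∈ K, x = (d : ℝ) • barycenter (K.erase a) + a := by
    rw [barycenter, hK.card_erase ha, smul_smul, mul_inv_cancel₀ (by exact_mod_cast hd), one_smul,
      Finset.sum_erase_add _ _ ha]
  have h2 : barycenter K = ((d : ℝ) + 1)⁻¹ • ((d : ℝ) • barycenter (K.erase a) + a) := by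
    rw [barycenter, h1, hK.card_eq]; push_cast; rfl
  have h3 : ((d : ℝ) + 1)⁻¹ * ((d : ℝ) + 1) = 1 := inv_mul_cancel₀ (by positivity)
  rw [h2]
  have h4 : barycenter (K.erase a) =
      (((d : ℝ) + 1)⁻¹ * ((d : ℝ) + 1)) • barycenter (K.erase a) := by rw [h3, one_smul]
  nth_rewrite 1 [h4]
  rw [mul_smul]
  module

theorem IsSimplex.notMem_affineSpan_erase (hK : IsSimplex K) (ha : a ∈ K) :
    a ∉ affineSpan ℝ ((K.erase a : Finset (Space d)) : Set (Space d)) := by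
  have := hK.indep.notMem_affineSpan_sdiff ⟨a, ha⟩ Set.univ
  convert this using 3
  ext z
  constructor
  · intro hz
    have hz' := Finset.mem_erase.1 (Finset.mem_coe.1 hz)
    exact ⟨⟨z, hz'.2⟩, by simpa using hz'.1, rfl⟩
  · rintro ⟨w, hw, rfl⟩
    have : (w : Space d) ≠ a := fun h => hw.2 (by
      rw [Set.mem_singleton_iff]; exact Subtype.ext h)
    simp [this]

/-- The height of the vertex `a` of the simplex `K` over the opposite face. -/
noncomputable def height (K : Finset (Space d)) (a : Space d) : ℝ :=
  inner ℝ (barycenter (K.erase a) - a) (outwardNormal K (K.erase a))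

/-- Otherwise `a` would lie in the affine span of the opposite face, against affine independence. -/
theorem IsSimplex.starProjection_ne_zero (hK : IsSimplex K) (hd : d ≠ 0) (ha : a ∈ K) :
    (vectorSpan ℝ ((K.erase a : Finset (Space d)) : Set (Space d)))ᗮ.starProjection
      (barycenter (K.erase a) - a) ≠ 0 := by
  intro h
  rw [Submodule.starProjection_apply_eq_zero_iff, Submodule.orthogonal_orthogonal] at h
  refine hK.notMem_affineSpan_erase ha ?_
  have hb := convexHull_subset_affineSpan _ (barycenter_mem_hull (hK.erase_nonempty hd ha))
  rw [← direction_affineSpan] at h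
  have := AffineSubspace.vadd_mem_of_mem_direction (neg_mem h) hb
  simpa using this

theorem IsSimplex.outwardNormal_eq (hK : IsSimplex K) (hd : d ≠ 0) (ha : a ∈ K) :
    outwardNormal K (K.erase a) = NormedSpace.normalize
      ((vectorSpan ℝ ((K.erase a : Finset (Space d)) : Set (Space d)))ᗮ.starProjection
        (barycenter (K.erase a) - a)) := by
  unfold outwardNormal
  rw [hK.barycenter_sub hd ha, map_smul, NormedSpace.normalize_smul_of_pos (by positivity)]

theorem IsSimplex.norm_outwardNormal (hK : IsSimplex K) (hd : d ≠ 0) (ha : a ∈ K) :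
    ‖outwardNormal K (K.erase a)‖ = 1 := by
  rw [hK.outwardNormal_eq hd ha]
  exact NormedSpace.norm_normalize (hK.starProjection_ne_zero hd ha)

/-- An orthogonal projection is self-adjoint and idempotent, so the height is the norm of the
projected vector. -/
theorem IsSimplex.height_pos (hK : IsSimplex K) (hd : d ≠ 0) (ha : a ∈ K) : 0 < height K a := by
  have h0 := hK.starProjection_ne_zero hd ha
  unfold height
  rw [hK.outwardNormal_eq hd ha]
  unfold NormedSpace.normalize
  rw [inner_smul_right]
  set W := (vectorSpan ℝ ((K.erase a : Finset (Space d)) : Set (Space d)))ᗮ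
  set w := W.starProjection (barycenter (K.erase a) - a) with hw
  have h1 : W.starProjection w = w :=
    Submodule.starProjection_eq_self_iff.2 (Submodule.starProjection_apply_mem _ _)
  have h2 : inner ℝ w w = inner ℝ (barycenter (K.erase a) - a) w := by
    conv_lhs => rw [hw, Submodule.inner_starProjection_left_eq_right, ← hw, h1]
  rw [← h2, real_inner_self_eq_norm_sq]
  have := norm_pos_iff.2 h0
  positivity

theorem IsSimplex.inner_sub_apex (hK : IsSimplex K) (hd : d ≠ 0) (ha : a ∈ K)
    (hx : x ∈ hull (K.erase a)) :
    inner ℝ (x - a) (outwardNormal K (K.erase a)) = height K a := by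
  have := inner_sub_outwardNormal (K := K) hx (barycenter_mem_hull (hK.erase_nonempty hd ha))
  rw [height, ← sub_eq_zero, ← inner_sub_left, ← this]
  congr 1; abel

/-- The barycentric coordinate of the vertex `a` in the simplex `K`. -/
noncomputable def coord (K : Finset (Space d)) (a x : Space d) : ℝ :=
  1 - inner ℝ (x - a) (outwardNormal K (K.erase a)) / height K a

/-- Every vertex `b ≠ a` has `⟨b - a, n⟩` equal to the height, so this affine function picks out the
weight of `a`. Barycentric coordinates are thereby expressed through the outward normals. -/
theorem IsSimplex.coord_sum (hK : IsSimplex K) (hd : d ≠ 0) (ha : a ∈ K) (w : Space d → ℝ)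
    (hw : ∑ b ∈ K, w b = 1) : coord K a (∑ b ∈ K, w b • b) = w a := by
  have hh := (hK.height_pos hd ha).ne'
  have h1 : inner ℝ (∑ b ∈ K, w b • b - a) (outwardNormal K (K.erase a)) =
      ∑ b ∈ K, w b * inner ℝ (b - a) (outwardNormal K (K.erase a)) := by
    have : ∑ b ∈ K, w b • b - a = ∑ b ∈ K, w b • (b - a) := by
      simp only [smul_sub, Finset.sum_sub_distrib, ← Finset.sum_smul, hw, one_smul]
    rw [this, sum_inner]
    simp [inner_smul_left]
  have h2 : ∑ b ∈ K, w b * inner ℝ (b - a) (outwardNormal K (K.erase a)) =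
      (1 - w a) * height K a := by
    rw [← Finset.sum_erase_add _ _ ha, sub_self, inner_zero_left, mul_zero, add_zero, ← hw,
      ← Finset.sum_erase_add _ _ ha, add_sub_cancel_right, Finset.sum_mul]
    refine Finset.sum_congr rfl fun b hb => ?_
    rw [hK.inner_sub_apex hd ha (subset_convexHull _ _ (Finset.mem_coe.2 hb))]
  rw [coord, h1, h2]
  field_simp
  ring

theorem IsSimplex.coord_nonneg (hK : IsSimplex K) (hd : d ≠ 0) (ha : a ∈ K) (hx : x ∈ hull K) :
    0 ≤ coord K a x := by
  obtain ⟨w, h0, h1, rfl⟩ := Finset.mem_convexHull'.1 hx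
  rw [hK.coord_sum hd ha w h1]
  exact h0 a ha

theorem IsSimplex.sum_coord (hK : IsSimplex K) (hd : d ≠ 0) (hx : x ∈ hull K) :
    ∑ a ∈ K, coord K a x = 1 := by
  obtain ⟨w, h0, h1, rfl⟩ := Finset.mem_convexHull'.1 hx
  rw [← h1]
  exact Finset.sum_congr rfl fun a ha => hK.coord_sum hd ha w h1

theorem IsSimplex.sum_coord_smul (hK : IsSimplex K) (hd : d ≠ 0) (hx : x ∈ hull K) :
    ∑ a ∈ K, coord K a x • a = x := by
  obtain ⟨w, h0, h1, rfl⟩ := Finset.mem_convexHull'.1 hx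
  exact Finset.sum_congr rfl fun a ha => by rw [hK.coord_sum hd ha w h1]

theorem IsSimplex.coord_eq_zero (hK : IsSimplex K) (hd : d ≠ 0) (ha : a ∈ K)
    (hx : x ∈ hull (K.erase a)) : coord K a x = 0 := by
  rw [coord, hK.inner_sub_apex hd ha hx, div_self (hK.height_pos hd ha).ne', sub_self]

/-- A short move along the outward normal stays in `K` and strictly lowers the coordinate, which is
still nonnegative there. -/
theorem IsSimplex.coord_pos (hK : IsSimplex K) (hd : d ≠ 0) (ha : a ∈ K) (hx : x ∈ cell K) :
    0 < coord K a x := by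
  have hh := hK.height_pos hd ha
  set n := outwardNormal K (K.erase a)
  have hcont : ContinuousAt (fun t : ℝ => x + t • n) 0 := by fun_prop
  have hmem : cell K ∈ nhds ((fun t : ℝ => x + t • n) 0) := by
    simp only [zero_smul, add_zero]
    exact IsOpen.mem_nhds isOpen_interior hx
  obtain ⟨ε, hε, hball⟩ := Metric.mem_nhds_iff.1 (hcont hmem)
  have h1 : x + (ε / 2) • n ∈ hull K := interior_subset (hball (by
    rw [Metric.mem_ball, Real.dist_eq, sub_zero, abs_of_pos (by positivity)]; linarith))
  have h2 := hK.coord_nonneg hd ha h1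
  have h3 : inner ℝ (x + (ε / 2) • n - a) n = inner ℝ (x - a) n + ε / 2 := by
    rw [add_sub_right_comm, inner_add_left, inner_smul_left, real_inner_self_eq_norm_sq,
      hK.norm_outwardNormal hd ha]
    simp
  rw [coord, h3] at h2
  rw [coord]
  have : 0 < ε / 2 / height K a := by positivity
  rw [add_div] at h2
  linarith

theorem IsSimplex.cell_nonempty (hK : IsSimplex K) : (cell K).Nonempty := by
  unfold cell hull
  rw [interior_convexHull_nonempty_iff_affineSpan_eq_top]
  have := hK.indep.affineSpan_eq_top_iff_card_eq_finrank_add_one.2 (by simp [hK.card_eq])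
  simpa using this

theorem isClosed_hull (e : Finset (Space d)) : IsClosed (hull e) :=
  (e.finite_toSet.isCompact_convexHull ℝ).isClosed

theorem isCompact_hull (e : Finset (Space d)) : IsCompact (hull e) :=
  e.finite_toSet.isCompact_convexHull ℝ

theorem cell_subset_hull : cell K ⊆ hull K := interior_subset

theorem isOpen_cell : IsOpen (cell K) := isOpen_interior

theorem cell_ae_eq_hull : cell K =ᵐ[volume] hull K :=
  interior_ae_eq_of_null_frontier ((convex_convexHull ℝ _).addHaar_frontier volume)

theorem hull_erase_subset : hull (K.erase a) ⊆ hull K :=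
  convexHull_mono (by simp)

theorem mem_powersetCard_iff (hK : IsSimplex K) :
    e ∈ K.powersetCard d ↔ ∃ a ∈ K, K.erase a = e := by
  rw [Finset.mem_powersetCard]
  constructor
  · rintro ⟨h1, h2⟩
    have h3 : (K \ e).card = 1 := by rw [Finset.card_sdiff_of_subset h1, hK.card_eq, h2]; omega
    obtain ⟨a, ha⟩ := Finset.card_eq_one.1 h3
    have haK : a ∈ K \ e := by rw [ha]; simp
    refine ⟨a, (Finset.mem_sdiff.1 haK).1, ?_⟩
    rw [Finset.erase_eq, ← ha, Finset.sdiff_sdiff_eq_self h1]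
  · rintro ⟨a, ha, rfl⟩
    exact ⟨Finset.erase_subset _ _, hK.card_erase ha⟩

theorem sum_powersetCard {M : Type*} [AddCommMonoid M] (hK : IsSimplex K)
    (F : Finset (Space d) → M) : ∑ e ∈ K.powersetCard d, F e = ∑ a ∈ K, F (K.erase a) := by
  have : K.powersetCard d = K.image fun a => K.erase a := by
    ext e; rw [mem_powersetCard_iff hK]; simp
  rw [this, Finset.sum_image (Finset.erase_injOn _)]

end Simplex

/-! ### Elements of the mesh -/

section Mesh

variable {d : ℕ} {Ω : Set (Space d)} (T : Triangulation Ω) {K L e : Finset (Space d)}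

/-- By conformity a common point lies in the hull of the common vertices, hence in a proper face of
`K`, where one barycentric coordinate vanishes; in the open cell all are positive. -/
theorem disjoint_cell (hd : d ≠ 0) (hK : K ∈ T.elems) (hL : L ∈ T.elems) (hne : K ≠ L) :
    Disjoint (cell K) (hull L) := by
  rw [Set.disjoint_left]
  intro x hxK hxL
  have h1 := T.conforming K hK L hL ⟨interior_subset hxK, hxL⟩
  have hKs := isSimplex_of_mem T hK
  obtain ⟨a, haK, haL⟩ : ∃ a ∈ K, a ∉ L := by
    by_contra! h
    exact hne (Finset.eq_of_subset_of_card_le h (by rw [T.card_eq K hK, T.card_eq L hL]))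
  have h2 : x ∈ hull (K.erase a) := by
    refine convexHull_mono ?_ h1
    rintro y ⟨hy1, hy2⟩
    rw [Finset.mem_coe] at *
    exact Finset.mem_erase.2 ⟨fun h => haL (h ▸ hy2), hy1⟩
  exact (hKs.coord_pos hd haK hxK).ne' (hKs.coord_eq_zero hd haK h2)

theorem hull_subset_closure (hK : K ∈ T.elems) : hull K ⊆ closure Ω := by
  rw [← T.cover]; exact Set.subset_biUnion_of_mem (u := fun K => hull K) hK

theorem cell_subset (hreg : interior (closure Ω) = Ω) (hK : K ∈ T.elems) : cell K ⊆ Ω := by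
  rw [← hreg]; exact interior_mono (hull_subset_closure T hK)

theorem mem_faces : e ∈ T.faces ↔ ∃ K ∈ T.elems, e ⊆ K ∧ e.card = d := by
  simp [Triangulation.faces, Finset.mem_powersetCard]

end Mesh

end RTHybrid

namespace RTHybrid

open scoped Classical ENNReal Pointwise

/-! ### Surface measure on a parametrized piece of a hyperplane -/

section Surface

variable {d : ℕ} {ι : Type*} [Fintype ι]

theorem equiv_prod_apply {ι : Type*} (Ψ : ((ι → ℝ) × ℝ) ≃ₗ[ℝ] Space d) (y : ι → ℝ) (s : ℝ) :
    Ψ (y, s) = Ψ (y, 0) + s • Ψ (0, 1) := by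
  rw [← map_smul, ← map_add]; simp

theorem inner_transversal_ne_zero {ι : Type*} (Ψ : ((ι → ℝ) × ℝ) ≃ₗ[ℝ] Space d)
    {n : Space d} (hn : ‖n‖ = 1)
    (hΨ : ∀ y, inner ℝ (Ψ (y, 0)) n = 0) : inner ℝ (Ψ (0, 1)) n ≠ 0 := by
  intro h
  obtain ⟨⟨y, s⟩, hys⟩ := Ψ.surjective n
  have : inner ℝ n n = (0 : ℝ) := by
    nth_rewrite 1 [← hys]
    rw [equiv_prod_apply, inner_add_left, hΨ, inner_smul_left, h]; simp
  rw [real_inner_self_eq_norm_sq, hn] at this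
  norm_num at this

theorem measurableEmbedding_linearEquiv (Ψ : ((ι → ℝ) × ℝ) ≃ₗ[ℝ] Space d) :
    MeasurableEmbedding Ψ :=
  Ψ.toContinuousLinearEquiv.toHomeomorph.measurableEmbedding

/-- Slicing by the hyperplanes orthogonal to `n`, each nonempty slice is a translate of the base,
and the admissible levels form an interval of length `|⟨Ψ (0, 1), n⟩|`. This fixes the normalization
of the surface measure relative to the volume. -/
theorem volume_cylinder (Ψ : ((ι → ℝ) × ℝ) ≃ₗ[ℝ] Space d)
    {n : Space d} (hn : ‖n‖ = 1)
    (hΨ : ∀ y, inner ℝ (Ψ (y, 0)) n = 0) {A : Set (ι → ℝ)} (hA : MeasurableSet A) :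
    volume (Ψ '' (A ×ˢ Icc (0 : ℝ) 1)) =
      ENNReal.ofReal |inner ℝ (Ψ (0, 1)) n| * μHE[d - 1] ((fun y => Ψ (y, 0)) '' A) := by
  set c : ℝ := inner ℝ (Ψ (0, 1)) n with hc
  have hc0 : c ≠ 0 := inner_transversal_ne_zero Ψ hn hΨ
  have hn0 : n ≠ 0 := by intro h; simp [h] at hn
  have hm : MeasurableSet (Ψ '' (A ×ˢ Icc (0 : ℝ) 1)) :=
    (measurableEmbedding_linearEquiv Ψ).measurableSet_image.2 (hA.prod measurableSet_Icc)
  have key := EuclideanGeometry.euclideanHausdorffMeasure_eq_lintegral (0 : Space d) hn0 hm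
  rw [InnerProductSpace.euclideanHausdorffMeasure_eq_volume] at key
  rw [key]
  have hslice : ∀ x : ℝ, Ψ '' (A ×ˢ Icc (0 : ℝ) 1) ∩
      (AffineSubspace.mk' (x • n +ᵥ (0 : Space d)) (ℝ ∙ n)ᗮ : Set (Space d)) =
      if x * c⁻¹ ∈ Icc (0 : ℝ) 1 then ((x * c⁻¹) • Ψ (0, 1)) +ᵥ ((fun y => Ψ (y, 0)) '' A) else ∅ := by
    intro x
    ext z
    have hz : ∀ y s, Ψ (y, s) ∈ (AffineSubspace.mk' (x • n +ᵥ (0 : Space d)) (ℝ ∙ n)ᗮ :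
        Set (Space d)) ↔ s = x * c⁻¹ := by
      intro y s
      rw [SetLike.mem_coe, AffineSubspace.mem_mk', Submodule.mem_orthogonal_singleton_iff_inner_left,
        vadd_eq_add, add_zero, vsub_eq_sub, inner_sub_left, equiv_prod_apply, inner_add_left, hΨ,
        inner_smul_left, inner_smul_left, real_inner_self_eq_norm_sq, hn, ← hc]
      simp only [conj_trivial]
      rw [eq_mul_inv_iff_mul_eq₀ hc0]
      constructor <;> intro h <;> linarith
    constructor
    · rintro ⟨⟨⟨y, s⟩, ⟨hy, hs⟩, rfl⟩, h2⟩
      have h3 := (hz y s).1 h2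
      simp only at hs
      rw [h3] at hs
      rw [if_pos hs]
      refine ⟨Ψ (y, 0), ⟨y, hy, rfl⟩, ?_⟩
      simp only [vadd_eq_add]
      rw [equiv_prod_apply Ψ y s, h3, add_comm]
    · intro h
      split_ifs at h with hx
      · obtain ⟨_, ⟨y, hy, rfl⟩, rfl⟩ := h
        change (x * c⁻¹) • Ψ (0, 1) + Ψ (y, 0) ∈ _
        rw [add_comm, ← equiv_prod_apply Ψ]
        exact ⟨⟨_, ⟨hy, hx⟩, rfl⟩, (hz _ _).2 rfl⟩
      · exact h.elim
  have hint : ∀ x : ℝ, μHE[Module.finrank ℝ (Space d) - 1] (Ψ '' (A ×ˢ Icc (0 : ℝ) 1) ∩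
      (AffineSubspace.mk' (x • n +ᵥ (0 : Space d)) (ℝ ∙ n)ᗮ : Set (Space d))) =
      ((fun x : ℝ => x * c⁻¹) ⁻¹' Icc (0 : ℝ) 1).indicator
        (fun _ => μHE[d - 1] ((fun y => Ψ (y, 0)) '' A)) x := by
    intro x
    rw [hslice x, finrank_euclideanSpace_fin]
    by_cases hx : x * c⁻¹ ∈ Icc (0 : ℝ) 1
    · rw [if_pos hx, indicator_of_mem (by exact hx), measure_vadd]
    · rw [if_neg hx, indicator_of_notMem (by exact hx), measure_empty]
  simp_rw [hint]
  rw [lintegral_indicator (measurableSet_Icc.preimage (by fun_prop)), setLIntegral_const,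
    Real.volume_preimage_mul_right (inv_ne_zero hc0), enorm_eq_nnnorm]
  have : ‖n‖₊ = 1 := by ext; simpa using hn
  rw [this]
  simp [mul_comm]

/-- The volume scaling factor of a linear equivalence with `ℝ^d`. -/
theorem exists_volume_image_eq (Ψ : ((ι → ℝ) × ℝ) ≃ₗ[ℝ] Space d) :
    ∃ D : ℝ, 0 < D ∧ (volume : Measure (Space d)) =
      ENNReal.ofReal D • (volume : Measure ((ι → ℝ) × ℝ)).map Ψ := by
  have : (volume : Measure ((ι → ℝ) × ℝ)).IsAddHaarMeasure := by
    rw [Measure.volume_eq_prod]; infer_instance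
  have : ((volume : Measure ((ι → ℝ) × ℝ)).map Ψ).IsAddHaarMeasure :=
    Ψ.toContinuousLinearEquiv.isAddHaarMeasure_map _
  have h := Measure.isAddLeftInvariant_eq_smul (volume : Measure (Space d))
    ((volume : Measure ((ι → ℝ) × ℝ)).map Ψ)
  refine ⟨_, NNReal.coe_pos.2 (Measure.addHaarScalarFactor_pos_of_isAddHaarMeasure
    (volume : Measure (Space d)) ((volume : Measure ((ι → ℝ) × ℝ)).map Ψ)), ?_⟩
  rw [ENNReal.ofReal_coe_nnreal]
  exact h

/-- The volume of the same cylinder is computed twice, by slicing and through the scaling factor `D`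
of `Ψ`. The value of `D` is never needed. -/
theorem surface_measure_image (Ψ : ((ι → ℝ) × ℝ) ≃ₗ[ℝ] Space d)
    {n : Space d} (hn : ‖n‖ = 1)
    (hΨ : ∀ y, inner ℝ (Ψ (y, 0)) n = 0) {D : ℝ}
    (hD : (volume : Measure (Space d)) = ENNReal.ofReal D • (volume : Measure ((ι → ℝ) × ℝ)).map Ψ)
    {A : Set (ι → ℝ)} (hA : MeasurableSet A) :
    ENNReal.ofReal |inner ℝ (Ψ (0, 1)) n| * μHE[d - 1] ((fun y => Ψ (y, 0)) '' A) =
      ENNReal.ofReal D * volume A := by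
  rw [← volume_cylinder Ψ hn hΨ hA, hD, Measure.smul_apply,
    (measurableEmbedding_linearEquiv Ψ).map_apply, Ψ.injective.preimage_image,
    Measure.volume_eq_prod, Measure.prod_prod]
  simp

theorem surface_measure_restrict (Ψ : ((ι → ℝ) × ℝ) ≃ₗ[ℝ] Space d)
    {n : Space d} (hn : ‖n‖ = 1)
    (hΨ : ∀ y, inner ℝ (Ψ (y, 0)) n = 0) {D : ℝ}
    (hD : (volume : Measure (Space d)) = ENNReal.ofReal D • (volume : Measure ((ι → ℝ) × ℝ)).map Ψ)
    (b : Space d) {A : Set (ι → ℝ)} (hA : MeasurableSet A) :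
    (μHE[d - 1] : Measure (Space d)).restrict ((fun y => b + Ψ (y, 0)) '' A) =
      ENNReal.ofReal (D / |inner ℝ (Ψ (0, 1)) n|) •
        (volume.restrict A).map (fun y => b + Ψ (y, 0)) := by
  have hcont : Continuous fun y : ι → ℝ => b + Ψ (y, 0) :=
    continuous_const.add (Ψ.toContinuousLinearEquiv.continuous.comp (by fun_prop))
  have hc0 : 0 < |inner ℝ (Ψ (0, 1)) n| := abs_pos.2 (inner_transversal_ne_zero Ψ hn hΨ)
  have hc1 : ENNReal.ofReal |inner ℝ (Ψ (0, 1)) n| ≠ 0 := by simpa using hc0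
  ext B hB
  rw [Measure.restrict_apply hB, Measure.smul_apply, Measure.map_apply hcont.measurable hB,
    Measure.restrict_apply (hcont.measurable hB), ENNReal.ofReal_div_of_pos hc0]
  have h1 := surface_measure_image Ψ hn hΨ hD ((hcont.measurable hB).inter hA)
  have h2 : B ∩ (fun y => b + Ψ (y, 0)) '' A =
      b +ᵥ ((fun y => Ψ (y, 0)) '' ((fun y => b + Ψ (y, 0)) ⁻¹' B ∩ A)) := by
    ext z
    constructor
    · rintro ⟨hz, y, hy, rfl⟩
      exact ⟨Ψ (y, 0), ⟨y, ⟨hz, hy⟩, rfl⟩, rfl⟩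
    · rintro ⟨_, ⟨y, ⟨hy1, hy2⟩, rfl⟩, rfl⟩
      exact ⟨hy1, y, hy2, rfl⟩
  rw [h2, measure_vadd, smul_eq_mul, div_eq_mul_inv, mul_right_comm, ← h1, mul_right_comm,
    ENNReal.mul_inv_cancel hc1 ENNReal.ofReal_ne_top, one_mul]

end Surface

end RTHybrid

namespace RTHybrid

open scoped Classical ENNReal

/-! ### The divergence theorem on a simplex -/

section Gauss

variable {d : ℕ} {K Q : Finset (Space d)} {a b c x : Space d}

theorem IsSimplex.inner_vertex_sub (hb : b ∈ K) (hc : c ∈ K) (hba : b ≠ a) (hca : c ≠ a) :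
    inner ℝ (b - c) (outwardNormal K (K.erase a)) = 0 :=
  inner_sub_outwardNormal (subset_convexHull _ _ (by simp [hb, hba]))
    (subset_convexHull _ _ (by simp [hc, hca]))

theorem IsSimplex.inner_vertex_sub_apex (hK : IsSimplex K) (hd : d ≠ 0) (ha : a ∈ K) (hb : b ∈ K)
    (hba : b ≠ a) : inner ℝ (b - a) (outwardNormal K (K.erase a)) = height K a :=
  hK.inner_sub_apex hd ha (subset_convexHull _ _ (by simp [hb, hba]))

theorem mem_hull_insert (hb : b ∉ Q) :
    x ∈ hull (insert b Q) ↔ ∃ w : Space d → ℝ, (∀ i ∈ Q, 0 ≤ w i) ∧ ∑ i ∈ Q, w i ≤ 1 ∧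
      b + ∑ i ∈ Q, w i • (i - b) = x := by
  have key : ∀ w : Space d → ℝ, ∑ i ∈ Q, w i • (i - b) = ∑ i ∈ Q, w i • i - (∑ i ∈ Q, w i) • b := by
    intro w
    simp only [smul_sub, Finset.sum_sub_distrib, Finset.sum_smul]
  rw [Finset.mem_convexHull']
  constructor
  · rintro ⟨w, h0, h1, h2⟩
    rw [Finset.sum_insert hb] at h1 h2
    refine ⟨w, fun i hi => h0 i (Finset.mem_insert_of_mem hi), ?_, ?_⟩
    · have := h0 b (Finset.mem_insert_self _ _)
      linarith
    · have h3 : w b = 1 - ∑ i ∈ Q, w i := by linarith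
      rw [key, ← h2, h3]
      module
  · rintro ⟨w, h0, h1, rfl⟩
    have hne : ∀ i ∈ Q, Function.update w b (1 - ∑ i ∈ Q, w i) i = w i := fun i hi =>
      Function.update_of_ne (by rintro rfl; exact hb hi) _ _
    refine ⟨Function.update w b (1 - ∑ i ∈ Q, w i), ?_, ?_, ?_⟩
    · intro i hi
      rcases Finset.mem_insert.1 hi with rfl | hi
      · simpa using h1
      · rw [hne i hi]; exact h0 i hi
    · rw [Finset.sum_insert hb, Finset.sum_congr rfl hne]; simp
    · have : ∑ i ∈ Q, Function.update w b (1 - ∑ i ∈ Q, w i) i • i = ∑ i ∈ Q, w i • i :=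
        Finset.sum_congr rfl fun i hi => by rw [hne i hi]
      rw [Finset.sum_insert hb, this, key]
      simp only [Function.update_self]
      module

/-- The linear part of the parametrization of a simplex with vertex `b` and edges to `Q`. -/
noncomputable def edgeMap (b : Space d) (Q : Finset (Space d)) : (Q → ℝ) →ₗ[ℝ] Space d :=
  Fintype.linearCombination ℝ fun i : Q => (i : Space d) - b

theorem edgeMap_apply (y : Q → ℝ) :
    edgeMap b Q y = ∑ i : Q, y i • ((i : Space d) - b) := Fintype.linearCombination_apply ..

/-- The corner simplex of nonnegative vectors with coordinate sum at most one. -/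
def cornerSimplex (ι : Type*) [Fintype ι] : Set (ι → ℝ) := {y | (∀ i, 0 ≤ y i) ∧ ∑ i, y i ≤ 1}

theorem isClosed_cornerSimplex (ι : Type*) [Fintype ι] : IsClosed (cornerSimplex ι) := by
  simp only [cornerSimplex, ofPred_and, ofPred_forall]
  exact (isClosed_iInter fun i => isClosed_le continuous_const (continuous_apply i)).inter
    (isClosed_le (by fun_prop) continuous_const)

theorem isCompact_cornerSimplex (ι : Type*) [Fintype ι] : IsCompact (cornerSimplex ι) := by
  refine (isCompact_univ_pi fun _ : ι => isCompact_Icc (a := (0 : ℝ)) (b := 1)).of_isClosed_subset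
    (isClosed_cornerSimplex ι) ?_
  intro y hy i _
  exact ⟨hy.1 i, (Finset.single_le_sum (fun j _ => hy.1 j) (Finset.mem_univ i)).trans hy.2⟩

theorem sum_extend {M : Type*} [AddCommMonoid M] (y : Q → ℝ) (F : ℝ → Space d → M) :
    ∑ i ∈ Q, F (if h : i ∈ Q then y ⟨i, h⟩ else 0) i = ∑ i : Q, F (y i) i := by
  rw [← Finset.sum_coe_sort]
  exact Finset.sum_congr rfl fun i _ => by simp

theorem hull_insert_eq_image (hb : b ∉ Q) :
    hull (insert b Q) = (fun y => b + edgeMap b Q y) '' cornerSimplex Q := by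
  ext x
  rw [mem_hull_insert hb]
  constructor
  · rintro ⟨w, h0, h1, rfl⟩
    refine ⟨fun i => w i, ⟨fun i => h0 i i.2, ?_⟩, ?_⟩
    · rwa [Finset.sum_coe_sort Q w]
    · simp only [edgeMap_apply]
      rw [Finset.sum_coe_sort Q fun i => w i • (i - b)]
  · rintro ⟨y, ⟨h0, h1⟩, rfl⟩
    refine ⟨fun i => if h : i ∈ Q then y ⟨i, h⟩ else 0, ?_, ?_, ?_⟩
    · intro i hi
      simpa [hi] using h0 ⟨i, hi⟩
    · rwa [sum_extend y fun t _ => t]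
    · simp only [edgeMap_apply]
      rw [sum_extend y fun t i => t • (i - b)]

/-- The parametrization of a simplex by an edge direction and the remaining vertices. -/
noncomputable def edgeProd (b v : Space d) (Q : Finset (Space d)) :
    ((Q → ℝ) × ℝ) →ₗ[ℝ] Space d :=
  (edgeMap b Q).coprod (LinearMap.toSpanSingleton ℝ _ v)

theorem edgeProd_apply (v : Space d) (y : Q → ℝ) (s : ℝ) :
    edgeProd b v Q (y, s) = edgeMap b Q y + s • v := by
  simp [edgeProd]

theorem IsSimplex.inner_edgeMap (hK : IsSimplex K) (hd : d ≠ 0) (hQ : Q ⊆ K) (hb : b ∈ K)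
    (hba : b ≠ a) (ha : a ∈ K) (y : Q → ℝ) :
    inner ℝ (edgeMap b Q y) (outwardNormal K (K.erase a)) =
      if h : a ∈ Q then - (y ⟨a, h⟩ * height K a) else 0 := by
  rw [edgeMap_apply, sum_inner]
  simp only [inner_smul_left, conj_trivial]
  split_ifs with h
  · rw [Finset.sum_eq_single ⟨a, h⟩]
    · rw [← neg_sub, inner_neg_left, hK.inner_vertex_sub_apex hd ha hb hba]; ring
    · intro i _ hi
      rw [IsSimplex.inner_vertex_sub (hQ i.2) hb (fun h => hi (Subtype.ext h)) hba, mul_zero]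
    · simp
  · refine Finset.sum_eq_zero fun i _ => ?_
    rw [IsSimplex.inner_vertex_sub (hQ i.2) hb (by rintro rfl; exact h i.2) hba, mul_zero]

/-- The normal opposite `a` is orthogonal to all directions except `a - b`, so it detects `s`; once
`s = 0`, the normal opposite `i ∈ Q` detects `y i`. -/
theorem IsSimplex.edgeProd_injective (hK : IsSimplex K) (hd : d ≠ 0)
    (hQ : insert a (insert b Q) = K) (ha : a ∉ insert b Q) (hb : b ∉ Q) :
    Function.Injective (edgeProd b (a - b) Q) := by
  have hQK : Q ⊆ K := by rw [← hQ]; intro x hx; simp [hx]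
  have haK : a ∈ K := by simp [← hQ]
  have hbK : b ∈ K := by simp [← hQ]
  have haQ : a ∉ Q := fun h => ha (Finset.mem_insert_of_mem h)
  have hba : b ≠ a := by rintro rfl; simp at ha
  rw [← LinearMap.ker_eq_bot, LinearMap.ker_eq_bot']
  rintro ⟨y, s⟩ h
  rw [edgeProd_apply] at h
  have hs : s = 0 := by
    have h1 : inner ℝ (edgeMap b Q y + s • (a - b)) (outwardNormal K (K.erase a)) = 0 := by
      rw [h, inner_zero_left]
    rw [inner_add_left, hK.inner_edgeMap hd hQK hbK hba haK, dif_neg haQ, inner_smul_left,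
      ← neg_sub, inner_neg_left, hK.inner_vertex_sub_apex hd haK hbK hba] at h1
    simpa [(hK.height_pos hd haK).ne'] using h1
  ext i
  · have hiK := hQK i.2
    have hib : b ≠ i := by rintro rfl; exact hb i.2
    have h1 : inner ℝ (edgeMap b Q y + s • (a - b)) (outwardNormal K (K.erase i)) = 0 := by
      rw [h, inner_zero_left]
    rw [hs, zero_smul, add_zero, hK.inner_edgeMap hd hQK hbK hib hiK, dif_pos i.2] at h1
    simpa [(hK.height_pos hd hiK).ne'] using h1
  · exact hs

/-- `edgeProd` as a linear equivalence. -/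
noncomputable def IsSimplex.edgeEquiv (hK : IsSimplex K) (hd : d ≠ 0)
    (hQ : insert a (insert b Q) = K) (ha : a ∉ insert b Q) (hb : b ∉ Q) :
    ((Q → ℝ) × ℝ) ≃ₗ[ℝ] Space d :=
  LinearEquiv.ofInjectiveOfFinrankEq (edgeProd b (a - b) Q)
    (hK.edgeProd_injective hd hQ ha hb) (by
      have := hK.card_eq
      rw [← hQ, Finset.card_insert_of_notMem ha, Finset.card_insert_of_notMem hb] at this
      simp only [Module.finrank_prod, Module.finrank_fintype_fun_eq_card, Fintype.card_coe,
        Module.finrank_self, finrank_euclideanSpace_fin]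
      omega)

theorem IsSimplex.edgeEquiv_apply (hK : IsSimplex K) (hd : d ≠ 0)
    (hQ : insert a (insert b Q) = K) (ha : a ∉ insert b Q) (hb : b ∉ Q) (p : (Q → ℝ) × ℝ) :
    hK.edgeEquiv hd hQ ha hb p = edgeMap b Q p.1 + p.2 • (a - b) := by
  rw [← edgeProd_apply]; rfl

/-- The face opposite to `a`, which contains `b`, is parametrized with base point `b`. -/
theorem IsSimplex.surface_measure_face (hK : IsSimplex K) (hd : d ≠ 0)
    (hQ : insert a (insert b Q) = K) (ha : a ∉ insert b Q) (hb : b ∉ Q) {D : ℝ}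
    (hD : (volume : Measure (Space d)) =
      ENNReal.ofReal D • (volume : Measure ((Q → ℝ) × ℝ)).map (hK.edgeEquiv hd hQ ha hb)) :
    (μHE[d - 1] : Measure (Space d)).restrict (hull (K.erase a)) =
      ENNReal.ofReal (D / height K a) •
        (volume.restrict (cornerSimplex Q)).map (fun y => b + edgeMap b Q y) := by
  have hQK : Q ⊆ K := by rw [← hQ]; intro x hx; simp [hx]
  have haK : a ∈ K := by simp [← hQ]
  have hbK : b ∈ K := by simp [← hQ]
  have haQ : a ∉ Q := fun h => ha (Finset.mem_insert_of_mem h)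
  have hba : b ≠ a := by rintro rfl; simp at ha
  have hins : K.erase a = insert b Q := by rw [← hQ, Finset.erase_insert ha]
  have h0 : ∀ y, hK.edgeEquiv hd hQ ha hb (y, 0) = edgeMap b Q y := by
    intro y; rw [hK.edgeEquiv_apply, zero_smul, add_zero]
  have h1 : hK.edgeEquiv hd hQ ha hb (0, 1) = a - b := by
    rw [hK.edgeEquiv_apply, map_zero, one_smul, zero_add]
  have h := surface_measure_restrict (hK.edgeEquiv hd hQ ha hb)
    (hK.norm_outwardNormal hd haK) (fun y => by
      rw [h0, hK.inner_edgeMap hd hQK hbK hba haK, dif_neg haQ]) hD b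
      (isClosed_cornerSimplex Q).measurableSet
  rw [h1, ← neg_sub, inner_neg_left, hK.inner_vertex_sub_apex hd haK hbK hba, abs_neg,
    abs_of_pos (hK.height_pos hd haK)] at h
  simp only [h0] at h
  rw [← hull_insert_eq_image hb, ← hins] at h
  exact h

theorem measurePreserving_reflect_shear (ι : Type*) [Fintype ι] :
    MeasurePreserving (fun p : (ι → ℝ) × ℝ => (p.1, -(∑ i, p.1 i) - p.2)) := by
  refine (MeasurePreserving.id (volume : Measure (ι → ℝ))).skew_product
    (g := fun y s => -(∑ i, y i) - s) (by fun_prop) (Filter.Eventually.of_forall fun y => ?_)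
  exact (Measure.measurePreserving_sub_left volume (-(∑ i, y i))).map_eq

theorem edgeMap_swap (y : Q → ℝ) :
    edgeMap a Q y = edgeMap b Q y - (∑ i, y i) • (a - b) := by
  simp only [edgeMap_apply, smul_sub, Finset.sum_sub_distrib, Finset.sum_smul]
  abel

/-- Exchanging `a` and `b` changes the parameters by a volume-preserving shear and reflection. The
faces opposite `a` and `b` thus share the same factor `D`, which is why it cancels in the edge
formula. -/
theorem IsSimplex.volume_eq_swap (hK : IsSimplex K) (hd : d ≠ 0)
    (hQ : insert a (insert b Q) = K) (ha : a ∉ insert b Q) (hb : b ∉ Q)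
    (hQ' : insert b (insert a Q) = K) (hb' : b ∉ insert a Q) (ha' : a ∉ Q) {D : ℝ}
    (hD : (volume : Measure (Space d)) =
      ENNReal.ofReal D • (volume : Measure ((Q → ℝ) × ℝ)).map (hK.edgeEquiv hd hQ ha hb)) :
    (volume : Measure (Space d)) =
      ENNReal.ofReal D • (volume : Measure ((Q → ℝ) × ℝ)).map (hK.edgeEquiv hd hQ' hb' ha') := by
  have h : (hK.edgeEquiv hd hQ' hb' ha' : (Q → ℝ) × ℝ → Space d) =
      hK.edgeEquiv hd hQ ha hb ∘ fun p : (Q → ℝ) × ℝ => (p.1, -(∑ i, p.1 i) - p.2) := by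
    funext p
    rw [Function.comp_apply, hK.edgeEquiv_apply, hK.edgeEquiv_apply, edgeMap_swap (a := a) (b := b)]
    module
  rw [h, ← Measure.map_map (measurableEmbedding_linearEquiv _).measurable
    (measurePreserving_reflect_shear Q).measurable, (measurePreserving_reflect_shear Q).map_eq]
  exact hD

/-- The parameter domain of a simplex. -/
def cornerRegion (ι : Type*) [Fintype ι] : Set ((ι → ℝ) × ℝ) :=
  {p | p.1 ∈ cornerSimplex ι ∧ p.2 ∈ Icc 0 (1 - ∑ i, p.1 i)}

theorem isCompact_cornerRegion (ι : Type*) [Fintype ι] : IsCompact (cornerRegion ι) := by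
  refine ((isCompact_cornerSimplex ι).prod (isCompact_Icc (a := (0 : ℝ)) (b := 1))).of_isClosed_subset
    ?_ ?_
  · refine ((isClosed_cornerSimplex ι).preimage continuous_fst).inter ?_
    exact (isClosed_le continuous_const continuous_snd).inter
      (isClosed_le continuous_snd (by fun_prop))
  · rintro ⟨y, s⟩ ⟨hy, hs⟩
    refine ⟨hy, hs.1, hs.2.trans ?_⟩
    have := Finset.sum_nonneg fun i (_ : i ∈ Finset.univ) => hy.1 i
    simpa using this

theorem IsSimplex.mem_hull_iff (hK : IsSimplex K) (hd : d ≠ 0)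
    (hQ : insert a (insert b Q) = K) (ha : a ∉ insert b Q) (hb : b ∉ Q) (p : (Q → ℝ) × ℝ) :
    b + hK.edgeEquiv hd hQ ha hb p ∈ hull K ↔ p ∈ cornerRegion Q := by
  have haQ : a ∉ Q := fun h => ha (Finset.mem_insert_of_mem h)
  have hab : a ≠ b := by rintro rfl; simp at ha
  have hb' : b ∉ insert a Q := by simp [hab.symm, hb]
  have hmem := mem_hull_insert (x := b + hK.edgeEquiv hd hQ ha hb p) hb'
  rw [Finset.insert_comm, hQ] at hmem
  rw [hmem]
  constructor
  · rintro ⟨w, h0, h1, h2⟩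
    rw [Finset.sum_insert haQ] at h1 h2
    have h3 : hK.edgeEquiv hd hQ ha hb (fun i => w i, w a) = hK.edgeEquiv hd hQ ha hb p := by
      rw [← add_right_inj b, ← h2, hK.edgeEquiv_apply, edgeMap_apply,
        Finset.sum_coe_sort Q fun i => w i • (i - b), add_comm (w a • _)]
    rw [← (hK.edgeEquiv hd hQ ha hb).injective h3]
    have hw : ∑ i : Q, w i = ∑ i ∈ Q, w i := Finset.sum_coe_sort Q w
    have h4 := h0 a (by simp)
    exact ⟨⟨fun i => h0 i (by simp), by simp only [hw]; linarith⟩, h4, by simp only [hw]; linarith⟩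
  · rintro ⟨⟨h0, h1⟩, h2, h3⟩
    have hne : ∀ i ∈ Q, i ≠ a := by rintro i hi rfl; exact haQ hi
    refine ⟨fun i => if i = a then p.2 else if h : i ∈ Q then p.1 ⟨i, h⟩ else 0, ?_, ?_, ?_⟩
    · intro i hi
      rcases Finset.mem_insert.1 hi with rfl | hi
      · simpa using h2
      · simpa [hne i hi, hi] using h0 ⟨i, hi⟩
    · rw [Finset.sum_insert haQ, Finset.sum_congr rfl fun i hi => if_neg (hne i hi),
        sum_extend p.1 fun t _ => t]
      simp only [if_true]; linarith
    · have h5 : ∑ i ∈ Q, (if i = a then p.2 else if h : i ∈ Q then p.1 ⟨i, h⟩ else 0) • (i - b) =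
          ∑ i ∈ Q, (if h : i ∈ Q then p.1 ⟨i, h⟩ else 0) • (i - b) :=
        Finset.sum_congr rfl fun i hi => by rw [if_neg (hne i hi)]
      rw [Finset.sum_insert haQ, h5, sum_extend p.1 fun t i => t • (i - b), hK.edgeEquiv_apply,
        edgeMap_apply]
      simp only [if_true]
      abel

theorem IsSimplex.setIntegral_hull (hK : IsSimplex K) (hd : d ≠ 0)
    (hQ : insert a (insert b Q) = K) (ha : a ∉ insert b Q) (hb : b ∉ Q) {D : ℝ} (hD0 : 0 < D)
    (hD : (volume : Measure (Space d)) =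
      ENNReal.ofReal D • (volume : Measure ((Q → ℝ) × ℝ)).map (hK.edgeEquiv hd hQ ha hb))
    (G : Space d → ℝ) :
    ∫ x in hull K, G x = D * ∫ p in cornerRegion Q, G (b + hK.edgeEquiv hd hQ ha hb p) := by
  have h1 : ∫ x in hull K, G x = ∫ x in (fun x => b + x) ⁻¹' hull K, G (b + x) :=
    ((measurePreserving_add_left volume b).setIntegral_preimage_emb
      (measurableEmbedding_addLeft b) G (hull K)).symm
  rw [h1]
  conv_lhs => rw [hD]
  rw [Measure.restrict_smul, integral_smul_measure,
    (measurableEmbedding_linearEquiv _).setIntegral_map, ENNReal.toReal_ofReal hD0.le, smul_eq_mul]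
  congr 3
  ext p
  exact hK.mem_hull_iff hd hQ ha hb p

/-- Integration in the direction of an edge. -/
theorem IsSimplex.integral_fderiv_edge (hK : IsSimplex K) (hd : d ≠ 0)
    (ha : a ∈ K) (hb : b ∈ K) (hab : a ≠ b) {F : Space d → ℝ} (hF : ContDiff ℝ 1 F) :
    ∫ x in hull K, fderiv ℝ F x (a - b) =
      height K b * ∫ x in hull (K.erase b), F x ∂μHE[d - 1] -
        height K a * ∫ x in hull (K.erase a), F x ∂μHE[d - 1] := by
  obtain ⟨Q, hQ, haQ, hbQ⟩ : ∃ Q : Finset (Space d),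
      insert a (insert b Q) = K ∧ a ∉ insert b Q ∧ b ∉ Q := by
    refine ⟨(K.erase a).erase b, ?_, ?_, by simp⟩
    · rw [Finset.insert_erase (by simp [hb, hab.symm]), Finset.insert_erase ha]
    · simp [hab]
  have hQ' : insert b (insert a Q) = K := by rw [Finset.insert_comm, hQ]
  have haQ' : a ∉ Q := fun h => haQ (Finset.mem_insert_of_mem h)
  have hbQ' : b ∉ insert a Q := by simp [hab.symm, hbQ]
  obtain ⟨D, hD0, hD⟩ := exists_volume_image_eq (hK.edgeEquiv hd hQ haQ hbQ)
  have hD' := hK.volume_eq_swap hd hQ haQ hbQ hQ' hbQ' haQ' hD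
  have hha := hK.height_pos hd ha
  have hhb := hK.height_pos hd hb
  have hcont : ∀ c : Space d, Continuous fun y : Q → ℝ => c + edgeMap c Q y := fun c =>
    continuous_const.add (LinearMap.continuous_of_finiteDimensional _)
  have hS := (isClosed_cornerSimplex Q).measurableSet
  have hface : ∀ c h, 0 < h → ∫ x, F x ∂(ENNReal.ofReal (D / h) •
        (volume.restrict (cornerSimplex Q)).map (fun y => c + edgeMap c Q y)) =
      D / h * ∫ y in cornerSimplex Q, F (c + edgeMap c Q y) := by
    intro c h hh
    rw [integral_smul_measure, integral_map (hcont c).measurable.aemeasurable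
      hF.continuous.aestronglyMeasurable, ENNReal.toReal_ofReal (by positivity), smul_eq_mul]
  rw [hK.surface_measure_face hd hQ haQ hbQ hD, hK.surface_measure_face hd hQ' hbQ' haQ' hD',
    hface _ _ hha, hface _ _ hhb, hK.setIntegral_hull hd hQ haQ hbQ hD0 hD]
  -- Fubini along the edge direction: for fixed `y` the segment starts at `s = 0` on the face
  -- opposite `a` and ends at `s = 1 - ∑ y i` on the face opposite `b`, at the point `a + edgeMap a
  -- Q y`.
  have hinner : ∫ p in cornerRegion Q, fderiv ℝ F (b + hK.edgeEquiv hd hQ haQ hbQ p) (a - b) =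
      ∫ y in cornerSimplex Q, (F (a + edgeMap a Q y) - F (b + edgeMap b Q y)) := by
    have hcf : Continuous fun x => fderiv ℝ F x (a - b) :=
      (hF.continuous_fderiv one_ne_zero).clm_apply continuous_const
    have hΨ : Continuous (hK.edgeEquiv hd hQ haQ hbQ) :=
      (hK.edgeEquiv hd hQ haQ hbQ).toContinuousLinearEquiv.continuous
    have hR := isCompact_cornerRegion Q
    have hint : Integrable ((cornerRegion Q).indicator fun p =>
        fderiv ℝ F (b + hK.edgeEquiv hd hQ haQ hbQ p) (a - b))
        ((volume : Measure (Q → ℝ)).prod (volume : Measure ℝ)) := by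
      rw [integrable_indicator_iff hR.measurableSet]
      exact (hcf.comp (continuous_const.add hΨ)).continuousOn.integrableOn_compact hR
    rw [← integral_indicator hR.measurableSet, Measure.volume_eq_prod, integral_prod _ hint,
      ← integral_indicator hS]
    congr 1
    funext y
    by_cases hy : y ∈ cornerSimplex Q
    · rw [indicator_of_mem hy]
      have hy1 : 0 ≤ 1 - ∑ i, y i := by linarith [hy.2]
      have h1 : ∀ s, (cornerRegion Q).indicator (fun p =>
          fderiv ℝ F (b + hK.edgeEquiv hd hQ haQ hbQ p) (a - b)) (y, s) =
          (Icc 0 (1 - ∑ i, y i)).indicator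
            (fun s => fderiv ℝ F (b + edgeMap b Q y + s • (a - b)) (a - b)) s := by
        intro s
        simp only [indicator, cornerRegion, mem_ofPred_eq, hy, true_and, hK.edgeEquiv_apply,
          add_assoc]
      simp_rw [h1]
      rw [integral_indicator measurableSet_Icc, integral_Icc_eq_integral_Ioc,
        ← intervalIntegral.integral_of_le hy1]
      have hderiv : ∀ s ∈ uIcc 0 (1 - ∑ i, y i),
          HasDerivAt (fun s : ℝ => F (b + edgeMap b Q y + s • (a - b)))
            (fderiv ℝ F (b + edgeMap b Q y + s • (a - b)) (a - b)) s := by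
        intro s _
        have h2 : HasDerivAt (fun s : ℝ => b + edgeMap b Q y + s • (a - b)) (a - b) s := by
          simpa using ((hasDerivAt_id s).smul_const (a - b)).const_add (b + edgeMap b Q y)
        exact ((hF.differentiable one_ne_zero _).hasFDerivAt).comp_hasDerivAt s h2
      rw [intervalIntegral.integral_eq_sub_of_hasDerivAt hderiv
        ((hcf.comp (by fun_prop)).intervalIntegrable _ _), zero_smul, add_zero,
        edgeMap_swap (a := a) (b := b)]
      congr 2
      module
    · rw [indicator_of_notMem hy]
      have h1 : ∀ s, (cornerRegion Q).indicator (fun p =>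
          fderiv ℝ F (b + hK.edgeEquiv hd hQ haQ hbQ p) (a - b)) (y, s) = 0 := fun s =>
        indicator_of_notMem (fun h => hy h.1) _
      simp_rw [h1]
      exact integral_zero _ _
  have hi : ∀ c : Space d, Integrable (fun y => F (c + edgeMap c Q y))
      (volume.restrict (cornerSimplex Q)) := fun c =>
    (hF.continuous.comp (hcont c)).continuousOn.integrableOn_compact (isCompact_cornerSimplex Q)
  rw [hinner, integral_sub (hi a) (hi b)]
  field_simp

end Gauss

end RTHybrid

namespace RTHybrid

open scoped Classical ENNReal

/-! ### Divergence theorem and surface integrals on faces -/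

section Faces

variable {d : ℕ} {K Q : Finset (Space d)} {a b c x : Space d}

/-- **Divergence theorem** on a simplex, for a constant vector times a scalar function. -/
theorem IsSimplex.integral_fderiv (hK : IsSimplex K) (hd : d ≠ 0) {F : Space d → ℝ}
    (hF : ContDiff ℝ 1 F) (v : Space d) :
    ∫ x in hull K, fderiv ℝ F x v =
      ∑ a ∈ K, inner ℝ v (outwardNormal K (K.erase a)) *
        ∫ x in hull (K.erase a), F x ∂μHE[d - 1] := by
  have hint : ∀ v, IntegrableOn (fun x => fderiv ℝ F x v) (hull K) := fun v =>
    ((hF.continuous_fderiv one_ne_zero).clm_apply continuous_const).continuousOn.integrableOn_compact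
      (isCompact_hull K)
  obtain ⟨b, hb⟩ : K.Nonempty := by rw [← Finset.card_pos, hK.card_eq]; omega
  have hv : v ∈ vectorSpan ℝ (K : Set (Space d)) := by
    have := hK.indep.vectorSpan_eq_top_of_card_eq_finrank_add_one (by simp [hK.card_eq])
    rw [Subtype.range_coe_subtype] at this
    have h2 : vectorSpan ℝ (K : Set (Space d)) = ⊤ := this
    rw [h2]; trivial
  -- Both sides are linear in `v`, and the edges from one vertex span. For the edge `a - b` only the
  -- normals opposite its two ends are not orthogonal to it, which leaves the edge formula.
  rw [vectorSpan_eq_span_vsub_set_right ℝ (Finset.mem_coe.2 hb)] at hv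
  induction hv using Submodule.span_induction with
  | mem v hv =>
    obtain ⟨a, ha, rfl⟩ := hv
    simp only [vsub_eq_sub]
    rw [Finset.mem_coe] at ha
    by_cases hab : a = b
    · simp [hab]
    · rw [hK.integral_fderiv_edge hd ha hb hab hF]
      rw [← Finset.add_sum_erase _ _ ha, ← Finset.add_sum_erase (K.erase a) _
        (Finset.mem_erase.2 ⟨Ne.symm hab, hb⟩), Finset.sum_eq_zero,
        hK.inner_vertex_sub_apex hd hb ha hab, ← neg_sub b a, inner_neg_left,
        hK.inner_vertex_sub_apex hd ha hb (Ne.symm hab)]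
      · ring
      · intro c hc
        simp only [Finset.mem_erase] at hc
        rw [IsSimplex.inner_vertex_sub ha hb (Ne.symm hc.2.1) (Ne.symm hc.1), zero_mul]
  | zero => simp
  | add v w _ _ h1 h2 =>
    simp only [map_add, inner_add_left, add_mul, Finset.sum_add_distrib]
    rw [integral_add (hint v) (hint w), h1, h2]
  | smul t v _ h1 =>
    simp only [map_smul, inner_smul_left, smul_eq_mul, mul_assoc, conj_trivial]
    rw [integral_const_mul, h1, Finset.mul_sum]

theorem IsSimplex.exists_surface_measure_face (hK : IsSimplex K) (hd : d ≠ 0) (ha : a ∈ K) :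
    ∃ (b : Space d) (Q : Finset (Space d)) (t : ℝ), b ∉ Q ∧ insert b Q = K.erase a ∧ 0 < t ∧
      (μHE[d - 1] : Measure (Space d)).restrict (hull (K.erase a)) = ENNReal.ofReal t •
        (volume.restrict (cornerSimplex Q)).map (fun y => b + edgeMap b Q y) := by
  obtain ⟨b, hb⟩ := hK.erase_nonempty hd ha
  have hQ : insert a (insert b ((K.erase a).erase b)) = K := by
    rw [Finset.insert_erase hb, Finset.insert_erase ha]
  have haQ : a ∉ insert b ((K.erase a).erase b) := by rw [Finset.insert_erase hb]; simp
  obtain ⟨D, hD0, hD⟩ := exists_volume_image_eq (hK.edgeEquiv hd hQ haQ (by simp))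
  exact ⟨b, (K.erase a).erase b, _, by simp, Finset.insert_erase hb,
    div_pos hD0 (hK.height_pos hd ha), hK.surface_measure_face hd hQ haQ (by simp) hD⟩

theorem continuous_edgeMap (b : Space d) (Q : Finset (Space d)) :
    Continuous fun y => b + edgeMap b Q y :=
  continuous_const.add (LinearMap.continuous_of_finiteDimensional _)

theorem IsSimplex.face_measure_lt_top (hK : IsSimplex K) (hd : d ≠ 0) (ha : a ∈ K) :
    (μHE[d - 1] : Measure (Space d)) (hull (K.erase a)) < ⊤ := by
  obtain ⟨b, Q, t, -, -, ht, h⟩ := hK.exists_surface_measure_face hd ha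
  rw [← Measure.restrict_apply_univ, h, Measure.smul_apply,
    Measure.map_apply (continuous_edgeMap b Q).measurable MeasurableSet.univ, preimage_univ,
    Measure.restrict_apply_univ]
  exact ENNReal.mul_lt_top ENNReal.ofReal_lt_top (isCompact_cornerSimplex Q).measure_lt_top

theorem convex_cornerSimplex (ι : Type*) [Fintype ι] : Convex ℝ (cornerSimplex ι) := by
  rintro y ⟨hy0, hy1⟩ z ⟨hz0, hz1⟩ s t hs ht hst
  refine ⟨fun i => ?_, ?_⟩
  · have := hy0 i; have := hz0 i
    simp only [Pi.add_apply, Pi.smul_apply, smul_eq_mul]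
    positivity
  · simp only [Pi.add_apply, Pi.smul_apply, smul_eq_mul, Finset.sum_add_distrib, ← Finset.mul_sum]
    nlinarith

/-- Continuous functions that agree almost everywhere on such a set agree everywhere on it, its
boundary included. -/
theorem cornerSimplex_subset_closure_interior (ι : Type*) [Fintype ι] :
    cornerSimplex ι ⊆ closure (interior (cornerSimplex ι)) := by
  have hne : (interior (cornerSimplex ι)).Nonempty := by
    have hopen : IsOpen {y : ι → ℝ | (∀ i, 0 < y i) ∧ ∑ i, y i < 1} := by
      simp only [ofPred_and, ofPred_forall]
      exact (isOpen_iInter_of_finite fun i => isOpen_lt continuous_const (continuous_apply i)).inter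
        (isOpen_lt (by fun_prop) continuous_const)
    -- With `n` coordinates this point has coordinate sum `n / (n + 1) < 1`.
    refine ⟨fun _ => ((Fintype.card ι : ℝ) + 1)⁻¹, interior_maximal ?_ hopen ⟨?_, ?_⟩⟩
    · rintro y ⟨h0, h1⟩
      exact ⟨fun i => (h0 i).le, h1.le⟩
    · intro i; positivity
    · rw [Finset.sum_const, Finset.card_univ, nsmul_eq_mul, ← div_eq_mul_inv,
        div_lt_one (by positivity)]
      linarith
  rw [(convex_cornerSimplex ι).closure_interior_eq_closure_of_nonempty_interior hne]
  exact subset_closure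

theorem IsSimplex.integrableOn_face (hK : IsSimplex K) (hd : d ≠ 0) (ha : a ∈ K)
    {g : Space d → ℝ} (hg : Continuous g) : IntegrableOn g (hull (K.erase a)) μHE[d - 1] :=
  hg.continuousOn.integrableOn_of_subset_isCompact (isCompact_hull _) (isClosed_hull _).measurableSet
    Subset.rfl (hK.face_measure_lt_top hd ha).ne

/-- The surface measure charges every relatively open subset of a face. -/
theorem IsSimplex.eq_zero_of_integral_face_eq_zero (hK : IsSimplex K) (hd : d ≠ 0) (ha : a ∈ K)
    {g : Space d → ℝ} (hg : Continuous g) (h0 : ∀ x ∈ hull (K.erase a), 0 ≤ g x)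
    (hint : ∫ x in hull (K.erase a), g x ∂μHE[d - 1] = 0) (hx : x ∈ hull (K.erase a)) :
    g x = 0 := by
  obtain ⟨b, Q, t, hb, hQ, ht, h⟩ := hK.exists_surface_measure_face hd ha
  have hψ := continuous_edgeMap b Q
  have hmem : ∀ y ∈ cornerSimplex Q, b + edgeMap b Q y ∈ hull (K.erase a) := by
    intro y hy
    rw [← hQ, hull_insert_eq_image hb]
    exact ⟨y, hy, rfl⟩
  rw [h, integral_smul_measure, integral_map hψ.measurable.aemeasurable
    hg.aestronglyMeasurable, smul_eq_mul, mul_eq_zero, ENNReal.toReal_ofReal ht.le] at hint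
  have hint := hint.resolve_left ht.ne'
  rw [setIntegral_eq_zero_iff_of_nonneg_ae] at hint
  · have := Measure.eqOn_of_ae_eq hint (hg.comp hψ).continuousOn continuousOn_const
      (cornerSimplex_subset_closure_interior Q)
    rw [← hQ, hull_insert_eq_image hb] at hx
    obtain ⟨y, hy, rfl⟩ := hx
    exact this hy
  · exact (ae_restrict_mem (isClosed_cornerSimplex Q).measurableSet).mono
      fun y hy => h0 _ (hmem y hy)
  · exact (hg.comp hψ).continuousOn.integrableOn_compact (isCompact_cornerSimplex Q)

theorem faceIntegral_eq (e : Finset (Space d)) (g : Space d → ℝ) :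
    faceIntegral e (fun x => g x) = ∫ x in hull e, g x ∂μHE[d - 1] :=
  integral_subtype_comap (isClosed_hull e).measurableSet g

end Faces

end RTHybrid

namespace RTHybrid

open scoped Classical ENNReal

/-! ### Polynomial fields, their normal traces and integration by parts -/

section Polynomials

variable {d k : ℕ} {K e : Finset (Space d)} {a b x : Space d} {p q : Poly d}

@[simp] theorem evalAt_mul (x : Space d) (p q : Poly d) :
    evalAt x (p * q) = evalAt x p * evalAt x q := map_mul (MvPolynomial.aeval _) p q

@[simp] theorem evalAt_C (x : Space d) (c : ℝ) : evalAt x (MvPolynomial.C c) = c :=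
  MvPolynomial.aeval_C _ c

@[simp] theorem evalAt_X (x : Space d) (i : Fin d) : evalAt x (MvPolynomial.X i) = x i :=
  MvPolynomial.aeval_X _ i

@[simp] theorem evalAt_one (x : Space d) : evalAt x 1 = 1 := map_one (MvPolynomial.aeval _)

theorem contDiff_evalAt (p : Poly d) : ContDiff ℝ ∞ fun x : Space d => evalAt x p := by
  induction p using MvPolynomial.induction_on with
  | C c => simpa using contDiff_const
  | add p q hp hq => simpa using hp.add hq
  | mul_X p i hp =>
    simp only [evalAt_mul, evalAt_X]
    exact hp.mul (by fun_prop)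

theorem continuous_evalAt (p : Poly d) : Continuous fun x : Space d => evalAt x p :=
  (contDiff_evalAt p).continuous

theorem differentiable_evalAt (p : Poly d) : Differentiable ℝ fun x : Space d => evalAt x p :=
  (contDiff_evalAt p).differentiable (by simp)

theorem fderiv_evalAt (p : Poly d) (x v : Space d) :
    fderiv ℝ (fun x : Space d => evalAt x p) x v =
      ∑ i, v i * evalAt x (MvPolynomial.pderiv i p) := by
  induction p using MvPolynomial.induction_on with
  | C c => simp
  | add p q hp hq =>
    simp only [map_add, mul_add, Finset.sum_add_distrib]
    rw [← hp, ← hq, fderiv_fun_add (differentiable_evalAt p x) (differentiable_evalAt q x)]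
    rfl
  | mul_X p i hp =>
    have h1 : HasFDerivAt (fun x : Space d => x i) (EuclideanSpace.proj i : Space d →L[ℝ] ℝ) x :=
      (EuclideanSpace.proj i : Space d →L[ℝ] ℝ).hasFDerivAt
    simp only [evalAt_mul, evalAt_X]
    rw [((differentiable_evalAt p x).hasFDerivAt.fun_mul h1).fderiv]
    simp only [add_apply, smul_apply, hp, smul_eq_mul,
      MvPolynomial.pderiv_mul, map_add, evalAt_mul, evalAt_X, mul_add, Finset.sum_add_distrib,
      MvPolynomial.pderiv_X]
    rw [add_comm]
    congr 1
    · rw [Finset.mul_sum]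
      exact Finset.sum_congr rfl fun j _ => by ring
    · rw [Finset.sum_eq_single i]
      · simp [mul_comm]
      · intro j _ hj
        simp [Ne.symm hj]
      · simp

/-- A polynomial that vanishes on a nonempty open set is zero. -/
theorem eq_zero_of_evalAt_eq_zero {U : Set (Space d)} (hU : IsOpen U) (hne : U.Nonempty)
    (h : ∀ x ∈ U, evalAt x p = 0) : p = 0 := by
  obtain ⟨x, hx⟩ := hne
  have hU' : IsOpen ((WithLp.toLp 2 : (Fin d → ℝ) → Space d) ⁻¹' U) :=
    hU.preimage (PiLp.continuous_toLp 2 _)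
  obtain ⟨ε, hε, hb⟩ := Metric.isOpen_iff.1 hU' (fun i => x i) hx
  refine MvPolynomial.funext_set (fun i => Metric.ball (x i) ε) (fun i => ?_) fun y hy => ?_
  · rw [Real.ball_eq_Ioo]
    exact Ioo_infinite (by linarith)
  · rw [map_zero]
    have hy' : y ∈ Metric.ball (fun i => x i) ε := by
      rw [ball_pi _ hε]; exact hy
    have := h _ (hb hy')
    rw [← MvPolynomial.coe_aeval_eq_eval]
    exact this

theorem mem_Pk : p ∈ Pk d k ↔ p.totalDegree ≤ k := MvPolynomial.mem_restrictTotalDegree _ _ _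

theorem totalDegree_X_sub_C_le (i : Fin d) (c : ℝ) :
    (MvPolynomial.X i - MvPolynomial.C c : Poly d).totalDegree ≤ 1 := by
  refine (MvPolynomial.totalDegree_sub _ _).trans ?_
  simp

/-- A nonzero derivative has degree at most `k - 1`, and a factor of degree one restores `k`; a zero
derivative, the only case when `k = 0`, is treated apart. It makes `λ_a ∂_i u` an admissible test
polynomial. -/
theorem mul_pderiv_mem_Pk (hp : p ∈ Pk d k) (hq : q.totalDegree ≤ 1) (i : Fin d) :
    q * MvPolynomial.pderiv i p ∈ Pk d k := by
  rw [mem_Pk] at *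
  by_cases h0 : MvPolynomial.pderiv i p = 0
  · simp [h0]
  have h1 : ∀ m ∈ (MvPolynomial.pderiv i p).support, (m.sum fun _ e => e) + 1 ≤ k := by
    intro m hm
    rw [MvPolynomial.mem_support_iff, MvPolynomial.coeff_pderiv] at hm
    have h2 : m + Finsupp.single i 1 ∈ p.support := by
      rw [MvPolynomial.mem_support_iff]
      intro h; rw [h] at hm; simp at hm
    have h3 := MvPolynomial.le_totalDegree h2
    rw [Finsupp.sum_add_index' (by simp) (by simp), Finsupp.sum_single_index rfl] at h3
    omega
  obtain ⟨m, hm⟩ := MvPolynomial.support_nonempty.2 h0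
  have hk : 1 ≤ k := by have := h1 m hm; omega
  have h4 : (MvPolynomial.pderiv i p).totalDegree ≤ k - 1 :=
    Finset.sup_le fun m hm => by have := h1 m hm; omega
  have := MvPolynomial.totalDegree_mul q (MvPolynomial.pderiv i p)
  omega

/-- The vector field `p (x - a)`. -/
noncomputable def radialField (p : Poly d) (a : Space d) : Fin d → Poly d :=
  fun i => p * (MvPolynomial.X i - MvPolynomial.C (a i))

/-- In `p (x - a)` only the top homogeneous component of `p` times `x` can exceed degree `k`, and
that is precisely the extra summand of the Raviart-Thomas space. -/
theorem radialField_mem_RT (hp : p ∈ Pk d k) (a : Space d) : radialField p a ∈ RT d k := by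
  have hp' := mem_Pk.1 hp
  have hsum : p = ∑ j ∈ Finset.range (k + 1), MvPolynomial.homogeneousComponent j p := by
    conv_lhs => rw [← MvPolynomial.sum_homogeneousComponent p]
    refine Finset.sum_subset (Finset.range_mono (by omega)) fun j _ hj => ?_
    exact MvPolynomial.homogeneousComponent_eq_zero _ _ (by simpa using hj)
  have hfield : radialField p a =
      (fun i => (∑ j ∈ Finset.range k, MvPolynomial.homogeneousComponent j p) * MvPolynomial.X i -
        p * MvPolynomial.C (a i)) + mulPosition d (MvPolynomial.homogeneousComponent k p) := by
    funext i
    simp only [radialField, mulPosition, Pi.add_apply, LinearMap.pi_apply, LinearMap.mulLeft_apply]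
    rw [mul_sub]
    nth_rewrite 1 [hsum]
    rw [Finset.sum_range_succ]
    ring
  rw [hfield]
  refine add_mem (Submodule.mem_sup_left ?_) (Submodule.mem_sup_right ?_)
  · intro i _
    refine sub_mem ?_ ?_
    · rw [Finset.sum_mul]
      refine sum_mem fun j hj => ?_
      rw [mem_Pk]
      have h1 := MvPolynomial.totalDegree_mul (MvPolynomial.homogeneousComponent j p)
        (MvPolynomial.X i)
      have h2 := (MvPolynomial.homogeneousComponent_isHomogeneous j p).totalDegree_le
      rw [MvPolynomial.totalDegree_X] at h1
      have := Finset.mem_range.1 hj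
      omega
    · rw [mem_Pk]
      have h1 := MvPolynomial.totalDegree_mul p (MvPolynomial.C (a i))
      rw [MvPolynomial.totalDegree_C] at h1
      omega
  · exact Submodule.mem_map_of_mem (MvPolynomial.homogeneousComponent_mem k p)

theorem evalAt_radialField (p : Poly d) (a x : Space d) :
    vecEvalAt x (radialField p a) = evalAt x p • (x - a) := by
  ext i
  simp [vecEvalAt, radialField]

theorem inner_vecEvalAt (q : Fin d → Poly d) (x v : Space d) :
    inner ℝ (vecEvalAt x q) v = ∑ i, v i * evalAt x (q i) := by
  simp [PiLp.inner_apply, vecEvalAt]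

theorem continuous_vecEvalAt (q : Fin d → Poly d) : Continuous fun x : Space d => vecEvalAt x q :=
  (PiLp.continuous_toLp 2 _).comp (continuous_pi fun i => continuous_evalAt (q i))

theorem continuous_normalTrace (K e : Finset (Space d)) (q : Fin d → Poly d) :
    Continuous (normalTrace K e q) :=
  (continuous_vecEvalAt q).inner continuous_const

/-- On a face, the normal component of a Raviart-Thomas field has degree at most `k`. -/
theorem exists_normalTrace_eq {r : Fin d → Poly d} (hr : r ∈ RT d k) (he : e.Nonempty) :
    ∃ p ∈ Pk d k, ∀ x ∈ hull e, normalTrace K e r x = evalAt x p := by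
  obtain ⟨b, hb⟩ := he
  obtain ⟨s, hs, t, ht, rfl⟩ := Submodule.mem_sup.1 hr
  obtain ⟨g, hg, rfl⟩ := (Submodule.mem_map).1 ht
  set n := outwardNormal K e with hn
  -- On the face `x·n` has the constant value `b·n`, so the normal component of `x g` is `(b·n) g`,
  -- of degree `k` rather than `k + 1`.
  refine ⟨∑ i, n i • s i + inner ℝ b n • g, ?_, ?_⟩
  · refine add_mem (sum_mem fun i _ => Submodule.smul_mem _ _ (hs i trivial))
      (Submodule.smul_mem _ _ ?_)
    rw [mem_Pk]
    exact ((MvPolynomial.mem_homogeneousSubmodule _ _).1 hg).totalDegree_le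
  · intro x hx
    have h1 : inner ℝ x n = inner ℝ b n := by
      have := inner_sub_outwardNormal (K := K) hx (subset_convexHull ℝ _ (Finset.mem_coe.2 hb))
      rwa [inner_sub_left, sub_eq_zero] at this
    rw [normalTrace, inner_vecEvalAt, ← hn, map_add, map_sum, map_smul, ← h1]
    simp only [Pi.add_apply, map_add, mul_add, Finset.sum_add_distrib, map_smul, smul_eq_mul,
      mulPosition, LinearMap.pi_apply, LinearMap.mulLeft_apply, evalAt_mul, evalAt_X]
    congr 1
    simp only [PiLp.inner_apply, Finset.sum_mul]
    refine Finset.sum_congr rfl fun i _ => ?_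
    simp only [RCLike.inner_apply, conj_trivial]
    ring

theorem normalTrace_mem_facePk {r : Fin d → Poly d} (hr : r ∈ RT d k) (he : e.Nonempty) :
    (fun x : hull e => normalTrace K e r x) ∈ facePk k e := by
  obtain ⟨p, hp, h⟩ := exists_normalTrace_eq (K := K) hr he
  exact ⟨p, hp, funext fun x => (h x x.2).symm⟩

/-- The barycentric coordinate as a polynomial. -/
noncomputable def coordPoly (K : Finset (Space d)) (a : Space d) : Poly d :=
  MvPolynomial.C 1 - ∑ i, MvPolynomial.C (outwardNormal K (K.erase a) i / height K a) *
    (MvPolynomial.X i - MvPolynomial.C (a i))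

theorem evalAt_coordPoly (K : Finset (Space d)) (a x : Space d) :
    evalAt x (coordPoly K a) = coord K a x := by
  simp only [coordPoly, coord, map_sub, map_sum, evalAt_C, evalAt_mul, evalAt_X, PiLp.inner_apply,
    Finset.sum_div]
  congr 1
  refine Finset.sum_congr rfl fun i _ => ?_
  simp only [RCLike.inner_apply, conj_trivial, PiLp.sub_apply]
  ring

theorem totalDegree_coordPoly_le (K : Finset (Space d)) (a : Space d) :
    (coordPoly K a).totalDegree ≤ 1 := by
  refine (MvPolynomial.totalDegree_sub _ _).trans (max_le (by simp) ?_)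
  refine MvPolynomial.totalDegree_finsetSum_le fun i _ => ?_
  refine (MvPolynomial.totalDegree_mul _ _).trans ?_
  rw [MvPolynomial.totalDegree_C, zero_add]
  exact totalDegree_X_sub_C_le _ _

/-- **Integration by parts** on a simplex. -/
theorem IsSimplex.integral_div (hK : IsSimplex K) (hd : d ≠ 0) {φ : Space d → ℝ}
    (hφ : ContDiff ℝ 1 φ) (q : Fin d → Poly d) :
    ∫ x in hull K, (fderiv ℝ φ x (vecEvalAt x q) + φ x * evalAt x (polyDiv q)) =
      ∑ a ∈ K, ∫ x in hull (K.erase a), φ x * normalTrace K (K.erase a) q x ∂μHE[d - 1] := by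
  have hF : ∀ i, ContDiff ℝ 1 fun x => φ x * evalAt x (q i) := fun i =>
    hφ.mul ((contDiff_evalAt (q i)).of_le (by norm_cast))
  set v : Fin d → Space d := fun i => EuclideanSpace.single i 1
  have hder : ∀ x i, fderiv ℝ (fun x => φ x * evalAt x (q i)) x (v i) =
      evalAt x (q i) * fderiv ℝ φ x (v i) + φ x * evalAt x (MvPolynomial.pderiv i (q i)) := by
    intro x i
    rw [((hφ.differentiable one_ne_zero x).hasFDerivAt.fun_mul
      (differentiable_evalAt (q i) x).hasFDerivAt).fderiv]
    simp only [add_apply, smul_apply, smul_eq_mul,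
      fderiv_evalAt]
    rw [add_comm, Finset.sum_eq_single i]
    · simp [v]
    · intro j _ hj; simp [v, hj]
    · simp
  have h1 : ∀ x, fderiv ℝ φ x (vecEvalAt x q) + φ x * evalAt x (polyDiv q) =
      ∑ i, fderiv ℝ (fun x => φ x * evalAt x (q i)) x (v i) := by
    intro x
    have hv : vecEvalAt x q = ∑ i, evalAt x (q i) • v i := by
      ext j
      simp [vecEvalAt, v, Pi.single_apply]
    rw [hv, polyDiv]
    simp only [hder, map_sum, map_smul, smul_eq_mul, Finset.sum_add_distrib, Finset.mul_sum]
  simp_rw [h1]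
  rw [integral_finsetSum]
  · simp_rw [hK.integral_fderiv hd (hF _)]
    rw [Finset.sum_comm]
    refine Finset.sum_congr rfl fun a ha => ?_
    simp only [normalTrace, inner_vecEvalAt, Finset.mul_sum]
    rw [integral_finsetSum]
    · refine Finset.sum_congr rfl fun i _ => ?_
      rw [← integral_const_mul]
      congr 1
      funext x
      have hv : inner ℝ (v i) (outwardNormal K (K.erase a)) = outwardNormal K (K.erase a) i := by
        simp only [v]
        rw [EuclideanSpace.inner_single_left]
        simp
      rw [hv]
      ring
    · intro i _
      exact hK.integrableOn_face hd ha (hφ.continuous.mul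
        (continuous_const.mul (continuous_evalAt _)))
  · intro i _
    exact (((hF i).continuous_fderiv one_ne_zero).clm_apply
      continuous_const).continuousOn.integrableOn_compact (isCompact_hull K)

end Polynomials

end RTHybrid

namespace RTHybrid

open scoped Classical ENNReal

/-! ### Faces of the mesh and their relative interiors -/

section MeshFaces

variable {d k : ℕ} {Ω : Set (Space d)} {T : Triangulation Ω} {K L e e' : Finset (Space d)}
  {x y z a : Space d}

theorem exists_erase_eq (hK : K ∈ T.elems) (he : e ∈ T.faces) (heK : e ⊆ K) :
    ∃ a ∈ K, K.erase a = e := by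
  obtain ⟨L, -, -, hc⟩ := (mem_faces T).1 he
  exact (mem_powersetCard_iff (isSimplex_of_mem T hK)).1 (Finset.mem_powersetCard.2 ⟨heK, hc⟩)

theorem exists_elem_erase_eq (he : e ∈ T.faces) : ∃ K ∈ T.elems, ∃ a ∈ K, K.erase a = e := by
  obtain ⟨K, hK, heK, -⟩ := (mem_faces T).1 he
  exact ⟨K, hK, exists_erase_eq hK he heK⟩

theorem erase_mem_faces (hK : K ∈ T.elems) (ha : a ∈ K) : K.erase a ∈ T.faces :=
  (mem_faces T).2 ⟨K, hK, Finset.erase_subset _ _, (isSimplex_of_mem T hK).card_erase ha⟩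

theorem face_nonempty (hd : d ≠ 0) (he : e ∈ T.faces) : e.Nonempty := by
  obtain ⟨K, hK, a, ha, rfl⟩ := exists_elem_erase_eq he
  exact (isSimplex_of_mem T hK).erase_nonempty hd ha

theorem face_measure_lt_top (hd : d ≠ 0) (he : e ∈ T.faces) :
    (μHE[d - 1] : Measure (Space d)) (hull e) < ⊤ := by
  obtain ⟨K, hK, a, ha, rfl⟩ := exists_elem_erase_eq he
  exact (isSimplex_of_mem T hK).face_measure_lt_top hd ha

theorem integrableOn_face (hd : d ≠ 0) (he : e ∈ T.faces) {g : Space d → ℝ} (hg : Continuous g) :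
    IntegrableOn g (hull e) μHE[d - 1] := by
  obtain ⟨K, hK, a, ha, rfl⟩ := exists_elem_erase_eq he
  exact (isSimplex_of_mem T hK).integrableOn_face hd ha hg

theorem eq_zero_of_integral_face_eq_zero (hd : d ≠ 0) (he : e ∈ T.faces)
    {g : Space d → ℝ} (hg : Continuous g) (h0 : ∀ x ∈ hull e, 0 ≤ g x)
    (hint : ∫ x in hull e, g x ∂μHE[d - 1] = 0) (hx : x ∈ hull e) : g x = 0 := by
  obtain ⟨K, hK, a, ha, rfl⟩ := exists_elem_erase_eq he
  exact (isSimplex_of_mem T hK).eq_zero_of_integral_face_eq_zero hd ha hg h0 hint hx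

theorem hull_face_subset_closure (he : e ∈ T.faces) : hull e ⊆ closure Ω := by
  obtain ⟨K, hK, a, ha, rfl⟩ := exists_elem_erase_eq he
  exact hull_erase_subset.trans (hull_subset_closure T hK)

theorem sum_faces (hK : K ∈ T.elems) (G : Finset (Space d) → ℝ) :
    ∑ e : T.faces with e.1 ⊆ K, G e.1 = ∑ a ∈ K, G (K.erase a) := by
  rw [← sum_powersetCard (isSimplex_of_mem T hK), Finset.sum_filter,
    Finset.sum_coe_sort T.faces fun e => if e ⊆ K then G e else 0, ← Finset.sum_filter]
  congr 1
  ext e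
  rw [Finset.mem_filter, Finset.mem_powersetCard, mem_faces]
  constructor
  · rintro ⟨⟨L, -, -, h⟩, h2⟩; exact ⟨h2, h⟩
  · rintro ⟨h2, h⟩; exact ⟨⟨K, hK, h2, h⟩, h2⟩

theorem sum_elems_faces_comm (P : T.faces → Prop) [DecidablePred P] (F : T.elems → T.faces → ℝ) :
    ∑ K : T.elems, ∑ e : T.faces with e.1 ⊆ K.1 ∧ P e, F K e =
      ∑ e : T.faces with P e, ∑ K : T.elems with e.1 ⊆ K.1, F K e := by
  simp only [Finset.sum_filter]
  rw [Finset.sum_comm]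
  refine Finset.sum_congr rfl fun e _ => ?_
  by_cases h : P e <;> simp [h]

/-- The points of a simplex with positive barycentric coordinates. -/
def relInterior (e : Finset (Space d)) : Set (Space d) :=
  {x | ∃ w : Space d → ℝ, (∀ a ∈ e, 0 < w a) ∧ ∑ a ∈ e, w a = 1 ∧ ∑ a ∈ e, w a • a = x}

theorem relInterior_subset_hull : relInterior e ⊆ hull e := by
  rintro x ⟨w, h0, h1, h2⟩
  exact Finset.mem_convexHull'.2 ⟨w, fun a ha => (h0 a ha).le, h1, h2⟩

theorem barycenter_mem_relInterior (he : e.Nonempty) : barycenter e ∈ relInterior e := by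
  have h := he.card_pos
  refine ⟨fun _ => (e.card : ℝ)⁻¹, fun _ _ => by positivity, ?_, ?_⟩
  · have : (e.card : ℝ) ≠ 0 := by exact_mod_cast h.ne'
    simp [this]
  · rw [barycenter, Finset.smul_sum]

theorem add_smul_sub_mem_relInterior (hy : y ∈ hull e) (hz : z ∈ relInterior e) {t : ℝ}
    (ht0 : 0 < t) (ht1 : t ≤ 1) : y + t • (z - y) ∈ relInterior e := by
  obtain ⟨w, h0, h1, rfl⟩ := Finset.mem_convexHull'.1 hy
  obtain ⟨w', h0', h1', rfl⟩ := hz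
  refine ⟨fun a => (1 - t) * w a + t * w' a, fun a ha => ?_, ?_, ?_⟩
  · have := mul_nonneg (sub_nonneg.2 ht1) (h0 a ha)
    have := mul_pos ht0 (h0' a ha)
    linarith
  · rw [Finset.sum_add_distrib, ← Finset.mul_sum, ← Finset.mul_sum, h1, h1']; ring
  · simp only [add_smul, mul_smul, Finset.sum_add_distrib, ← Finset.smul_sum]
    module

theorem IsSimplex.coord_pos_of_mem_relInterior (hK : IsSimplex K) (hd : d ≠ 0) (he : e ⊆ K)
    (ha : a ∈ e) (hx : x ∈ relInterior e) : 0 < coord K a x := by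
  obtain ⟨w, h0, h1, rfl⟩ := hx
  have h2 : ∀ b ∈ e, (if b ∈ e then w b else 0) = w b := fun b hb => if_pos hb
  have h3 : ∑ b ∈ K, (if b ∈ e then w b else 0) = 1 := by
    rw [← h1, ← Finset.sum_congr rfl h2]
    exact (Finset.sum_subset he fun b _ hb => if_neg hb).symm
  have h4 : ∑ b ∈ e, w b • b = ∑ b ∈ K, (if b ∈ e then w b else 0) • b := by
    rw [← Finset.sum_subset he fun b _ hb => by rw [if_neg hb, zero_smul]]
    exact Finset.sum_congr rfl fun b hb => by rw [h2 b hb]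
  rw [h4, hK.coord_sum hd (he ha) _ h3, if_pos ha]
  exact h0 a ha

/-- The relative interior of a face meets no other face. -/
theorem eq_of_mem_relInterior (hd : d ≠ 0) (he : e ∈ T.faces) (he' : e' ∈ T.faces)
    (hx : x ∈ relInterior e) (hx' : x ∈ hull e') : e = e' := by
  obtain ⟨K, hK, heK, hce⟩ := (mem_faces T).1 he
  obtain ⟨L, hL, heL, hce'⟩ := (mem_faces T).1 he'
  have hKs := isSimplex_of_mem T hK
  have hLs := isSimplex_of_mem T hL
  have hKL := T.conforming K hK L hL ⟨convexHull_mono (by exact_mod_cast heK)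
    (relInterior_subset_hull hx), convexHull_mono (by exact_mod_cast heL) hx'⟩
  -- If a vertex of `e` were missing from `L`, its coordinate in `K` would vanish on the hull of `K
  -- ∩ L`, which contains `x`. The same argument inside `L` then gives `e ⊆ e'`.
  have h1 : e ⊆ L := by
    intro a ha
    by_contra haL
    refine (hKs.coord_pos_of_mem_relInterior hd heK ha hx).ne'
      (hKs.coord_eq_zero hd (heK ha) (convexHull_mono ?_ hKL))
    rintro b ⟨hb1, hb2⟩
    simp only [Finset.mem_coe, Finset.mem_erase] at *
    exact ⟨by rintro rfl; exact haL hb2, hb1⟩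
  refine Finset.eq_of_subset_of_card_le ?_ (by rw [hce, hce'])
  intro a ha
  by_contra hae
  refine (hLs.coord_pos_of_mem_relInterior hd h1 ha hx).ne'
    (hLs.coord_eq_zero hd (h1 ha) (convexHull_mono ?_ hx'))
  intro b hb
  simp only [Finset.mem_coe, Finset.mem_erase] at *
  exact ⟨by rintro rfl; exact hae hb, heL hb⟩

theorem exists_polynomial_eval_eq (p : Poly d) (x v : Space d) :
    ∃ P : Polynomial ℝ, ∀ t, P.eval t = evalAt (x + t • v) p := by
  induction p using MvPolynomial.induction_on with
  | C c => exact ⟨Polynomial.C c, by simp⟩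
  | add p q hp hq =>
    obtain ⟨P, hP⟩ := hp
    obtain ⟨Q, hQ⟩ := hq
    exact ⟨P + Q, by simp [hP, hQ]⟩
  | mul_X p i hp =>
    obtain ⟨P, hP⟩ := hp
    exact ⟨P * (Polynomial.C (x i) + Polynomial.C (v i) * Polynomial.X),
      fun t => by simp [hP, mul_comm t]⟩

/-- A polynomial vanishing on an initial piece of a segment vanishes at its end. -/
theorem evalAt_eq_zero_of_segment {p : Poly d} {ε : ℝ} (hε : 0 < ε)
    (h : ∀ t : ℝ, 0 < t → t < ε → evalAt (x + t • (y - x)) p = 0) : evalAt y p = 0 := by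
  obtain ⟨P, heval⟩ := exists_polynomial_eval_eq p x (y - x)
  have h0 : P = 0 := by
    refine Polynomial.eq_zero_of_infinite_isRoot P ((Ioo_infinite hε).mono ?_)
    intro t ht
    change P.eval t = 0
    rw [heval, h t ht.1 ht.2]
  have := heval 1
  rw [h0] at this
  simpa using this.symm

end MeshFaces

/-! ### Integrals over the domain as sums over elements -/

section MeshIntegrals

variable {d k : ℕ} {Ω : Set (Space d)} {T : Triangulation Ω} {K L e e' : Finset (Space d)}
  {x y z a : Space d}

/-- The closed elements cover `Ω`, and the frontier of a convex set is a null set. -/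
theorem cells_ae_eq (hreg : interior (closure Ω) = Ω) :
    (⋃ K ∈ (Finset.univ : Finset T.elems), cell K.1 : Set (Space d)) =ᵐ[volume] Ω := by
  have hsub : (⋃ K ∈ (Finset.univ : Finset T.elems), cell K.1) ⊆ Ω :=
    iUnion₂_subset fun K _ => cell_subset T hreg K.2
  refine Filter.EventuallyLE.antisymm (Filter.Eventually.of_forall fun x hx => hsub hx) ?_
  have h1 : ∀ᵐ x ∂(volume : Measure (Space d)), ∀ K : T.elems, (x ∈ cell K.1) = (x ∈ hull K.1) :=
    ae_all_iff.2 fun K => cell_ae_eq_hull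
  filter_upwards [h1] with x hx hxΩ
  have h2 : x ∈ ⋃ K ∈ T.elems, hull K := by rw [T.cover]; exact subset_closure hxΩ
  simp only [mem_iUnion] at h2
  obtain ⟨K, hK, hxK⟩ := h2
  have h3 : x ∈ cell K := by rw [hx ⟨K, hK⟩]; exact hxK
  exact mem_iUnion₂.2 ⟨⟨K, hK⟩, Finset.mem_univ _, h3⟩

theorem ae_restrict_iff_cells (hreg : interior (closure Ω) = Ω) {P : Space d → Prop} :
    (∀ᵐ x ∂volume.restrict Ω, P x) ↔
      ∀ K : T.elems, ∀ᵐ x ∂volume.restrict (cell K.1), P x := by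
  rw [← Measure.restrict_congr_set (cells_ae_eq (T := T) hreg)]
  simp only [Finset.mem_univ, iUnion_true]
  exact ae_restrict_iUnion_iff _ _

theorem setIntegral_eq_sum_cells (hd : d ≠ 0) (hreg : interior (closure Ω) = Ω) {G : Space d → ℝ}
    {g : T.elems → Space d → ℝ} (hint : ∀ K, IntegrableOn (g K) (cell K.1))
    (heq : ∀ K, EqOn G (g K) (cell K.1)) : ∫ x in Ω, G x = ∑ K : T.elems, ∫ x in cell K.1, g K x := by
  rw [← setIntegral_congr_set (cells_ae_eq (T := T) hreg), integral_biUnion_finset]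
  · exact Finset.sum_congr rfl fun K _ => setIntegral_congr_fun isOpen_cell.measurableSet (heq K)
  · exact fun K _ => isOpen_cell.measurableSet
  · intro K _ L _ hKL
    exact (disjoint_cell T hd K.2 L.2 (fun h => hKL (Subtype.ext h))).mono_right cell_subset_hull
  · exact fun K _ => (hint K).congr_fun (heq K).symm isOpen_cell.measurableSet

theorem integrableOn_cell {g : Space d → ℝ} (hg : Continuous g) : IntegrableOn g (cell K) :=
  (hg.continuousOn.integrableOn_compact (isCompact_hull K)).mono_set cell_subset_hull

theorem setIntegral_cell_eq (g : Space d → ℝ) : ∫ x in cell K, g x = ∫ x in hull K, g x :=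
  setIntegral_congr_set cell_ae_eq_hull

theorem volume_lt_top (T : Triangulation Ω) : volume Ω < ⊤ := by
  refine (measure_mono subset_closure).trans_lt ?_
  rw [← T.cover]
  exact (measure_biUnion_finset_le _ _).trans_lt
    (ENNReal.sum_lt_top.2 fun K _ => (isCompact_hull K).measure_lt_top)

/-- The function that is `g K` on each (open) element `K`. -/
noncomputable def pwFun {E : Type*} [AddCommMonoid E] (g : T.elems → Space d → E) (x : Space d) : E :=
  ∑ K : T.elems, (cell K.1).indicator (g K) x

theorem pwFun_eq (hd : d ≠ 0) {E : Type*} [AddCommMonoid E] (g : T.elems → Space d → E)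
    (K : T.elems) (hx : x ∈ cell K.1) : pwFun g x = g K x := by
  rw [pwFun, Finset.sum_eq_single K]
  · exact indicator_of_mem hx _
  · intro L _ hL
    refine indicator_of_notMem (fun h => ?_) _
    exact Set.disjoint_left.1 (disjoint_cell T hd K.2 L.2 (fun h => hL (Subtype.ext h.symm))) hx
      (cell_subset_hull h)
  · simp

theorem memLp_pwFun {E : Type*} [NormedAddCommGroup E] {g : T.elems → Space d → E}
    (hg : ∀ K, Continuous (g K)) : MemLp (pwFun g) 2 (volume.restrict Ω) := by
  have h1 : ∀ K : T.elems, MemLp ((cell K.1).indicator (g K)) 2 (volume : Measure (Space d)) := by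
    intro K
    rw [memLp_indicator_iff_restrict isOpen_cell.measurableSet]
    have hfin : IsFiniteMeasure ((volume : Measure (Space d)).restrict (cell K.1)) :=
      isFiniteMeasure_restrict.2
        ((measure_mono cell_subset_hull).trans_lt (isCompact_hull K.1).measure_lt_top).ne
    obtain ⟨C, hC⟩ := ((isCompact_hull K.1).image (hg K)).isBounded.exists_norm_le
    refine MemLp.of_bound ((hg K).continuousOn.aestronglyMeasurable_of_subset_isCompact
      (isCompact_hull K.1) isOpen_cell.measurableSet cell_subset_hull) C ?_
    exact (ae_restrict_mem isOpen_cell.measurableSet).mono fun x hx =>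
      hC _ ⟨x, cell_subset_hull hx, rfl⟩
  exact (memLp_finsetSum _ fun K _ => h1 K).restrict Ω

end MeshIntegrals

end RTHybrid

namespace RTHybrid

open scoped Classical ENNReal

/-! ### Weak divergence and normal jumps of piecewise polynomial fields -/

section WeakDivergence

variable {d k : ℕ} {Ω : Set (Space d)} {T : Triangulation Ω} {K L e e' : Finset (Space d)}
  {x y z a : Space d} {φ : Space d → ℝ}

/-- The sum of the normal components on the face `e` of the fields of the adjacent elements. -/
noncomputable def normalJump (q : T.elems → Fin d → Poly d) (e : Finset (Space d)) (x : Space d) : ℝ :=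
  ∑ K : T.elems with e ⊆ K.1, normalTrace K.1 e (q K) x

theorem exists_evalAt_eq_normalJump (q : T.elems → Fin d → Poly d) (e : Finset (Space d)) :
    ∃ p : Poly d, ∀ x, normalJump q e x = evalAt x p := by
  refine ⟨∑ K : T.elems with e ⊆ K.1, ∑ i, outwardNormal K.1 e i • q K i, fun x => ?_⟩
  simp [normalJump, normalTrace, inner_vecEvalAt]

theorem continuous_normalJump (q : T.elems → Fin d → Poly d) (e : Finset (Space d)) :
    Continuous (normalJump q e) :=
  continuous_finsetSum _ fun K _ => continuous_normalTrace K.1 e (q K)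

theorem integral_cell_div (hd : d ≠ 0) (hφ : ContDiff ℝ 1 φ) (q : Fin d → Poly d)
    (hK : K ∈ T.elems) :
    ∫ x in cell K, (fderiv ℝ φ x (vecEvalAt x q) + φ x * evalAt x (polyDiv q)) =
      ∑ e : T.faces with e.1 ⊆ K, ∫ x in hull e.1, φ x * normalTrace K e.1 q x ∂μHE[d - 1] := by
  rw [setIntegral_cell_eq, (isSimplex_of_mem T hK).integral_div hd hφ q,
    sum_faces hK fun e => ∫ x in hull e, φ x * normalTrace K e q x ∂μHE[d - 1]]

/-- The elementwise Green formulas regrouped by faces. The right side is what separates the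
distributional from the elementwise divergence, and both directions of the `H(div)` criterion are
read off from it. -/
theorem sum_integral_cell_div (hd : d ≠ 0) (hφ : ContDiff ℝ 1 φ) (q : T.elems → Fin d → Poly d) :
    ∑ K : T.elems, ∫ x in cell K.1,
        (fderiv ℝ φ x (vecEvalAt x (q K)) + φ x * evalAt x (polyDiv (q K))) =
      ∑ e : T.faces, ∫ x in hull e.1, φ x * normalJump q e.1 x ∂μHE[d - 1] := by
  simp_rw [integral_cell_div hd hφ _ (Subtype.prop _)]
  have := sum_elems_faces_comm (T := T) (fun _ => True) fun K e =>
    ∫ x in hull e.1, φ x * normalTrace K.1 e.1 (q K) x ∂μHE[d - 1]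
  simp only [and_true, Finset.filter_true] at this
  rw [this]
  refine Finset.sum_congr rfl fun e _ => ?_
  rw [← integral_finsetSum]
  · simp only [normalJump, Finset.mul_sum]
  · exact fun K _ => integrableOn_face hd e.2 (hφ.continuous.mul (continuous_normalTrace _ _ _))

theorem continuous_fderiv_vecEvalAt (hφ : ContDiff ℝ 1 φ) (q : Fin d → Poly d) :
    Continuous fun x => fderiv ℝ φ x (vecEvalAt x q) :=
  (hφ.continuous_fderiv one_ne_zero).clm_apply (continuous_vecEvalAt q)

theorem integrableOn_cell_mul (hφ : Continuous φ) (p : Poly d) :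
    IntegrableOn (fun x => φ x * evalAt x p) (cell K) :=
  integrableOn_cell (hφ.mul (continuous_evalAt p))

theorem eq_zero_on_frontier (hopen : IsOpen Ω) (hsupp : tsupport φ ⊆ Ω) (hx : x ∈ frontier Ω) :
    φ x = 0 := by
  by_contra h
  rw [hopen.frontier_eq] at hx
  exact hx.2 (hsupp (subset_tsupport φ h))

/-- On a face inside the frontier the test function vanishes; on every other face the jump does. -/
theorem hasWeakDiv_of_normalJump_eq_zero (hd : d ≠ 0) (hopen : IsOpen Ω)
    (hreg : interior (closure Ω) = Ω) {q : T.elems → Fin d → Poly d}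
    (hq : ∀ e ∈ T.faces, ¬ OnBoundary Ω e → ∀ x ∈ hull e, normalJump q e x = 0) :
    HasWeakDiv Ω (pwFun fun K x => vecEvalAt x (q K)) (pwFun fun K x => evalAt x (polyDiv (q K))) := by
  intro φ hφ _ hsupp
  have hφ1 : ContDiff ℝ 1 φ := hφ.of_le (by norm_cast)
  have h := sum_integral_cell_div hd hφ1 q
  have hzero : ∑ e : T.faces, ∫ x in hull e.1, φ x * normalJump q e.1 x ∂μHE[d - 1] = 0 := by
    refine Finset.sum_eq_zero fun e _ => ?_
    refine setIntegral_eq_zero_of_forall_eq_zero fun x hx => ?_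
    by_cases hb : OnBoundary Ω e.1
    · rw [eq_zero_on_frontier hopen hsupp (hb hx), zero_mul]
    · rw [hq e.1 e.2 hb x hx, mul_zero]
  have hi1 := fun K : T.elems => integrableOn_cell (K := K.1) (continuous_fderiv_vecEvalAt hφ1 (q K))
  have hi2 := fun K : T.elems => integrableOn_cell_mul (K := K.1) hφ1.continuous
    (polyDiv (q K))
  rw [hzero, Finset.sum_congr rfl fun K _ => integral_add (hi1 K) (hi2 K),
    Finset.sum_add_distrib] at h
  rw [setIntegral_eq_sum_cells hd hreg hi1 fun K x hx => by
      simp only [pwFun_eq hd _ K hx],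
    setIntegral_eq_sum_cells hd hreg hi2 fun K x hx => by
      simp only [pwFun_eq hd _ K hx, mul_comm]]
  linarith

theorem disjoint_cell_face (hd : d ≠ 0) (hK : K ∈ T.elems) (he : e ∈ T.faces) (heK : e ⊆ K) :
    Disjoint (cell K) (hull e) := by
  obtain ⟨a, ha, rfl⟩ := exists_erase_eq hK he heK
  rw [Set.disjoint_left]
  intro x hx hxe
  exact ((isSimplex_of_mem T hK).coord_pos hd ha hx).ne'
    ((isSimplex_of_mem T hK).coord_eq_zero hd ha hxe)

/-- A distributional divergence of a piecewise polynomial field is the elementwise divergence. -/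
theorem ae_eq_of_hasWeakDiv (hd : d ≠ 0) (hreg : interior (closure Ω) = Ω)
    {q : T.elems → Fin d → Poly d} {g : Space d → ℝ} (hg : MemLp g 2 (volume.restrict Ω))
    (h : HasWeakDiv Ω (pwFun fun K x => vecEvalAt x (q K)) g) :
    g =ᵐ[volume.restrict Ω] pwFun fun K x => evalAt x (polyDiv (q K)) := by
  have hfin : IsFiniteMeasure ((volume : Measure (Space d)).restrict Ω) :=
    isFiniteMeasure_restrict.2 (volume_lt_top T).ne
  have hgi : IntegrableOn g Ω := hg.integrable one_le_two
  refine (ae_restrict_iff_cells (T := T) hreg).2 fun K => ?_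
  have hKΩ := cell_subset T hreg K.2
  have hloc : LocallyIntegrableOn (fun x => g x - evalAt x (polyDiv (q K))) (cell K.1) :=
    ((hgi.mono_set hKΩ).sub (integrableOn_cell (continuous_evalAt _))).locallyIntegrableOn
  have key := isOpen_cell.ae_eq_zero_of_integral_contDiff_smul_eq_zero hloc ?_
  · rw [ae_restrict_iff' isOpen_cell.measurableSet]
    filter_upwards [key] with x hx hxK
    rw [pwFun_eq hd _ K hxK]
    exact sub_eq_zero.1 (hx hxK)
  -- A test function supported in one open cell vanishes on all faces of that cell, so Green's
  -- formula has no boundary term.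
  intro φ hφ hcomp hsupp
  have hφ1 : ContDiff ℝ 1 φ := hφ.of_le (by norm_cast)
  have hφ0 : ∀ x, x ∉ cell K.1 → φ x = 0 := fun x hx =>
    image_eq_zero_of_notMem_tsupport fun h => hx (hsupp h)
  have hdφ0 : ∀ x, x ∉ cell K.1 → fderiv ℝ φ x = 0 := fun x hx =>
    image_eq_zero_of_notMem_tsupport fun h => hx (hsupp (tsupport_fderiv_subset ℝ h))
  have h1 := h φ hφ hcomp (hsupp.trans hKΩ)
  have h2 : ∫ x in Ω, fderiv ℝ φ x (pwFun (fun K x => vecEvalAt x (q K)) x) =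
      ∫ x in cell K.1, fderiv ℝ φ x (vecEvalAt x (q K)) := by
    rw [setIntegral_eq_of_subset_of_forall_sdiff_eq_zero
      (isOpen_interior (s := closure Ω) |> fun h => by rw [hreg] at h; exact h.measurableSet) hKΩ
      fun x hx => by rw [hdφ0 x hx.2]; rfl]
    exact setIntegral_congr_fun isOpen_cell.measurableSet fun x hx => by
      simp only [pwFun_eq hd _ K hx]
  have h3 : ∫ x in Ω, g x * φ x = ∫ x in cell K.1, g x * φ x :=
    setIntegral_eq_of_subset_of_forall_sdiff_eq_zero
      (isOpen_interior (s := closure Ω) |> fun h => by rw [hreg] at h; exact h.measurableSet) hKΩ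
      fun x hx => by rw [hφ0 x hx.2, mul_zero]
  have h4 := integral_cell_div hd hφ1 (q K) K.2
  have h5 : ∑ e : T.faces with e.1 ⊆ K.1,
      ∫ x in hull e.1, φ x * normalTrace K.1 e.1 (q K) x ∂μHE[d - 1] = 0 := by
    refine Finset.sum_eq_zero fun e he => setIntegral_eq_zero_of_forall_eq_zero fun x hx => ?_
    rw [hφ0 x fun hxK => Set.disjoint_left.1
      (disjoint_cell_face hd K.2 e.2 (Finset.mem_filter.1 he).2) hxK hx, zero_mul]
  have hi2 := integrableOn_cell_mul (K := K.1) hφ1.continuous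
    (polyDiv (q K))
  rw [h5, integral_add (integrableOn_cell (continuous_fderiv_vecEvalAt hφ1 (q K))) hi2] at h4
  rw [h2, h3] at h1
  obtain ⟨C, hC⟩ := hφ1.continuous.bounded_above_of_compact_support hcomp
  have hi3 : IntegrableOn (fun x => g x * φ x) (cell K.1) :=
    (hgi.mono_set hKΩ).mul_bdd (c := C) hφ1.continuous.aestronglyMeasurable
      (Filter.Eventually.of_forall hC)
  have h6 : ∫ x, φ x • (g x - evalAt x (polyDiv (q K))) =
      ∫ x in cell K.1, (g x * φ x - φ x * evalAt x (polyDiv (q K))) := by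
    rw [← setIntegral_eq_integral_of_forall_compl_eq_zero (s := cell K.1) fun x hx => by
      rw [hφ0 x hx, zero_smul]]
    congr 1
    funext x
    simp only [smul_eq_mul]
    ring
  rw [h6, integral_sub hi3 hi2]
  linarith

/-- The normal components of a piecewise polynomial field in `H(div)` match across interior
faces. -/
theorem normalJump_eq_zero (hd : d ≠ 0) (hopen : IsOpen Ω)
    (hreg : interior (closure Ω) = Ω) {q : T.elems → Fin d → Poly d} {g : Space d → ℝ}
    (hg : MemLp g 2 (volume.restrict Ω))
    (h : HasWeakDiv Ω (pwFun fun K x => vecEvalAt x (q K)) g)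
    (he : e ∈ T.faces) (heb : ¬ OnBoundary Ω e) (hy : y ∈ hull e) : normalJump q e y = 0 := by
  have hae := ae_eq_of_hasWeakDiv hd hreg hg h
  -- Since `g` is the elementwise divergence, the volume terms cancel and only the jumps, integrated
  -- against `φ`, remain.
  have htest : ∀ φ : Space d → ℝ, ContDiff ℝ ∞ φ → HasCompactSupport φ → tsupport φ ⊆ Ω →
      ∑ e : T.faces, ∫ x in hull e.1, φ x * normalJump q e.1 x ∂μHE[d - 1] = 0 := by
    intro φ hφ hcomp hsupp
    have hφ1 : ContDiff ℝ 1 φ := hφ.of_le (by norm_cast)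
    have h1 := h φ hφ hcomp hsupp
    have h2 : ∫ x in Ω, g x * φ x =
        ∫ x in Ω, pwFun (T := T) (fun K x => evalAt x (polyDiv (q K))) x * φ x :=
      integral_congr_ae (hae.mono fun x hx => by simp only [hx])
    have hi1 := fun K : T.elems =>
      integrableOn_cell (K := K.1) (continuous_fderiv_vecEvalAt hφ1 (q K))
    have hi2 := fun K : T.elems => integrableOn_cell_mul (K := K.1) hφ1.continuous
      (polyDiv (q K))
    rw [← sum_integral_cell_div hd hφ1 q, Finset.sum_congr rfl fun K _ =>
      integral_add (hi1 K) (hi2 K), Finset.sum_add_distrib]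
    rw [h2, setIntegral_eq_sum_cells hd hreg hi1 fun K x hx => by
        simp only [pwFun_eq hd _ K hx],
      setIntegral_eq_sum_cells hd hreg hi2 fun K x hx => by
        simp only [pwFun_eq hd _ K hx, mul_comm]] at h1
    linarith
  have hrel : ∀ x ∈ relInterior e, x ∈ Ω → normalJump q e x = 0 := by
    intro x hx hxΩ
    by_contra hne
    -- A bump function supported in `V` sees no other face, and on `V` the jump keeps the sign it
    -- has at `x`. The integrand is then nonnegative with zero integral, yet positive at `x`.
    set V : Set (Space d) := (Ω ∩ ⋂ e' ∈ T.faces.erase e, (hull e')ᶜ) ∩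
      {z | 0 < normalJump q e z * normalJump q e x} with hV
    have hVo : IsOpen V := by
      refine (hopen.inter (isOpen_biInter_finset fun e' _ => (isClosed_hull e').isOpen_compl)).inter ?_
      exact isOpen_lt continuous_const ((continuous_normalJump q e).mul continuous_const)
    have hxV : x ∈ V := by
      refine ⟨⟨hxΩ, mem_iInter₂.2 fun e' he' hx' => ?_⟩, mul_self_pos.2 hne⟩
      rw [Finset.mem_erase] at he'
      exact he'.1 (eq_of_mem_relInterior hd he he'.2 hx hx').symm
    obtain ⟨φ, hsupp, hcomp, hφ, hrange, hφx⟩ :=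
      exists_contDiff_tsupport_subset (n := ⊤) (hVo.mem_nhds hxV)
    have hφ0 : ∀ z, z ∉ V → φ z = 0 := fun z hz =>
      image_eq_zero_of_notMem_tsupport fun h => hz (hsupp h)
    have h1 := htest φ hφ hcomp (hsupp.trans fun z hz => hz.1.1)
    rw [Finset.sum_eq_single ⟨e, he⟩] at h1
    · have h2 := eq_zero_of_integral_face_eq_zero hd he
        (g := fun z => φ z * normalJump q e z * normalJump q e x)
        ((hφ.continuous.mul (continuous_normalJump q e)).mul continuous_const) ?_ ?_
        (relInterior_subset_hull hx)
      · simp only [hφx, one_mul] at h2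
        exact hne (mul_self_eq_zero.1 h2)
      · intro z _
        by_cases hz : z ∈ V
        · rw [mul_assoc]
          exact mul_nonneg (hrange ⟨z, rfl⟩).1 (le_of_lt hz.2)
        · rw [hφ0 z hz]; simp
      · rw [integral_mul_const, h1, zero_mul]
    · intro e' _ hne'
      refine setIntegral_eq_zero_of_forall_eq_zero fun z hz => ?_
      rw [hφ0 z, zero_mul]
      intro hzV
      refine mem_iInter₂.1 hzV.1.2 e'.1 ?_ hz
      exact Finset.mem_erase.2 ⟨fun h => hne' (Subtype.ext h), e'.2⟩
    · simp
  -- A face not contained in the frontier meets `Ω` somewhere, possibly only at its rim. Moving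
  -- slightly towards the barycenter gives a point of the relative interior that is still in `Ω`.
  obtain ⟨z, hz, hzΩ⟩ : ∃ z ∈ hull e, z ∈ Ω := by
    by_contra! hcon
    refine heb fun z hz => ?_
    rw [hopen.frontier_eq]
    exact ⟨hull_face_subset_closure he hz, hcon z hz⟩
  have hb := barycenter_mem_relInterior (face_nonempty hd he)
  have hnear : ∀ x v : Space d, x ∈ Ω → ∃ ε : ℝ, 0 < ε ∧ ∀ t : ℝ, 0 < t → t < ε → x + t • v ∈ Ω := by
    intro x v hx
    have hc : ContinuousAt (fun t : ℝ => x + t • v) 0 := by fun_prop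
    have hm : Ω ∈ nhds ((fun t : ℝ => x + t • v) 0) := by
      simpa using hopen.mem_nhds hx
    obtain ⟨ε, hε, hball⟩ := Metric.mem_nhds_iff.1 (hc hm)
    refine ⟨ε, hε, fun t ht0 ht1 => hball ?_⟩
    rw [Metric.mem_ball, Real.dist_eq, sub_zero, abs_of_pos ht0]
    exact ht1
  obtain ⟨x, hx, hxΩ⟩ : ∃ x ∈ relInterior e, x ∈ Ω := by
    obtain ⟨ε, hε, hball⟩ := hnear z (barycenter e - z) hzΩ
    have h0 : 0 < min (ε / 2) 1 := by positivity
    exact ⟨_, add_smul_sub_mem_relInterior hz hb h0 (min_le_right _ _),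
      hball _ h0 ((min_le_left _ _).trans_lt (by linarith))⟩
  obtain ⟨p, hp⟩ := exists_evalAt_eq_normalJump q e
  -- The jump is a polynomial and vanishes on the start of the segment from `x` to `y`, hence at
  -- `y`, even if the segment leaves `Ω`.
  obtain ⟨ε, hε, hball⟩ := hnear x (y - x) hxΩ
  rw [hp]
  refine evalAt_eq_zero_of_segment (x := x) (ε := min ε 1) (by positivity) fun t ht0 ht1 => ?_
  rw [← hp]
  have ht2 := ht1.trans_le (min_le_right _ _)
  refine hrel _ ?_ (hball t ht0 (ht1.trans_le (min_le_left _ _)))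
  have := add_smul_sub_mem_relInterior hy hx (t := 1 - t) (by linarith) (by linarith)
  convert this using 1
  module

theorem weakDiv_ae_eq (hd : d ≠ 0) (hreg : interior (closure Ω) = Ω)
    {q : T.elems → Fin d → Poly d} (h : MemHdiv Ω (pwFun fun K x => vecEvalAt x (q K))) :
    weakDiv Ω (pwFun fun K x => vecEvalAt x (q K)) =ᵐ[volume.restrict Ω]
      pwFun fun K x => evalAt x (polyDiv (q K)) := by
  rw [weakDiv, dif_pos h.2]
  exact ae_eq_of_hasWeakDiv hd hreg h.2.choose_spec.1 h.2.choose_spec.2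

theorem memHdiv_iff (hd : d ≠ 0) (hopen : IsOpen Ω) (hreg : interior (closure Ω) = Ω)
    {q : T.elems → Fin d → Poly d} :
    MemHdiv Ω (pwFun fun K x => vecEvalAt x (q K)) ↔
      ∀ e ∈ T.faces, ¬ OnBoundary Ω e → ∀ x ∈ hull e, normalJump q e x = 0 := by
  constructor
  · rintro ⟨-, g, hg, h⟩ e he heb x hx
    exact normalJump_eq_zero hd hopen hreg hg h he heb hx
  · intro h
    exact ⟨memLp_pwFun fun K => continuous_vecEvalAt (q K), _,
      memLp_pwFun fun K => continuous_evalAt (polyDiv (q K)),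
      hasWeakDiv_of_normalJump_eq_zero hd hopen hreg h⟩

end WeakDivergence

end RTHybrid

namespace RTHybrid

open scoped Classical

section Forms

variable {d k : ℕ} {Ω : Set (Space d)} {T : Triangulation Ω} {K e : Finset (Space d)}
  {κ f u₀ : Space d → ℝ}

/-! ### Linearity of the forms -/

theorem vecEvalAt_add (x : Space d) (q r : Fin d → Poly d) :
    vecEvalAt x (q + r) = vecEvalAt x q + vecEvalAt x r := by
  ext i; simp [vecEvalAt]

theorem vecEvalAt_smul (x : Space d) (c : ℝ) (q : Fin d → Poly d) :
    vecEvalAt x (c • q) = c • vecEvalAt x q := by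
  ext i; simp [vecEvalAt]

theorem polyDiv_add (q r : Fin d → Poly d) : polyDiv (q + r) = polyDiv q + polyDiv r := by
  simp [polyDiv, Finset.sum_add_distrib]

theorem polyDiv_smul (c : ℝ) (q : Fin d → Poly d) : polyDiv (c • q) = c • polyDiv q := by
  simp [polyDiv, Finset.smul_sum]

theorem normalTrace_add (K e : Finset (Space d)) (q r : Fin d → Poly d) (x : Space d) :
    normalTrace K e (q + r) x = normalTrace K e q x + normalTrace K e r x := by
  simp only [normalTrace, vecEvalAt_add, inner_add_left]

theorem normalTrace_smul (K e : Finset (Space d)) (c : ℝ) (q : Fin d → Poly d) (x : Space d) :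
    normalTrace K e (c • q) x = c * normalTrace K e q x := by
  simp only [normalTrace, vecEvalAt_smul, inner_smul_left, conj_trivial]

theorem integrableOn_mul_continuous {w g : Space d → ℝ} (hw : IntegrableOn w (cell K))
    (hg : Continuous g) : IntegrableOn (fun x => w x * g x) (cell K) := by
  obtain ⟨C, hC⟩ := ((isCompact_hull K).image hg).isBounded.exists_norm_le
  exact Integrable.mul_bdd (c := C) hw hg.aestronglyMeasurable
    ((ae_restrict_mem isOpen_cell.measurableSet).mono fun x hx => hC _ ⟨x, cell_subset_hull hx, rfl⟩)

theorem continuous_facePk {g : hull e → ℝ} (hg : g ∈ facePk k e) : Continuous g := by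
  obtain ⟨p, -, rfl⟩ := hg
  exact (continuous_evalAt p).comp continuous_subtype_val

theorem exists_evalAt_eq_facePk {g : hull e → ℝ} (hg : g ∈ facePk k e) :
    ∃ p ∈ Pk d k, ∀ x : hull e, g x = evalAt x.1 p := by
  obtain ⟨p, hp, rfl⟩ := hg
  exact ⟨p, hp, fun x => rfl⟩

/-- The surface measure on a face. -/
noncomputable abbrev faceMeasure (e : Finset (Space d)) : Measure (hull e) :=
  Measure.comap Subtype.val (μHE[d - 1] : Measure (Space d))

theorem isFiniteMeasure_faceMeasure (hd : d ≠ 0) (he : e ∈ T.faces) :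
    IsFiniteMeasure (faceMeasure e) := by
  refine ⟨?_⟩
  rw [faceMeasure, (MeasurableEmbedding.subtype_coe (isClosed_hull e).measurableSet).comap_apply,
    image_univ, Subtype.range_coe]
  exact face_measure_lt_top hd he

theorem integrable_mul_continuous_face {w g : hull e → ℝ} (hw : Integrable w (faceMeasure e))
    (hg : Continuous g) : Integrable (fun x => w x * g x) (faceMeasure e) := by
  have : CompactSpace (hull e) := isCompact_iff_compactSpace.1 (isCompact_hull e)
  obtain ⟨C, hC⟩ := (isCompact_range hg).isBounded.exists_norm_le
  exact Integrable.mul_bdd (c := C) hw hg.aestronglyMeasurable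
    (Filter.Eventually.of_forall fun x => hC _ ⟨x, rfl⟩)

theorem integrable_continuous_face (hd : d ≠ 0) (he : e ∈ T.faces) {g : hull e → ℝ}
    (hg : Continuous g) : Integrable g (faceMeasure e) := by
  have := isFiniteMeasure_faceMeasure hd he
  simpa using integrable_mul_continuous_face (integrable_const (1 : ℝ)) hg

theorem continuous_normalTrace_face (K e : Finset (Space d)) (q : Fin d → Poly d) :
    Continuous fun x : hull e => normalTrace K e q x :=
  (continuous_normalTrace K e q).comp continuous_subtype_val

theorem faceIntegral_add {g h : hull e → ℝ} (hg : Integrable g (faceMeasure e))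
    (hh : Integrable h (faceMeasure e)) :
    faceIntegral e (fun x => g x + h x) = faceIntegral e g + faceIntegral e h :=
  integral_add hg hh

theorem faceIntegral_mul_left (c : ℝ) (g : hull e → ℝ) :
    faceIntegral e (fun x => c * g x) = c * faceIntegral e g :=
  integral_const_mul c g

section Mass

theorem massForm_comm (q r : Vh T k) : massForm κ q r = massForm κ r q := by
  simp only [massForm, real_inner_comm]

theorem massForm_add_left
    (hκ : ∀ K : T.elems, IntegrableOn (fun x => (κ x)⁻¹) (cell K.1))
    (q q' r : Vh T k) :
    massForm κ (q + q') r = massForm κ q r + massForm κ q' r := by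
  simp only [massForm, ← Finset.sum_add_distrib]
  refine Finset.sum_congr rfl fun K _ => ?_
  rw [← integral_add
    (integrableOn_mul_continuous (hκ K) ((continuous_vecEvalAt _).inner (continuous_vecEvalAt _)))
    (integrableOn_mul_continuous (hκ K) ((continuous_vecEvalAt _).inner (continuous_vecEvalAt _)))]
  simp only [Pi.add_apply, Submodule.coe_add, vecEvalAt_add, inner_add_left, mul_add]

theorem massForm_smul_left (c : ℝ) (q r : Vh T k) :
    massForm κ (c • q) r = c * massForm κ q r := by
  simp only [massForm, Finset.mul_sum]
  refine Finset.sum_congr rfl fun K _ => ?_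
  rw [← integral_const_mul]
  simp only [Pi.smul_apply, Submodule.coe_smul, vecEvalAt_smul, inner_smul_left, conj_trivial,
    mul_left_comm]

theorem massForm_add_right
    (hκ : ∀ K : T.elems, IntegrableOn (fun x => (κ x)⁻¹) (cell K.1))
    (q r r' : Vh T k) :
    massForm κ q (r + r') = massForm κ q r + massForm κ q r' := by
  rw [massForm_comm, massForm_add_left hκ, massForm_comm r, massForm_comm r']

theorem massForm_smul_right (c : ℝ) (q r : Vh T k) :
    massForm κ q (c • r) = c * massForm κ q r := by
  rw [massForm_comm, massForm_smul_left, massForm_comm r]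

end Mass

theorem divForm_add_left (w w' : Wh T k) (q : Vh T k) :
    divForm (w + w') q = divForm w q + divForm w' q := by
  simp only [divForm, ← Finset.sum_add_distrib]
  refine Finset.sum_congr rfl fun K _ => ?_
  rw [← integral_add (integrableOn_cell_mul (continuous_evalAt _) _)
    (integrableOn_cell_mul (continuous_evalAt _) _)]
  simp only [Pi.add_apply, Submodule.coe_add, map_add, add_mul]

theorem divForm_smul_left (c : ℝ) (w : Wh T k) (q : Vh T k) :
    divForm (c • w) q = c * divForm w q := by
  simp only [divForm, Finset.mul_sum]
  refine Finset.sum_congr rfl fun K _ => ?_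
  rw [← integral_const_mul]
  simp only [Pi.smul_apply, Submodule.coe_smul, map_smul, smul_eq_mul, mul_assoc]

theorem divForm_add_right (w : Wh T k) (q q' : Vh T k) :
    divForm w (q + q') = divForm w q + divForm w q' := by
  simp only [divForm, ← Finset.sum_add_distrib]
  refine Finset.sum_congr rfl fun K _ => ?_
  rw [← integral_add (integrableOn_cell_mul (continuous_evalAt _) _)
    (integrableOn_cell_mul (continuous_evalAt _) _)]
  simp only [Pi.add_apply, Submodule.coe_add, polyDiv_add, map_add, mul_add]

theorem divForm_smul_right (c : ℝ) (w : Wh T k) (q : Vh T k) :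
    divForm w (c • q) = c * divForm w q := by
  simp only [divForm, Finset.mul_sum]
  refine Finset.sum_congr rfl fun K _ => ?_
  rw [← integral_const_mul]
  simp only [Pi.smul_apply, Submodule.coe_smul, polyDiv_smul, map_smul, smul_eq_mul, mul_left_comm]

theorem loadForm_add (hf : ∀ K : T.elems, IntegrableOn f (cell K.1)) (w w' : Wh T k) :
    loadForm f (w + w') = loadForm f w + loadForm f w' := by
  simp only [loadForm, ← Finset.sum_add_distrib]
  refine Finset.sum_congr rfl fun K _ => ?_
  rw [← integral_add (integrableOn_mul_continuous (hf K) (continuous_evalAt _))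
    (integrableOn_mul_continuous (hf K) (continuous_evalAt _))]
  simp only [Pi.add_apply, Submodule.coe_add, map_add, mul_add]

theorem loadForm_smul (c : ℝ) (w : Wh T k) : loadForm f (c • w) = c * loadForm f w := by
  simp only [loadForm, Finset.mul_sum]
  refine Finset.sum_congr rfl fun K _ => ?_
  rw [← integral_const_mul]
  simp only [Pi.smul_apply, Submodule.coe_smul, map_smul, smul_eq_mul, mul_left_comm]

theorem traceForm_eq_sum_faces (hd : d ≠ 0) (μ : Mh T k) (q : Vh T k) :
    traceForm μ q = ∑ e : T.faces,
      faceIntegral e.1 fun x => (μ e).1 x * normalJump (fun K => (q K).1) e.1 x := by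
  have := sum_elems_faces_comm (T := T) (fun _ => True) fun K e =>
    faceIntegral e.1 fun x => (μ e).1 x * normalTrace K.1 e.1 (q K).1 x
  simp only [and_true, Finset.filter_true] at this
  rw [traceForm, this]
  refine Finset.sum_congr rfl fun e _ => ?_
  simp only [faceIntegral, normalJump, Finset.mul_sum]
  rw [integral_finsetSum]
  exact fun K _ => integrable_continuous_face hd e.2
    ((continuous_facePk (μ e).2).mul (continuous_normalTrace_face _ _ _))

theorem interiorTraceForm_eq_sum_faces (hd : d ≠ 0) (q : Vh T k) (μ : Mh T k) :
    interiorTraceForm q μ = ∑ e : T.faces with ¬ OnBoundary Ω e.1,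
      faceIntegral e.1 fun x => (μ e).1 x * normalJump (fun K => (q K).1) e.1 x := by
  rw [interiorTraceForm, sum_elems_faces_comm (fun e => ¬ OnBoundary Ω e.1) fun K e =>
    faceIntegral e.1 fun x => normalTrace K.1 e.1 (q K).1 x * (μ e).1 x]
  refine Finset.sum_congr rfl fun e _ => ?_
  simp only [faceIntegral, normalJump, Finset.mul_sum, mul_comm]
  rw [integral_finsetSum]
  exact fun K _ => integrable_continuous_face hd e.2
    ((continuous_normalTrace_face _ _ _).mul (continuous_facePk (μ e).2))

theorem normalJump_add (q r : T.elems → Fin d → Poly d) (e : Finset (Space d)) (x : Space d) :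
    normalJump (fun K => q K + r K) e x = normalJump q e x + normalJump r e x := by
  simp only [normalJump, normalTrace_add, Finset.sum_add_distrib]

theorem normalJump_smul (c : ℝ) (q : T.elems → Fin d → Poly d) (e : Finset (Space d))
    (x : Space d) : normalJump (fun K => c • q K) e x = c * normalJump q e x := by
  simp only [normalJump, normalTrace_smul, Finset.mul_sum]

theorem integrable_face_mul_normalJump (hd : d ≠ 0) (μ : Mh T k) (q : T.elems → Fin d → Poly d)
    (e : T.faces) :
    Integrable (fun x : hull e.1 => (μ e).1 x * normalJump q e.1 x) (faceMeasure e.1) :=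
  integrable_continuous_face hd e.2
    ((continuous_facePk (μ e).2).mul ((continuous_normalJump q e.1).comp continuous_subtype_val))

theorem integrable_face_mul_face (hd : d ≠ 0) (lam μ : Mh T k) (e : T.faces) :
    Integrable (fun x : hull e.1 => (lam e).1 x * (μ e).1 x) (faceMeasure e.1) :=
  integrable_continuous_face hd e.2 ((continuous_facePk (lam e).2).mul (continuous_facePk (μ e).2))

theorem traceForm_add_left (hd : d ≠ 0) (μ μ' : Mh T k) (q : Vh T k) :
    traceForm (μ + μ') q = traceForm μ q + traceForm μ' q := by
  simp only [traceForm_eq_sum_faces hd, ← Finset.sum_add_distrib]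
  refine Finset.sum_congr rfl fun e _ => ?_
  rw [← faceIntegral_add (integrable_face_mul_normalJump hd μ _ e)
    (integrable_face_mul_normalJump hd μ' _ e)]
  simp only [Pi.add_apply, Submodule.coe_add, add_mul]

theorem traceForm_smul_left (hd : d ≠ 0) (c : ℝ) (μ : Mh T k) (q : Vh T k) :
    traceForm (c • μ) q = c * traceForm μ q := by
  simp only [traceForm_eq_sum_faces hd, Finset.mul_sum]
  refine Finset.sum_congr rfl fun e _ => ?_
  rw [← faceIntegral_mul_left]
  simp only [Pi.smul_apply, Submodule.coe_smul, smul_eq_mul, mul_assoc]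

theorem traceForm_add_right (hd : d ≠ 0) (μ : Mh T k) (q r : Vh T k) :
    traceForm μ (q + r) = traceForm μ q + traceForm μ r := by
  simp only [traceForm_eq_sum_faces hd, ← Finset.sum_add_distrib]
  refine Finset.sum_congr rfl fun e _ => ?_
  rw [← faceIntegral_add (integrable_face_mul_normalJump hd μ _ e)
    (integrable_face_mul_normalJump hd μ _ e)]
  simp only [Pi.add_apply, Submodule.coe_add, normalJump_add, mul_add]

theorem traceForm_smul_right (hd : d ≠ 0) (c : ℝ) (μ : Mh T k) (q : Vh T k) :
    traceForm μ (c • q) = c * traceForm μ q := by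
  simp only [traceForm_eq_sum_faces hd, Finset.mul_sum]
  refine Finset.sum_congr rfl fun e _ => ?_
  rw [← faceIntegral_mul_left]
  simp only [Pi.smul_apply, Submodule.coe_smul, normalJump_smul, mul_left_comm]

theorem interiorTraceForm_add_left (hd : d ≠ 0) (q r : Vh T k) (μ : Mh T k) :
    interiorTraceForm (q + r) μ = interiorTraceForm q μ + interiorTraceForm r μ := by
  simp only [interiorTraceForm_eq_sum_faces hd, ← Finset.sum_add_distrib]
  refine Finset.sum_congr rfl fun e _ => ?_
  rw [← faceIntegral_add (integrable_face_mul_normalJump hd μ _ e)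
    (integrable_face_mul_normalJump hd μ _ e)]
  simp only [Pi.add_apply, Submodule.coe_add, normalJump_add, mul_add]

theorem interiorTraceForm_smul_left (hd : d ≠ 0) (c : ℝ) (q : Vh T k) (μ : Mh T k) :
    interiorTraceForm (c • q) μ = c * interiorTraceForm q μ := by
  simp only [interiorTraceForm_eq_sum_faces hd, Finset.mul_sum]
  refine Finset.sum_congr rfl fun e _ => ?_
  rw [← faceIntegral_mul_left]
  simp only [Pi.smul_apply, Submodule.coe_smul, normalJump_smul, mul_left_comm]

theorem interiorTraceForm_add_right (hd : d ≠ 0) (q : Vh T k) (μ μ' : Mh T k) :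
    interiorTraceForm q (μ + μ') = interiorTraceForm q μ + interiorTraceForm q μ' := by
  simp only [interiorTraceForm_eq_sum_faces hd, ← Finset.sum_add_distrib]
  refine Finset.sum_congr rfl fun e _ => ?_
  rw [← faceIntegral_add (integrable_face_mul_normalJump hd μ _ e)
    (integrable_face_mul_normalJump hd μ' _ e)]
  simp only [Pi.add_apply, Submodule.coe_add, add_mul]

theorem interiorTraceForm_smul_right (hd : d ≠ 0) (c : ℝ) (q : Vh T k) (μ : Mh T k) :
    interiorTraceForm q (c • μ) = c * interiorTraceForm q μ := by
  simp only [interiorTraceForm_eq_sum_faces hd, Finset.mul_sum]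
  refine Finset.sum_congr rfl fun e _ => ?_
  rw [← faceIntegral_mul_left]
  simp only [Pi.smul_apply, Submodule.coe_smul, smul_eq_mul, mul_assoc]

theorem boundaryForm_comm (lam μ : Mh T k) : boundaryForm lam μ = boundaryForm μ lam := by
  simp only [boundaryForm, mul_comm]

theorem boundaryForm_add_left (hd : d ≠ 0) (lam lam' μ : Mh T k) :
    boundaryForm (lam + lam') μ = boundaryForm lam μ + boundaryForm lam' μ := by
  simp only [boundaryForm, ← Finset.sum_add_distrib]
  refine Finset.sum_congr rfl fun e _ => ?_
  rw [← faceIntegral_add (integrable_face_mul_face hd lam μ e)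
    (integrable_face_mul_face hd lam' μ e)]
  simp only [Pi.add_apply, Submodule.coe_add, add_mul]

theorem boundaryForm_smul_left (c : ℝ) (lam μ : Mh T k) :
    boundaryForm (c • lam) μ = c * boundaryForm lam μ := by
  simp only [boundaryForm, Finset.mul_sum]
  refine Finset.sum_congr rfl fun e _ => ?_
  rw [← faceIntegral_mul_left]
  simp only [Pi.smul_apply, Submodule.coe_smul, smul_eq_mul, mul_assoc]

theorem boundaryForm_add_right (hd : d ≠ 0) (lam μ μ' : Mh T k) :
    boundaryForm lam (μ + μ') = boundaryForm lam μ + boundaryForm lam μ' := by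
  rw [boundaryForm_comm, boundaryForm_add_left hd, boundaryForm_comm μ, boundaryForm_comm μ']

theorem boundaryForm_smul_right (c : ℝ) (lam μ : Mh T k) :
    boundaryForm lam (c • μ) = c * boundaryForm lam μ := by
  rw [boundaryForm_comm, boundaryForm_smul_left, boundaryForm_comm μ]

theorem boundaryLoad_add
    (hu : ∀ e ∈ T.faces, OnBoundary Ω e → Integrable (fun x : hull e => u₀ x) (faceMeasure e))
    (μ μ' : Mh T k) : boundaryLoad u₀ (μ + μ') = boundaryLoad u₀ μ + boundaryLoad u₀ μ' := by
  simp only [boundaryLoad, ← Finset.sum_add_distrib]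
  refine Finset.sum_congr rfl fun e he => ?_
  have hi := hu e.1 e.2 (Finset.mem_filter.1 he).2
  rw [← faceIntegral_add (integrable_mul_continuous_face hi (continuous_facePk (μ e).2))
    (integrable_mul_continuous_face hi (continuous_facePk (μ' e).2))]
  simp only [Pi.add_apply, Submodule.coe_add, mul_add]

theorem boundaryLoad_smul (c : ℝ) (μ : Mh T k) :
    boundaryLoad u₀ (c • μ) = c * boundaryLoad u₀ μ := by
  simp only [boundaryLoad, Finset.mul_sum]
  refine Finset.sum_congr rfl fun e _ => ?_
  rw [← faceIntegral_mul_left]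
  simp only [Pi.smul_apply, Submodule.coe_smul, smul_eq_mul, mul_left_comm]

end Forms

end RTHybrid

namespace RTHybrid

open scoped Classical

section Systems

variable {d k : ℕ} {Ω : Set (Space d)} {T : Triangulation Ω} {K e : Finset (Space d)}
  {κ f u₀ : Space d → ℝ} {q r : Vh T k} {u w : Wh T k} {μ lam : Mh T k}

/-! ### Normal continuity and `H(div)` -/

theorem eq_zero_of_faceIntegral_sq_eq_zero (hd : d ≠ 0) (he : e ∈ T.faces) {g : hull e → ℝ}
    (hg : g ∈ facePk k e) (h : faceIntegral e (fun x => g x * g x) = 0) : g = 0 := by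
  obtain ⟨p, -, hp⟩ := exists_evalAt_eq_facePk hg
  simp only [hp] at h
  rw [faceIntegral_eq e fun x => evalAt x p * evalAt x p] at h
  funext x
  have := eq_zero_of_integral_face_eq_zero hd he ((continuous_evalAt p).mul (continuous_evalAt p))
    (fun x _ => mul_self_nonneg _) h x.2
  rw [hp]
  exact mul_self_eq_zero.1 this

/-- The restriction of the normal jump to a face. -/
noncomputable def faceJump (hd : d ≠ 0) (q : Vh T k) : Mh T k := fun e =>
  ⟨fun x => normalJump (fun K => (q K).1) e.1 x, by
    have : (fun x : hull e.1 => normalJump (fun K => (q K).1) e.1 x) =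
        ∑ K : T.elems with e.1 ⊆ K.1, fun x : hull e.1 => normalTrace K.1 e.1 (q K).1 x := by
      funext x; simp [normalJump]
    rw [this]
    exact sum_mem fun K _ => normalTrace_mem_facePk (q K).2 (face_nonempty hd e.2)⟩

/-- The part of a discrete function on the skeleton supported on the faces satisfying `P`. -/
noncomputable def restrictFaces (P : T.faces → Prop) (μ : Mh T k) : Mh T k :=
  fun e => if P e then μ e else 0

theorem interiorTraceForm_restrictFaces (q : Vh T k) (μ : Mh T k) :
    interiorTraceForm q (restrictFaces (fun e => ¬ OnBoundary Ω e.1) μ) =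
      interiorTraceForm q μ := by
  refine Finset.sum_congr rfl fun K _ => Finset.sum_congr rfl fun e he => ?_
  rw [restrictFaces, if_pos (Finset.mem_filter.1 he).2.2]

theorem boundaryForm_restrictFaces (lam μ : Mh T k) :
    boundaryForm lam (restrictFaces (fun e => OnBoundary Ω e.1) μ) = boundaryForm lam μ := by
  refine Finset.sum_congr rfl fun e he => ?_
  rw [restrictFaces, if_pos (Finset.mem_filter.1 he).2]

theorem boundaryLoad_restrictFaces (μ : Mh T k) :
    boundaryLoad u₀ (restrictFaces (fun e => OnBoundary Ω e.1) μ) = boundaryLoad u₀ μ := by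
  refine Finset.sum_congr rfl fun e he => ?_
  rw [restrictFaces, if_pos (Finset.mem_filter.1 he).2]

theorem restrictFaces_mem_interior (μ : Mh T k) :
    restrictFaces (fun e => ¬ OnBoundary Ω e.1) μ ∈ MhInterior T k := fun e he => by
  rw [restrictFaces, if_neg (not_not.2 he)]

theorem restrictFaces_mem_boundary (μ : Mh T k) :
    restrictFaces (fun e => OnBoundary Ω e.1) μ ∈ MhBoundary T k := fun e he => by
  rw [restrictFaces, if_neg he]

theorem interiorTraceForm_eq_zero (hμ : ∀ e : T.faces, ¬ OnBoundary Ω e.1 → μ e = 0) :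
    interiorTraceForm q μ = 0 := by
  refine Finset.sum_eq_zero fun K _ => Finset.sum_eq_zero fun e he => ?_
  rw [hμ e (Finset.mem_filter.1 he).2.2]
  simp [faceIntegral]

theorem boundaryForm_eq_zero (hμ : ∀ e : T.faces, OnBoundary Ω e.1 → μ e = 0) :
    boundaryForm lam μ = 0 := by
  refine Finset.sum_eq_zero fun e he => ?_
  rw [hμ e (Finset.mem_filter.1 he).2]
  simp [faceIntegral]

theorem boundaryLoad_eq_zero (hμ : ∀ e : T.faces, OnBoundary Ω e.1 → μ e = 0) :
    boundaryLoad u₀ μ = 0 := by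
  refine Finset.sum_eq_zero fun e he => ?_
  rw [hμ e (Finset.mem_filter.1 he).2]
  simp [faceIntegral]

theorem faceIntegral_sq_nonneg (g : hull e → ℝ) : 0 ≤ faceIntegral e (fun x => g x * g x) :=
  integral_nonneg fun _ => mul_self_nonneg _

/-- Normal traces of Raviart-Thomas fields lie in `P_k(e)`, so the jump itself is an admissible
multiplier, and testing with it gives the sum of its squared norms over the interior faces. -/
theorem interiorTraceForm_eq_zero_iff (hd : d ≠ 0) :
    (∀ μ ∈ MhInterior T k, interiorTraceForm q μ = 0) ↔
      ∀ e ∈ T.faces, ¬ OnBoundary Ω e →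
        ∀ x ∈ hull e, normalJump (fun K => (q K).1) e x = 0 := by
  constructor
  · intro h e he heb x hx
    have h1 := h _ (restrictFaces_mem_interior (faceJump hd q))
    rw [interiorTraceForm_restrictFaces, interiorTraceForm_eq_sum_faces hd] at h1
    change ∑ e : T.faces with ¬ OnBoundary Ω e.1,
      faceIntegral e.1 (fun x => (faceJump hd q e).1 x * (faceJump hd q e).1 x) = 0 at h1
    rw [Finset.sum_eq_zero_iff_of_nonneg fun e _ => faceIntegral_sq_nonneg (faceJump hd q e).1] at h1
    have h2 := eq_zero_of_faceIntegral_sq_eq_zero hd he (faceJump hd q ⟨e, he⟩).2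
      (h1 ⟨e, he⟩ (by simpa using heb))
    exact congrFun h2 ⟨x, hx⟩
  · intro h μ _
    rw [interiorTraceForm_eq_sum_faces hd]
    refine Finset.sum_eq_zero fun e he => ?_
    have h1 : ∀ x : hull e.1, (μ e).1 x * normalJump (fun K => (q K).1) e.1 x = 0 := fun x => by
      rw [h e.1 e.2 (Finset.mem_filter.1 he).2 x x.2, mul_zero]
    simp [faceIntegral, h1]

theorem mem_VhDiv_iff (hd : d ≠ 0) (hopen : IsOpen Ω) (hreg : interior (closure Ω) = Ω) :
    q ∈ VhDiv T k ↔ ∀ e ∈ T.faces, ¬ OnBoundary Ω e →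
        ∀ x ∈ hull e, normalJump (fun K => (q K).1) e x = 0 :=
  memHdiv_iff hd hopen hreg

/-! ### The Galerkin system in terms of elementwise forms -/

theorem integral_mass_eq (hd : d ≠ 0) (hreg : interior (closure Ω) = Ω)
    (hκ : ∀ K : T.elems, IntegrableOn (fun x => (κ x)⁻¹) (cell K.1)) :
    ∫ x in Ω, (κ x)⁻¹ * inner ℝ (vectorFun q x) (vectorFun r x) = massForm κ q r :=
  setIntegral_eq_sum_cells hd hreg
    (fun K => integrableOn_mul_continuous (hκ K)
      ((continuous_vecEvalAt _).inner (continuous_vecEvalAt _))) fun K x hx => by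
    have h1 : ∀ q : Vh T k, vectorFun q x = vecEvalAt x (q K).1 := fun q =>
      pwFun_eq hd (fun K y => vecEvalAt y (q K).1) K hx
    simp only [h1]

theorem scalarFun_eq (hd : d ≠ 0) (w : Wh T k) (K : T.elems) {x : Space d} (hx : x ∈ cell K.1) :
    scalarFun w x = evalAt x (w K).1 :=
  pwFun_eq hd (fun K y => evalAt y (w K).1) K hx

theorem integral_div_eq (hd : d ≠ 0) (hreg : interior (closure Ω) = Ω) (hq : q ∈ VhDiv T k) :
    ∫ x in Ω, scalarFun u x * weakDiv Ω (vectorFun q) x = divForm u q := by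
  have h : weakDiv Ω (vectorFun q) =ᵐ[volume.restrict Ω]
      pwFun (T := T) fun K x => evalAt x (polyDiv (q K).1) :=
    weakDiv_ae_eq (q := fun K => (q K).1) hd hreg hq
  rw [integral_congr_ae (h.mono fun x hx => by simp only [hx] :
    (fun x => scalarFun u x * weakDiv Ω (vectorFun q) x) =ᵐ[volume.restrict Ω]
      fun x => scalarFun u x * pwFun (T := T) (fun K x => evalAt x (polyDiv (q K).1)) x)]
  refine setIntegral_eq_sum_cells hd hreg
    (fun K => integrableOn_cell_mul (continuous_evalAt _) _) fun K x hx => ?_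
  simp only [scalarFun_eq hd u K hx, pwFun_eq hd _ K hx]

theorem integral_load_eq (hd : d ≠ 0) (hreg : interior (closure Ω) = Ω)
    (hf : ∀ K : T.elems, IntegrableOn f (cell K.1)) :
    ∫ x in Ω, f x * scalarFun w x = loadForm f w :=
  setIntegral_eq_sum_cells hd hreg
    (fun K => integrableOn_mul_continuous (hf K) (continuous_evalAt _)) fun K x hx => by
    simp only [scalarFun_eq hd w K hx]

/-- On `V_h^div` the chosen weak divergence agrees almost everywhere with the elementwise one, so
(G) can be stated with the forms of (H). -/
theorem isGalerkinSolution_iff (hd : d ≠ 0) (hreg : interior (closure Ω) = Ω)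
    (hκ : ∀ K : T.elems, IntegrableOn (fun x => (κ x)⁻¹) (cell K.1))
    (hf : ∀ K : T.elems, IntegrableOn f (cell K.1)) :
    IsGalerkinSolution T k κ f u₀ q u ↔ q ∈ VhDiv T k ∧
      (∀ r ∈ VhDiv T k, massForm κ q r - divForm u r = - boundaryFluxLoad u₀ r) ∧
      ∀ w, divForm w q = loadForm f w := by
  constructor
  · rintro ⟨h1, h2, h3⟩
    refine ⟨h1, fun r hr => ?_, fun w => ?_⟩
    · rw [← h2 r hr, integral_mass_eq hd hreg hκ, integral_div_eq hd hreg hr]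
    · rw [← integral_div_eq hd hreg h1, ← integral_load_eq hd hreg hf, ← h3 w]
      simp only [mul_comm]
  · rintro ⟨h1, h2, h3⟩
    refine ⟨h1, fun r hr => ?_, fun w => ?_⟩
    · rw [← h2 r hr, integral_mass_eq hd hreg hκ, integral_div_eq hd hreg hr]
    · rw [integral_load_eq hd hreg hf, ← h3 w, ← integral_div_eq hd hreg h1]
      simp only [mul_comm]

/-- The normal flux on `Γ` becomes a multiplier in `M_h`, against which the Dirichlet equation can
be tested. -/
theorem boundaryFluxLoad_eq (hd : d ≠ 0)
    (hu : ∀ e ∈ T.faces, OnBoundary Ω e → Integrable (fun x : hull e => u₀ x) (faceMeasure e)) :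
    boundaryFluxLoad u₀ r = boundaryLoad u₀ (faceJump hd r) := by
  rw [boundaryFluxLoad, sum_elems_faces_comm (fun e => OnBoundary Ω e.1) fun K e =>
    faceIntegral e.1 fun x => u₀ x * normalTrace K.1 e.1 (r K).1 x]
  refine Finset.sum_congr rfl fun e he => ?_
  simp only [faceIntegral, faceJump, normalJump, Finset.mul_sum]
  rw [integral_finsetSum]
  exact fun K _ => integrable_mul_continuous_face (hu e.1 e.2 (Finset.mem_filter.1 he).2)
    (continuous_normalTrace_face _ _ _)

theorem traceForm_eq_boundaryForm (hd : d ≠ 0)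
    (hr : ∀ e ∈ T.faces, ¬ OnBoundary Ω e →
        ∀ x ∈ hull e, normalJump (fun K => (r K).1) e x = 0) :
    traceForm μ r = boundaryForm μ (faceJump hd r) := by
  rw [traceForm_eq_sum_faces hd, boundaryForm, Finset.sum_filter]
  refine Finset.sum_congr rfl fun e _ => ?_
  split_ifs with h
  · rfl
  · have h1 : ∀ x : hull e.1, (μ e).1 x * normalJump (fun K => (r K).1) e.1 x = 0 := fun x => by
      rw [hr e.1 e.2 h x x.2, mul_zero]
    simp [faceIntegral, h1]

/-- For a normally continuous `r` the trace term reduces to `Γ`, and the Dirichlet equation tested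
with the flux of `r` exchanges `û` for `u₀`. -/
theorem IsHybridSolution.isGalerkinSolution (hd : d ≠ 0) (hopen : IsOpen Ω)
    (hreg : interior (closure Ω) = Ω)
    (hκ : ∀ K : T.elems, IntegrableOn (fun x => (κ x)⁻¹) (cell K.1))
    (hf : ∀ K : T.elems, IntegrableOn f (cell K.1))
    (hu : ∀ e ∈ T.faces, OnBoundary Ω e → Integrable (fun x : hull e => u₀ x) (faceMeasure e))
    (h : IsHybridSolution T k κ f u₀ q u μ) : IsGalerkinSolution T k κ f u₀ q u := by
  rw [isGalerkinSolution_iff hd hreg hκ hf]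
  refine ⟨(mem_VhDiv_iff hd hopen hreg).2 ((interiorTraceForm_eq_zero_iff hd).1 h.continuity),
    fun r hr => ?_, h.balance⟩
  have h1 := h.flux r
  have h2 := h.dirichlet _ (restrictFaces_mem_boundary (faceJump hd r))
  rw [boundaryForm_restrictFaces, boundaryLoad_restrictFaces, ← boundaryFluxLoad_eq hd hu,
    ← traceForm_eq_boundaryForm hd ((mem_VhDiv_iff hd hopen hreg).1 hr)] at h2
  linarith

/-! ### Energy arguments -/

/-- The field vanishes almost everywhere on each cell, then everywhere there by continuity, and a
polynomial vanishing on an open set is zero. -/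
theorem eq_zero_of_massForm_self_eq_zero
    (hκ : ∀ K : T.elems, IntegrableOn (fun x => (κ x)⁻¹) (cell K.1))
    (hpos : ∀ K : T.elems, ∀ᵐ x ∂volume.restrict (cell K.1), 0 < κ x)
    (h : massForm κ q q = 0) : q = 0 := by
  have hnn : ∀ K : T.elems, 0 ≤ᵐ[volume.restrict (cell K.1)] fun x =>
      (κ x)⁻¹ * inner ℝ (vecEvalAt x (q K).1) (vecEvalAt x (q K).1) := fun K =>
    (hpos K).mono fun x hx => mul_nonneg (inv_pos.2 hx).le real_inner_self_nonneg
  rw [massForm, Finset.sum_eq_zero_iff_of_nonneg fun K _ => integral_nonneg_of_ae (hnn K)] at h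
  funext K
  have h1 := h K (Finset.mem_univ _)
  rw [setIntegral_eq_zero_iff_of_nonneg_ae (hnn K) (integrableOn_mul_continuous (hκ K)
    ((continuous_vecEvalAt _).inner (continuous_vecEvalAt _)))] at h1
  have h2 : (fun x => vecEvalAt x (q K).1) =ᵐ[volume.restrict (cell K.1)] fun _ => 0 := by
    filter_upwards [h1, hpos K] with x hx hκx
    have := (mul_eq_zero.1 hx).resolve_left (inv_pos.2 hκx).ne'
    exact inner_self_eq_zero.1 this
  have h3 := Measure.eqOn_open_of_ae_eq h2 isOpen_cell (continuous_vecEvalAt _).continuousOn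
    continuousOn_const
  refine Subtype.ext (funext fun i => ?_)
  refine eq_zero_of_evalAt_eq_zero isOpen_cell
    (isSimplex_of_mem T K.2).cell_nonempty fun x hx => ?_
  have := congrArg (fun v : Space d => v i) (h3 hx)
  simpa [vecEvalAt] using this

theorem loadForm_scalarFun (hd : d ≠ 0) (u : Wh T k) :
    loadForm (scalarFun u) u = ∑ K : T.elems, ∫ x in cell K.1, evalAt x (u K).1 * evalAt x (u K).1 :=
  Finset.sum_congr rfl fun K _ => setIntegral_congr_fun isOpen_cell.measurableSet fun x hx => by
    simp only [scalarFun_eq hd u K hx]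

theorem eq_zero_of_sum_integral_sq_eq_zero
    (h : ∑ K : T.elems, ∫ x in cell K.1, evalAt x (u K).1 * evalAt x (u K).1 = 0) : u = 0 := by
  rw [Finset.sum_eq_zero_iff_of_nonneg fun K _ =>
    integral_nonneg fun x => mul_self_nonneg _] at h
  funext K
  have h1 := h K (Finset.mem_univ _)
  rw [setIntegral_eq_zero_iff_of_nonneg_ae
    (Filter.Eventually.of_forall fun x => mul_self_nonneg _)
    (integrableOn_cell_mul (continuous_evalAt _) _)] at h1
  have h3 := Measure.eqOn_open_of_ae_eq h1 isOpen_cell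
    ((continuous_evalAt _).mul (continuous_evalAt _)).continuousOn continuousOn_const
  refine Subtype.ext (eq_zero_of_evalAt_eq_zero isOpen_cell
    (isSimplex_of_mem T K.2).cell_nonempty fun x hx => ?_)
  exact mul_self_eq_zero.1 (h3 hx)

/-- The boundary part of `μ` is itself an admissible test function. -/
theorem dirichlet_homogeneous (hd : d ≠ 0)
    (h : ∀ ν ∈ MhBoundary T k, boundaryForm μ ν = boundaryLoad 0 ν) (e : T.faces)
    (he : OnBoundary Ω e.1) : μ e = 0 := by
  have h1 := h _ (restrictFaces_mem_boundary μ)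
  rw [boundaryForm_restrictFaces] at h1
  have h2 : ∀ ν : Mh T k, boundaryLoad 0 ν = 0 := fun ν => by simp [boundaryLoad, faceIntegral]
  rw [h2, boundaryForm,
    Finset.sum_eq_zero_iff_of_nonneg fun e _ => faceIntegral_sq_nonneg (μ e).1] at h1
  exact Subtype.ext (eq_zero_of_faceIntegral_sq_eq_zero hd e.2 (μ e).2
    (h1 e (by simpa using he)))

end Systems

end RTHybrid

namespace RTHybrid

open scoped Classical

section Uniqueness

variable {d k : ℕ} {Ω : Set (Space d)} {T : Triangulation Ω} {K e : Finset (Space d)}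
  {κ f u₀ : Space d → ℝ} {q r : Vh T k} {u w : Wh T k} {μ lam : Mh T k} {a : Space d} {p : Poly d}

/-! ### Elementwise rigidity -/

/-- On a face through `a` the vector `x - a` is tangential; on the opposite face its normal
component is the constant height. -/
theorem sum_faces_radialField (hd : d ≠ 0) (hK : K ∈ T.elems) (ha : a ∈ K) (p : Poly d)
    (g : ∀ e : T.faces, hull e.1 → ℝ) :
    ∑ e : T.faces with e.1 ⊆ K,
        faceIntegral e.1 (fun x => g e x * normalTrace K e.1 (radialField p a) x) =
      height K a * faceIntegral (K.erase a)
        (fun x => g ⟨K.erase a, erase_mem_faces hK ha⟩ x * evalAt x.1 p) := by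
  have hnT : ∀ b x, normalTrace K (K.erase b) (radialField p a) x =
      evalAt x p * inner ℝ (x - a) (outwardNormal K (K.erase b)) := fun b x => by
    rw [normalTrace, evalAt_radialField, inner_smul_left, conj_trivial]
  rw [Finset.sum_eq_single ⟨K.erase a, erase_mem_faces hK ha⟩]
  · rw [← faceIntegral_mul_left]
    congr 1
    funext x
    rw [hnT, (isSimplex_of_mem T hK).inner_sub_apex hd ha x.2]
    ring
  · rintro ⟨e, he⟩ heK hne
    obtain ⟨b, hb, rfl⟩ := exists_erase_eq hK he (Finset.mem_filter.1 heK).2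
    have hab : a ≠ b := by rintro rfl; exact hne rfl
    have h0 : ∀ x : hull (K.erase b), normalTrace K (K.erase b) (radialField p a) x = 0 := by
      intro x
      rw [hnT, inner_sub_outwardNormal x.2 (subset_convexHull ℝ _ (by simp [ha, hab])), mul_zero]
    simp [faceIntegral, h0]
  · intro h
    exact (h (by simp [Finset.erase_subset])).elim

theorem traceForm_single (K : T.elems) (ρ : RT d k) :
    traceForm μ (Pi.single K ρ) = ∑ e : T.faces with e.1 ⊆ K.1,
      faceIntegral e.1 fun x => (μ e).1 x * normalTrace K.1 e.1 ρ.1 x := by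
  rw [traceForm, Finset.sum_eq_single K]
  · simp
  · intro L _ hL
    refine Finset.sum_eq_zero fun e _ => ?_
    have : ∀ x : Space d, normalTrace L.1 e.1 ((Pi.single K ρ : Vh T k) L).1 x = 0 := fun x => by
      rw [Pi.single_eq_of_ne hL]
      simpa using normalTrace_smul L.1 e.1 0 0 x
    simp [faceIntegral, this]
  · simp

theorem divForm_single (K : T.elems) (ρ : RT d k) :
    divForm u (Pi.single K ρ) =
      ∫ x in cell K.1, evalAt x (u K).1 * evalAt x (polyDiv ρ.1) := by
  rw [divForm, Finset.sum_eq_single K]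
  · simp
  · intro L _ hL
    rw [Pi.single_eq_of_ne hL]
    simp [polyDiv]
  · simp

/-- The hypothesis is tested with the field `p (x - a)` on `K` alone, and Green's formula moves the
derivative onto `u`. A single face integral survives, so its integrand can be controlled through
`p`. -/
theorem integral_radial_deriv (hd : d ≠ 0) (h : ∀ r : Vh T k, divForm u r = traceForm μ r)
    (K : T.elems) (ha : a ∈ K.1) (hp : p ∈ Pk d k) :
    ∫ x in cell K.1, fderiv ℝ (fun y : Space d => evalAt y (u K).1) x (x - a) * evalAt x p =
      height K.1 a * faceIntegral (K.1.erase a) (fun x =>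
        (evalAt x.1 (u K).1 - (μ ⟨K.1.erase a, erase_mem_faces K.2 ha⟩).1 x) * evalAt x.1 p) := by
  set e : T.faces := ⟨K.1.erase a, erase_mem_faces K.2 ha⟩ with he
  have h1 := h (Pi.single K ⟨radialField p a, radialField_mem_RT hp a⟩)
  rw [divForm_single, traceForm_single,
    sum_faces_radialField hd K.2 ha p fun e => (μ e).1] at h1
  have hφ : ContDiff ℝ 1 fun y : Space d => evalAt y (u K).1 :=
    (contDiff_evalAt _).of_le (by norm_cast)
  have h2 := integral_cell_div hd hφ (radialField p a) K.2
  simp only [← faceIntegral_eq] at h2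
  rw [sum_faces_radialField hd K.2 ha p fun e x => evalAt x.1 (u K).1,
    integral_add (integrableOn_cell (continuous_fderiv_vecEvalAt hφ _))
      (integrableOn_cell_mul hφ.continuous _), h1] at h2
  have h3 : faceIntegral (K.1.erase a) (fun x => evalAt x.1 (u K).1 * evalAt x.1 p) =
      faceIntegral (K.1.erase a) (fun x =>
        (evalAt x.1 (u K).1 - (μ e).1 x) * evalAt x.1 p) +
      faceIntegral (K.1.erase a) (fun x => (μ e).1 x * evalAt x.1 p) := by
    have hc1 : Continuous fun x : hull (K.1.erase a) => evalAt x.1 (u K).1 :=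
      (continuous_evalAt _).comp continuous_subtype_val
    have hc2 : Continuous fun x : hull (K.1.erase a) => evalAt x.1 p :=
      (continuous_evalAt _).comp continuous_subtype_val
    have hc3 : Continuous fun x : hull (K.1.erase a) => (μ e).1 x := continuous_facePk (μ e).2
    have i1 : Integrable (fun x : hull (K.1.erase a) =>
        (evalAt x.1 (u K).1 - (μ e).1 x) * evalAt x.1 p) (faceMeasure (K.1.erase a)) :=
      integrable_continuous_face hd e.2 ((hc1.sub hc3).mul hc2)
    have i2 : Integrable (fun x : hull (K.1.erase a) => (μ e).1 x * evalAt x.1 p)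
        (faceMeasure (K.1.erase a)) := integrable_continuous_face hd e.2 (hc3.mul hc2)
    rw [← faceIntegral_add i1 i2]
    congr 1
    funext x
    ring
  have h4 : ∀ x : Space d, fderiv ℝ (fun y : Space d => evalAt y (u K).1) x
      (vecEvalAt x (radialField p a)) =
      fderiv ℝ (fun y : Space d => evalAt y (u K).1) x (x - a) * evalAt x p := fun x => by
    rw [evalAt_radialField, map_smul, smul_eq_mul, mul_comm]
  simp only [h4] at h2
  rw [h3] at h2
  linarith

theorem IsSimplex.eq_zero_of_eqOn_vertices (hK : IsSimplex K) (G : Space d →L[ℝ] ℝ) {c : ℝ}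
    (h : ∀ a ∈ K, G a = c) : G = 0 := by
  obtain ⟨b, hb⟩ : K.Nonempty := by rw [← Finset.card_pos, hK.card_eq]; omega
  have htop : vectorSpan ℝ (K : Set (Space d)) = ⊤ := by
    have := hK.indep.vectorSpan_eq_top_of_card_eq_finrank_add_one (by simp [hK.card_eq])
    rw [Subtype.range_coe_subtype] at this
    exact this
  rw [vectorSpan_eq_span_vsub_set_right ℝ (Finset.mem_coe.2 hb)] at htop
  have : (G : Space d →ₗ[ℝ] ℝ) = 0 := by
    refine LinearMap.ext_on htop ?_
    rintro _ ⟨a, ha, rfl⟩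
    simp [h a ha, h b hb]
  ext v
  exact DFunLike.congr_fun this v

/-- A suitable `p` for each vertex removes the face terms and turns the sum over the vertices into a
variance. Its vanishing makes the gradient take equal values at all vertices, and differences of
vertices span. -/
theorem fderiv_eq_zero_of_rigid (hd : d ≠ 0) (h : ∀ r : Vh T k, divForm u r = traceForm μ r)
    (K : T.elems) {x : Space d} (hx : x ∈ cell K.1) :
    fderiv ℝ (fun y : Space d => evalAt y (u K).1) x = 0 := by
  have hKs := isSimplex_of_mem T K.2
  set G : Space d → Space d →L[ℝ] ℝ := fderiv ℝ (fun y : Space d => evalAt y (u K).1) with hG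
  have hGc : Continuous G :=
    ((contDiff_evalAt (u K).1).of_le (by norm_cast : (1 : WithTop ℕ∞) ≤ ∞)).continuous_fderiv
      one_ne_zero
  have hcoord : ∀ a, Continuous (coord K.1 a) := fun a => by
    have : coord K.1 a = fun x => evalAt x (coordPoly K.1 a) :=
      funext fun x => (evalAt_coordPoly _ _ x).symm
    rw [this]
    exact continuous_evalAt _
  -- This is `-λ_a ∇u·a`: of degree at most `k` because a derivative is multiplied by an affine
  -- function, and zero on the face opposite `a`.
  set s : Space d → Poly d := fun a =>
    ∑ i, MvPolynomial.C (- a i) * (coordPoly K.1 a * MvPolynomial.pderiv i (u K).1)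
  have hs : ∀ a, s a ∈ Pk d k := fun a => sum_mem fun i _ => by
    rw [← MvPolynomial.smul_eq_C_mul]
    exact Submodule.smul_mem _ _ (mul_pderiv_mem_Pk (u K).2 (totalDegree_coordPoly_le _ _) i)
  have hseval : ∀ a x, evalAt x (s a) = - (coord K.1 a x * G x a) := by
    intro a x
    rw [hG, fderiv_evalAt]
    simp only [s, map_sum, evalAt_mul, evalAt_C, evalAt_coordPoly, Finset.mul_sum,
      ← Finset.sum_neg_distrib]
    exact Finset.sum_congr rfl fun i _ => by ring
  have h1 : ∀ a ∈ K.1, ∫ x in cell K.1, G x (x - a) * evalAt x (s a) = 0 := by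
    intro a ha
    rw [integral_radial_deriv hd h K ha (hs a)]
    have : ∀ x : hull (K.1.erase a), evalAt x.1 (s a) = 0 := fun x => by
      rw [hseval, hKs.coord_eq_zero hd ha x.2, zero_mul, neg_zero]
    simp [faceIntegral, this]
  have hcont : ∀ a, Continuous fun x => G x (x - a) * evalAt x (s a) := fun a =>
    (hGc.clm_apply (continuous_id.sub continuous_const)).mul (continuous_evalAt _)
  have h2 : ∫ x in cell K.1, ∑ a ∈ K.1, G x (x - a) * evalAt x (s a) = 0 := by
    rw [integral_finsetSum _ fun a _ => integrableOn_cell (hcont a)]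
    exact Finset.sum_eq_zero h1
  -- Since `∑ λ_a = 1` and `∑ λ_a a = x`, the mean of the values `G x a` is `G x x`; both sides
  -- equal `∑ λ_a (G x a)² - (G x x)²`.
  have h3 : ∀ x ∈ cell K.1, ∑ a ∈ K.1, G x (x - a) * evalAt x (s a) =
      ∑ a ∈ K.1, coord K.1 a x * (G x a - G x x) ^ 2 := by
    intro x hx
    have e1 := hKs.sum_coord hd (cell_subset_hull hx)
    have e2 : ∑ a ∈ K.1, coord K.1 a x * G x a = G x x := by
      conv_rhs => rw [← hKs.sum_coord_smul hd (cell_subset_hull hx)]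
      rw [map_sum]
      simp only [map_smul, smul_eq_mul]
      rw [hKs.sum_coord_smul hd (cell_subset_hull hx)]
    have e3 : ∑ a ∈ K.1, (G x (x - a) * evalAt x (s a) - coord K.1 a x * (G x a - G x x) ^ 2) =
        G x x * ∑ a ∈ K.1, coord K.1 a x * G x a - (G x x) ^ 2 * ∑ a ∈ K.1, coord K.1 a x := by
      rw [Finset.mul_sum, Finset.mul_sum, ← Finset.sum_sub_distrib]
      refine Finset.sum_congr rfl fun a _ => ?_
      rw [hseval, map_sub]
      ring
    rw [e1, e2, Finset.sum_sub_distrib] at e3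
    linarith
  rw [setIntegral_congr_fun isOpen_cell.measurableSet h3, setIntegral_eq_zero_iff_of_nonneg_ae] at h2
  · have hcont2 : Continuous fun x => ∑ a ∈ K.1, coord K.1 a x * (G x a - G x x) ^ 2 :=
      continuous_finsetSum _ fun a _ => (hcoord a).mul
        (((hGc.clm_apply continuous_const).sub (hGc.clm_apply continuous_id)).pow 2)
    have h4 := Measure.eqOn_open_of_ae_eq h2 isOpen_cell hcont2.continuousOn continuousOn_const hx
    have h5 := (Finset.sum_eq_zero_iff_of_nonneg fun a ha => mul_nonneg
      (hKs.coord_pos hd ha hx).le (sq_nonneg _)).1 h4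
    refine hKs.eq_zero_of_eqOn_vertices (G x) (c := G x x) fun a ha => ?_
    have h6 := (mul_eq_zero.1 (h5 a ha)).resolve_left (hKs.coord_pos hd ha hx).ne'
    exact sub_eq_zero.1 (pow_eq_zero_iff two_ne_zero |>.1 h6)
  · exact (ae_restrict_mem isOpen_cell.measurableSet).mono fun x hx => Finset.sum_nonneg fun a ha =>
      mul_nonneg (hKs.coord_pos hd ha hx).le (sq_nonneg _)
  · exact integrableOn_cell (continuous_finsetSum _ fun a _ => (hcoord a).mul
        (((hGc.clm_apply continuous_const).sub (hGc.clm_apply continuous_id)).pow 2))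

/-- With the gradient zero, the choice `p = u - μ`, for a polynomial extension of `μ` from the face,
leaves the height times the squared norm of `u - μ` on that face. -/
theorem trace_eq_of_rigid (hd : d ≠ 0) (h : ∀ r : Vh T k, divForm u r = traceForm μ r)
    (K : T.elems) (e : T.faces) (heK : e.1 ⊆ K.1) (x : hull e.1) :
    (μ e).1 x = evalAt x.1 (u K).1 := by
  obtain ⟨e, he⟩ := e
  obtain ⟨a, ha, rfl⟩ := exists_erase_eq K.2 he heK
  have hKs := isSimplex_of_mem T K.2
  obtain ⟨v, hv, hμv⟩ := exists_evalAt_eq_facePk (μ ⟨K.1.erase a, he⟩).2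
  have h1 := integral_radial_deriv hd h K ha (sub_mem (u K).2 hv)
  have h2 : ∫ x in cell K.1, fderiv ℝ (fun y : Space d => evalAt y (u K).1) x (x - a) *
      evalAt x ((u K).1 - v) = 0 :=
    setIntegral_eq_zero_of_forall_eq_zero fun x hx => by
      rw [fderiv_eq_zero_of_rigid hd h K hx]; simp
  rw [h2, eq_comm, mul_eq_zero] at h1
  have h3 := h1.resolve_left (hKs.height_pos hd ha).ne'
  have h4 : (fun x : hull (K.1.erase a) => evalAt x.1 ((u K).1 - v)) ∈ facePk k (K.1.erase a) :=
    ⟨(u K).1 - v, sub_mem (u K).2 hv, rfl⟩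
  have h5 := eq_zero_of_faceIntegral_sq_eq_zero hd he h4 (by
    rw [← h3]
    congr 1
    funext x
    rw [hμv, map_sub])
  have h6 := congrFun h5 x
  simp only [map_sub, Pi.zero_apply] at h6
  rw [hμv]
  linarith

/-! ### The position field -/

theorem hasWeakDiv_position : HasWeakDiv Ω (fun x : Space d => x) fun _ => d := by
  intro φ hφ hcomp hsupp
  have hφ0 : ∀ x, x ∉ Ω → φ x = 0 := fun x hx =>
    image_eq_zero_of_notMem_tsupport fun h => hx (hsupp h)
  have hdφ0 : ∀ x, x ∉ Ω → fderiv ℝ φ x = 0 := fun x hx =>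
    image_eq_zero_of_notMem_tsupport fun h => hx (hsupp (tsupport_fderiv_subset ℝ h))
  rw [setIntegral_eq_integral_of_forall_compl_eq_zero fun x hx => by rw [hdφ0 x hx]; rfl,
    setIntegral_eq_integral_of_forall_compl_eq_zero fun x hx => by rw [hφ0 x hx, mul_zero]]
  have hφ1 : ContDiff ℝ 1 φ := hφ.of_le (by norm_cast)
  have hdc := hφ1.continuous_fderiv one_ne_zero
  set v : Fin d → Space d := fun i => EuclideanSpace.single i 1
  have hx : ∀ x : Space d, fderiv ℝ φ x x = ∑ i, x i * fderiv ℝ φ x (v i) := by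
    intro x
    have : x = ∑ i, x i • v i := by
      ext j; simp [v, Pi.single_apply]
    conv_lhs => rw [this]
    rw [map_sum, ← this]
    simp only [map_smul, smul_eq_mul]
  have hcoord : ∀ i (x : Space d), HasFDerivAt (fun x : Space d => x i)
      (EuclideanSpace.proj i : Space d →L[ℝ] ℝ) x := fun i x =>
    (EuclideanSpace.proj i : Space d →L[ℝ] ℝ).hasFDerivAt
  have hfd : ∀ i (x : Space d), fderiv ℝ (fun x : Space d => x i) x (v i) = 1 := fun i x => by
    rw [(hcoord i x).fderiv]; simp [v]
  have hci : ∀ i : Fin d, Continuous fun x : Space d => x i := fun i => by fun_prop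
  have hint1 : ∀ i, Integrable fun x : Space d => x i * fderiv ℝ φ x (v i) := fun i =>
    ((hci i).mul (hdc.clm_apply continuous_const)).integrable_of_hasCompactSupport
      (HasCompactSupport.mul_left
        (hcomp.fderiv (𝕜 := ℝ) |>.comp_left (g := fun L : Space d →L[ℝ] ℝ => L (v i)) rfl))
  have hint2 : Integrable φ := hφ1.continuous.integrable_of_hasCompactSupport hcomp
  have hint3 : ∀ i : Fin d, Integrable fun x : Space d => x i * φ x := fun i =>
    ((hci i).mul hφ1.continuous).integrable_of_hasCompactSupport (HasCompactSupport.mul_left hcomp)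
  have hparts : ∀ i, ∫ x : Space d, x i * fderiv ℝ φ x (v i) = - ∫ x, φ x := by
    intro i
    have := integral_mul_fderiv_eq_neg_fderiv_mul_of_integrable (μ := (volume : Measure (Space d)))
      (f := fun x : Space d => x i) (g := φ) (v := v i)
      (by simpa only [hfd, one_mul] using hint2) (hint1 i) (hint3 i)
      (fun x _ => (hcoord i x).differentiableAt) (fun x _ => hφ1.differentiable one_ne_zero x)
    simpa only [hfd, one_mul] using this
  simp_rw [hx]
  rw [integral_finsetSum _ fun i _ => hint1 i]
  simp only [hparts, integral_const_mul]
  simp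

/-- `radialField 1 0` is the field `x`, which has the weak divergence `d` on all of `Ω`; the
`H(div)` criterion then yields the cancellation of `x·n`. No description of the two sides of an
interior face is needed. -/
theorem normalJump_position_eq_zero (hd : d ≠ 0) (hopen : IsOpen Ω)
    (hreg : interior (closure Ω) = Ω) (he : e ∈ T.faces) (heb : ¬ OnBoundary Ω e)
    {x : Space d} (hx : x ∈ hull e) :
    normalJump (T := T) (fun _ => radialField 1 0) e x = 0 := by
  have hfin : IsFiniteMeasure ((volume : Measure (Space d)).restrict Ω) :=
    isFiniteMeasure_restrict.2 (volume_lt_top T).ne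
  refine normalJump_eq_zero hd hopen hreg (memLp_const (d : ℝ)) ?_ he heb hx
  have hae : ∀ᵐ x ∂volume.restrict Ω,
      pwFun (T := T) (fun _ x => vecEvalAt x (radialField 1 0)) x = x := by
    refine (ae_restrict_iff_cells (T := T) hreg).2 fun K => ?_
    filter_upwards [ae_restrict_mem isOpen_cell.measurableSet] with x hx
    rw [pwFun_eq hd _ K hx, evalAt_radialField]
    simp
  intro φ hφ hcomp hsupp
  rw [← hasWeakDiv_position φ hφ hcomp hsupp]
  exact integral_congr_ae (hae.mono fun x hx => by simp only [hx])

/-! ### Uniqueness for the hybridized system -/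

/-- On each element `u` is constant with trace `μ`, so Green's formula for `u² x` gives `d ∫_K u²`
as face integrals of `μ² x·n`. Summed over the mesh they cancel on interior faces and vanish on `Γ`,
which settles all elements at once. -/
theorem eq_zero_of_rigid (hd : d ≠ 0) (hopen : IsOpen Ω) (hreg : interior (closure Ω) = Ω)
    (h : ∀ r : Vh T k, divForm u r = traceForm μ r)
    (hμ : ∀ e : T.faces, OnBoundary Ω e.1 → μ e = 0) : u = 0 ∧ μ = 0 := by
  have hKe : ∀ K : T.elems, ∫ x in cell K.1, (d : ℝ) * (evalAt x (u K).1 * evalAt x (u K).1) =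
      ∑ e : T.faces with e.1 ⊆ K.1, faceIntegral e.1 fun x =>
        ((μ e).1 x * (μ e).1 x) * normalTrace K.1 e.1 (radialField 1 0) x := by
    intro K
    have hφ : ContDiff ℝ 1 fun y : Space d => evalAt y ((u K).1 * (u K).1) :=
      (contDiff_evalAt _).of_le (by norm_cast)
    have h1 := integral_cell_div hd hφ (radialField 1 0) K.2
    have h2 : ∀ e : T.faces, e ∈ Finset.univ.filter (fun e : T.faces => e.1 ⊆ K.1) →
        ∫ x in hull e.1, evalAt x ((u K).1 * (u K).1) *
          normalTrace K.1 e.1 (radialField 1 0) x ∂μHE[d - 1] =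
        faceIntegral e.1 fun x =>
          ((μ e).1 x * (μ e).1 x) * normalTrace K.1 e.1 (radialField 1 0) x := by
      intro e he
      rw [← faceIntegral_eq]
      congr 1
      funext x
      rw [trace_eq_of_rigid hd h K e (Finset.mem_filter.1 he).2 x, evalAt_mul]
    rw [Finset.sum_congr rfl h2] at h1
    rw [← h1]
    refine setIntegral_congr_fun isOpen_cell.measurableSet fun x hx => ?_
    have h3 : fderiv ℝ (fun y : Space d => evalAt y ((u K).1 * (u K).1)) x = 0 := by
      simp only [evalAt_mul]
      rw [((differentiable_evalAt (u K).1 x).hasFDerivAt.fun_mul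
        (differentiable_evalAt (u K).1 x).hasFDerivAt).fderiv, fderiv_eq_zero_of_rigid hd h K hx]
      simp
    have h4 : polyDiv (radialField (1 : Poly d) 0) = MvPolynomial.C (d : ℝ) := by
      simp [polyDiv, radialField]
    simp only [h3]
    simp only [h4, evalAt_C, evalAt_mul]
    simp [mul_comm]
  have hsum : ∑ K : T.elems, ∫ x in cell K.1,
      (d : ℝ) * (evalAt x (u K).1 * evalAt x (u K).1) = 0 := by
    simp_rw [hKe]
    have hcomm := sum_elems_faces_comm (T := T) (fun _ => True) fun K e =>
      faceIntegral e.1 fun x =>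
        ((μ e).1 x * (μ e).1 x) * normalTrace K.1 e.1 (radialField 1 0) x
    simp only [and_true, Finset.filter_true] at hcomm
    rw [hcomm]
    refine Finset.sum_eq_zero fun e _ => ?_
    have hc := continuous_facePk (μ e).2
    have h1 : ∑ K : T.elems with e.1 ⊆ K.1, (faceIntegral e.1 fun x =>
        ((μ e).1 x * (μ e).1 x) * normalTrace K.1 e.1 (radialField 1 0) x) =
        faceIntegral e.1 fun x => ((μ e).1 x * (μ e).1 x) *
          normalJump (T := T) (fun _ => radialField 1 0) e.1 x := by
      simp only [faceIntegral, normalJump, Finset.mul_sum]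
      rw [integral_finsetSum]
      exact fun K _ => integrable_continuous_face hd e.2
        ((hc.mul hc).mul (continuous_normalTrace_face _ _ _))
    rw [h1]
    by_cases hb : OnBoundary Ω e.1
    · rw [hμ e hb]; simp [faceIntegral]
    · have h2 : ∀ x : hull e.1, ((μ e).1 x * (μ e).1 x) *
          normalJump (T := T) (fun _ => radialField 1 0) e.1 x = 0 := fun x => by
        rw [normalJump_position_eq_zero hd hopen hreg e.2 hb x.2, mul_zero]
      simp [faceIntegral, h2]
  have hu : u = 0 := by
    simp only [integral_const_mul, ← Finset.mul_sum] at hsum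
    exact eq_zero_of_sum_integral_sq_eq_zero
      ((mul_eq_zero.1 hsum).resolve_left (by exact_mod_cast hd))
  refine ⟨hu, funext fun e => Subtype.ext (funext fun x => ?_)⟩
  obtain ⟨K, hK, a, ha, hKa⟩ := exists_elem_erase_eq e.2
  rw [trace_eq_of_rigid hd h ⟨K, hK⟩ e (by rw [← hKa]; exact Finset.erase_subset _ _) x, hu]
  simp

/-- For zero data `û` vanishes on `Γ`, so testing the flux equation with `q` leaves only the energy.
With `q = 0` that equation becomes the rigidity hypothesis. -/
theorem IsHybridSolution.eq_zero (hd : d ≠ 0) (hopen : IsOpen Ω) (hreg : interior (closure Ω) = Ω)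
    (hκ : ∀ K : T.elems, IntegrableOn (fun x => (κ x)⁻¹) (cell K.1))
    (hpos : ∀ K : T.elems, ∀ᵐ x ∂volume.restrict (cell K.1), 0 < κ x)
    (h : IsHybridSolution T k κ 0 0 q u μ) : q = 0 ∧ u = 0 ∧ μ = 0 := by
  have hμ := dirichlet_homogeneous hd h.dirichlet
  have hq : q = 0 := by
    refine eq_zero_of_massForm_self_eq_zero hκ hpos ?_
    have h1 := h.flux q
    have h2 : loadForm 0 u = 0 := by simp [loadForm]
    rw [h.balance u, h2, traceForm_eq_boundaryForm hd
      ((interiorTraceForm_eq_zero_iff hd).1 h.continuity), boundaryForm_comm,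
      boundaryForm_eq_zero hμ] at h1
    linarith
  have hm : ∀ r : Vh T k, massForm κ 0 r = 0 := fun r => by
    simpa using massForm_smul_left (κ := κ) 0 (0 : Vh T k) r
  refine ⟨hq, eq_zero_of_rigid hd hopen hreg (fun r => ?_) hμ⟩
  have h1 := h.flux r
  rw [hq, hm] at h1
  linarith

/-! ### Existence for the hybridized system -/

/-- A multiplier splits into its interior and its boundary part, so the last two equations can be
tested with one `μ ∈ M_h`. Trial and test spaces then coincide and the system is square. -/
theorem isHybridSolution_iff (hd : d ≠ 0) :
    IsHybridSolution T k κ f u₀ q u lam ↔ ∀ (r : Vh T k) (w : Wh T k) (μ : Mh T k),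
      massForm κ q r - divForm u r + traceForm lam r + divForm w q + interiorTraceForm q μ +
        boundaryForm lam μ = loadForm f w + boundaryLoad u₀ μ := by
  have hm : massForm κ q 0 = 0 := by simpa using massForm_smul_right (κ := κ) 0 q (0 : Vh T k)
  have hdr : divForm u (0 : Vh T k) = 0 := by simpa using divForm_smul_right 0 u (0 : Vh T k)
  have hdl : divForm (0 : Wh T k) q = 0 := by simpa using divForm_smul_left 0 (0 : Wh T k) q
  have ht : traceForm lam (0 : Vh T k) = 0 := by
    simpa using traceForm_smul_right hd 0 lam (0 : Vh T k)
  have hi : interiorTraceForm q (0 : Mh T k) = 0 := interiorTraceForm_eq_zero fun _ _ => rfl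
  have hb : boundaryForm lam (0 : Mh T k) = 0 := boundaryForm_eq_zero fun _ _ => rfl
  have hl : loadForm f (0 : Wh T k) = 0 := by simpa using loadForm_smul (f := f) 0 (0 : Wh T k)
  have hbl : boundaryLoad u₀ (0 : Mh T k) = 0 := boundaryLoad_eq_zero fun _ _ => rfl
  constructor
  · intro h r w μ
    rw [h.flux r, h.balance w, ← interiorTraceForm_restrictFaces,
      h.continuity _ (restrictFaces_mem_interior μ), ← boundaryForm_restrictFaces,
      h.dirichlet _ (restrictFaces_mem_boundary μ), boundaryLoad_restrictFaces]
    ring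
  · intro h
    refine ⟨fun r => ?_, fun w => ?_, fun μ hμ => ?_, fun μ hμ => ?_⟩
    · simpa only [hdl, hi, hb, hl, hbl, add_zero] using h r 0 0
    · simpa only [hm, hdr, ht, hi, hb, hbl, add_zero, sub_zero, zero_add] using h 0 w 0
    · have := h 0 0 μ
      rw [boundaryForm_eq_zero hμ, boundaryLoad_eq_zero hμ] at this
      simpa only [hm, hdr, ht, hdl, hl, add_zero, sub_zero, zero_add] using this
    · have := h 0 0 μ
      rw [interiorTraceForm_eq_zero hμ] at this
      simpa only [hm, hdr, ht, hdl, hl, add_zero, sub_zero, zero_add] using this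

/-- The bilinear form of the hybridized system. -/
noncomputable def hybridForm (T : Triangulation Ω) (k : ℕ) (hd : d ≠ 0)
    (hκ : ∀ K : T.elems, IntegrableOn (fun x => (κ x)⁻¹) (cell K.1)) :
    (Vh T k × Wh T k × Mh T k) →ₗ[ℝ] Module.Dual ℝ (Vh T k × Wh T k × Mh T k) :=
  LinearMap.mk₂ ℝ (fun s t => massForm κ s.1 t.1 - divForm s.2.1 t.1 + traceForm s.2.2 t.1 +
      divForm t.2.1 s.1 + interiorTraceForm s.1 t.2.2 + boundaryForm s.2.2 t.2.2)
    (fun s s' t => by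
      simp only [Prod.fst_add, Prod.snd_add, massForm_add_left hκ, divForm_add_left,
        divForm_add_right, traceForm_add_left hd, interiorTraceForm_add_left hd,
        boundaryForm_add_left hd]
      ring)
    (fun c s t => by
      simp only [Prod.smul_fst, Prod.smul_snd, massForm_smul_left, divForm_smul_left,
        divForm_smul_right, traceForm_smul_left hd, interiorTraceForm_smul_left hd,
        boundaryForm_smul_left, smul_eq_mul]
      ring)
    (fun s t t' => by
      simp only [Prod.fst_add, Prod.snd_add, massForm_add_right hκ, divForm_add_left,
        divForm_add_right, traceForm_add_right hd, interiorTraceForm_add_right hd,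
        boundaryForm_add_right hd]
      ring)
    (fun c s t => by
      simp only [Prod.smul_fst, Prod.smul_snd, massForm_smul_right, divForm_smul_left,
        divForm_smul_right, traceForm_smul_right hd, interiorTraceForm_smul_right hd,
        boundaryForm_smul_right, smul_eq_mul]
      ring)

theorem finiteDimensional_facePk (e : Finset (Space d)) : FiniteDimensional ℝ (facePk k e) := by
  have : FiniteDimensional ℝ (Pk d k) := by unfold Pk; infer_instance
  unfold facePk
  infer_instance

theorem finiteDimensional_RT : FiniteDimensional ℝ (RT d k) := by
  have h1 : FiniteDimensional ℝ (Pk d k) := by unfold Pk; infer_instance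
  have h2 : FiniteDimensional ℝ (Submodule.pi Set.univ (fun _ : Fin d => Pk d k)) := by
    refine FiniteDimensional.of_injective (V₂ := Fin d → Pk d k)
      (LinearMap.pi fun i => LinearMap.codRestrict (Pk d k)
        ((LinearMap.proj i).comp (Submodule.subtype _)) fun s => s.2 i trivial) ?_
    intro s t hst
    refine Subtype.ext (funext fun i => ?_)
    exact congrArg Subtype.val (congrFun hst i)
  have h3 : FiniteDimensional ℝ (MvPolynomial.homogeneousSubmodule (Fin d) ℝ k) := by
    refine Submodule.finiteDimensional_of_le (S₂ := Pk d k) fun p hp => ?_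
    rw [mem_Pk]
    exact ((MvPolynomial.mem_homogeneousSubmodule _ _).1 hp).totalDegree_le
  unfold RT
  infer_instance

/-- An injective linear map from a finite-dimensional space to its dual is bijective, and its kernel
consists of the solutions for zero data. -/
theorem existsUnique_isHybridSolution (hd : d ≠ 0) (hopen : IsOpen Ω)
    (hreg : interior (closure Ω) = Ω)
    (hκ : ∀ K : T.elems, IntegrableOn (fun x => (κ x)⁻¹) (cell K.1))
    (hpos : ∀ K : T.elems, ∀ᵐ x ∂volume.restrict (cell K.1), 0 < κ x)
    (hf : ∀ K : T.elems, IntegrableOn f (cell K.1))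
    (hu : ∀ e ∈ T.faces, OnBoundary Ω e → Integrable (fun x : hull e => u₀ x) (faceMeasure e)) :
    ∃! s : Vh T k × Wh T k × Mh T k, IsHybridSolution T k κ f u₀ s.1 s.2.1 s.2.2 := by
  have : FiniteDimensional ℝ (Pk d k) := by unfold Pk; infer_instance
  have := finiteDimensional_RT (d := d) (k := k)
  have := fun e : T.faces => finiteDimensional_facePk (k := k) e.1
  set ℓ : Module.Dual ℝ (Vh T k × Wh T k × Mh T k) :=
    { toFun := fun t => loadForm f t.2.1 + boundaryLoad u₀ t.2.2
      map_add' := fun t t' => by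
        simp only [Prod.snd_add, Prod.fst_add, loadForm_add hf, boundaryLoad_add hu]; ring
      map_smul' := fun c t => by
        simp only [Prod.smul_snd, Prod.smul_fst, loadForm_smul, boundaryLoad_smul, smul_eq_mul,
          RingHom.id_apply]
        ring } with hℓ
  have hiff : ∀ s : Vh T k × Wh T k × Mh T k,
      IsHybridSolution T k κ f u₀ s.1 s.2.1 s.2.2 ↔ hybridForm T k hd hκ s = ℓ := by
    intro s
    rw [isHybridSolution_iff hd]
    constructor
    · intro h
      exact LinearMap.ext fun t => h t.1 t.2.1 t.2.2
    · intro h r w μ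
      exact DFunLike.congr_fun h (r, w, μ)
  have hinj : Function.Injective (hybridForm T k hd hκ) := by
    rw [← LinearMap.ker_eq_bot, LinearMap.ker_eq_bot']
    rintro ⟨q, u, μ⟩ h
    have h1 : IsHybridSolution T k κ 0 0 q u μ := by
      rw [isHybridSolution_iff hd]
      intro r w ν
      have h2 : loadForm 0 w = 0 := by simp [loadForm]
      have h3 : boundaryLoad 0 ν = 0 := by simp [boundaryLoad, faceIntegral]
      rw [h2, h3, add_zero]
      exact DFunLike.congr_fun h (r, w, ν)
    obtain ⟨rfl, rfl, rfl⟩ := h1.eq_zero hd hopen hreg hκ hpos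
    rfl
  have hsurj : Function.Surjective (hybridForm T k hd hκ) :=
    (LinearMap.injective_iff_surjective_of_finrank_eq_finrank Subspace.dual_finrank_eq.symm).1 hinj
  obtain ⟨s, hs⟩ := hsurj ℓ
  exact ⟨s, (hiff s).2 hs, fun t ht => hinj (((hiff t).1 ht).trans hs.symm)⟩

/-! ### Uniqueness for the Galerkin system -/

theorem VhDiv_sub (hd : d ≠ 0) (hopen : IsOpen Ω) (hreg : interior (closure Ω) = Ω)
    (hq : q ∈ VhDiv T k) (hr : r ∈ VhDiv T k) : q + (-1 : ℝ) • r ∈ VhDiv T k := by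
  rw [mem_VhDiv_iff hd hopen hreg] at *
  intro e he heb x hx
  have h1 := normalJump_add (fun K => (q K).1) (fun K => (-1 : ℝ) • (r K).1) e x
  rw [normalJump_smul, hq e he heb x hx, hr e he heb x hx] at h1
  simpa using h1

/-- The difference of the fluxes has zero elementwise divergence and hence zero energy. The
difference `η` of the scalars is then orthogonal to all divergences from `V_h^div`, and these
exhaust `W_h`. -/
theorem IsGalerkinSolution.unique (hd : d ≠ 0) (hopen : IsOpen Ω) (hreg : interior (closure Ω) = Ω)
    (hκ : ∀ K : T.elems, IntegrableOn (fun x => (κ x)⁻¹) (cell K.1))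
    (hpos : ∀ K : T.elems, ∀ᵐ x ∂volume.restrict (cell K.1), 0 < κ x)
    (hf : ∀ K : T.elems, IntegrableOn f (cell K.1)) {q' : Vh T k} {u' : Wh T k}
    (h : IsGalerkinSolution T k κ f u₀ q u) (h' : IsGalerkinSolution T k κ f u₀ q' u') :
    q = q' ∧ u = u' := by
  rw [isGalerkinSolution_iff hd hreg hκ hf] at h h'
  obtain ⟨hm, hflux, hbal⟩ := h
  obtain ⟨hm', hflux', hbal'⟩ := h'
  set δ : Vh T k := q + (-1 : ℝ) • q' with hδ
  set η : Wh T k := u + (-1 : ℝ) • u' with hη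
  have hδm : δ ∈ VhDiv T k := VhDiv_sub hd hopen hreg hm hm'
  have hδdiv : ∀ w, divForm w δ = 0 := fun w => by
    rw [hδ, divForm_add_right, divForm_smul_right, hbal, hbal']; ring
  have hflux0 : ∀ r ∈ VhDiv T k, massForm κ δ r = divForm η r := fun r hr => by
    rw [hδ, hη, massForm_add_left hκ, massForm_smul_left, divForm_add_left, divForm_smul_left]
    have := hflux r hr
    have := hflux' r hr
    linarith
  have hδ0 : δ = 0 := eq_zero_of_massForm_self_eq_zero hκ hpos (by rw [hflux0 δ hδm, hδdiv])
  have hdiv0 : ∀ r ∈ VhDiv T k, divForm η r = 0 := fun r hr => by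
    rw [← hflux0 r hr, hδ0]
    simpa using massForm_smul_left (κ := κ) 0 (0 : Vh T k) r
  have hκ1 : ∀ K : T.elems, IntegrableOn (fun _ : Space d => ((fun _ => (1 : ℝ)) () : ℝ)⁻¹)
      (cell K.1) := fun K => integrableOn_cell continuous_const
  have hfη : ∀ K : T.elems, IntegrableOn (scalarFun η) (cell K.1) := fun K =>
    (integrableOn_cell (continuous_evalAt (η K).1)).congr_fun
      (fun x hx => (scalarFun_eq hd η K hx).symm) isOpen_cell.measurableSet
  have hu0 : ∀ e ∈ T.faces, OnBoundary Ω e →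
      Integrable (fun x : hull e => (0 : Space d → ℝ) x) (faceMeasure e) := fun e _ _ =>
    integrable_zero _ _ _
  -- An auxiliary hybrid problem with `κ = 1`, load `η` and zero Dirichlet data supplies `p ∈
  -- V_h^div` with divergence `η`. Testing with `p` gives `‖η‖² = 0`.
  obtain ⟨⟨p, v, lam⟩, hs, -⟩ := existsUnique_isHybridSolution (T := T) (k := k)
    (κ := fun _ => (1 : ℝ)) (f := scalarFun η) (u₀ := 0) hd hopen hreg hκ1
    (fun K => Filter.Eventually.of_forall fun _ => one_pos) hfη hu0
  have hp : p ∈ VhDiv T k := (mem_VhDiv_iff hd hopen hreg).2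
    ((interiorTraceForm_eq_zero_iff hd).1 hs.continuity)
  have hη0 : η = 0 := by
    refine eq_zero_of_sum_integral_sq_eq_zero ?_
    rw [← loadForm_scalarFun hd, ← hs.balance η, hdiv0 p hp]
  rw [hδ] at hδ0
  rw [hη] at hη0
  constructor
  · have e : (-1 : ℝ) • q' = -q' := neg_one_smul ℝ q'
    rwa [e, ← sub_eq_add_neg, sub_eq_zero] at hδ0
  · have e : (-1 : ℝ) • u' = -u' := neg_one_smul ℝ u'
    rwa [e, ← sub_eq_add_neg, sub_eq_zero] at hη0

end Uniqueness

end RTHybrid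

theorem proposition3p1 (d : ℕ) (hd : 2 ≤ d)
    (Ω : Set (RTHybrid.Space d)) (hopen : IsOpen Ω) (hconn : IsConnected Ω)
    (hreg : interior (closure Ω) = Ω)
    (T : RTHybrid.Triangulation Ω) (k : ℕ)
    (κ f u₀ : RTHybrid.Space d → ℝ)
    (hκ : MemLp κ ⊤ (volume.restrict Ω))
    (hκpos : ∃ κ₀ : ℝ, 0 < κ₀ ∧ ∀ᵐ x ∂(volume.restrict Ω), κ₀ ≤ κ x)
    (hf : MemLp f 2 (volume.restrict Ω))
    (hu₀ : MemLp u₀ 2 ((μHE[d - 1] : Measure (RTHybrid.Space d)).restrict (frontier Ω))) :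
    (∃! s : RTHybrid.Vh T k × RTHybrid.Wh T k × RTHybrid.Mh T k,
      RTHybrid.IsHybridSolution T k κ f u₀ s.1 s.2.1 s.2.2) ∧
    (∀ (q : RTHybrid.Vh T k) (u : RTHybrid.Wh T k) (uhat : RTHybrid.Mh T k),
      RTHybrid.IsHybridSolution T k κ f u₀ q u uhat →
        RTHybrid.IsGalerkinSolution T k κ f u₀ q u) ∧
    (∀ (q : RTHybrid.Vh T k) (u : RTHybrid.Wh T k),
      RTHybrid.IsGalerkinSolution T k κ f u₀ q u →
        ∃ uhat : RTHybrid.Mh T k, RTHybrid.IsHybridSolution T k κ f u₀ q u uhat) := by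
  have hd0 : d ≠ 0 := by omega
  obtain ⟨κ₀, hκ₀, hκle⟩ := hκpos
  have : IsFiniteMeasure (volume.restrict Ω) :=
    isFiniteMeasure_restrict.2 (RTHybrid.volume_lt_top T).ne
  have hsub : ∀ K : T.elems, RTHybrid.cell K.1 ⊆ Ω := fun K => RTHybrid.cell_subset T hreg K.2
  -- `κ⁻¹` is bounded by `κ₀⁻¹` almost everywhere, on a set of finite measure.
  have hκi : ∀ K : T.elems, IntegrableOn (fun x => (κ x)⁻¹) (RTHybrid.cell K.1) := fun K => by
    have h : IntegrableOn (fun x => (κ x)⁻¹) Ω :=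
      Integrable.of_bound hκ.1.aemeasurable.inv.aestronglyMeasurable κ₀⁻¹ <| by
        filter_upwards [hκle] with x hx
        rw [norm_inv, Real.norm_of_nonneg (hκ₀.le.trans hx)]
        exact inv_anti₀ hκ₀ hx
    exact h.mono_set (hsub K)
  have hpos : ∀ K : T.elems, ∀ᵐ x ∂volume.restrict (RTHybrid.cell K.1), 0 < κ x := fun K =>
    (ae_restrict_of_ae_restrict_of_subset (hsub K) hκle).mono fun _ hx => hκ₀.trans_le hx
  have hfi : ∀ K : T.elems, IntegrableOn f (RTHybrid.cell K.1) := fun K =>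
    IntegrableOn.mono_set (hf.integrable one_le_two) (hsub K)
  have hui : ∀ e ∈ T.faces, RTHybrid.OnBoundary Ω e →
      Integrable (fun x : RTHybrid.hull e => u₀ x) (RTHybrid.faceMeasure e) := fun e he heb => by
    have : IsFiniteMeasure
        ((μHE[d - 1] : Measure (RTHybrid.Space d)).restrict (RTHybrid.hull e)) :=
      isFiniteMeasure_restrict.2 (RTHybrid.face_measure_lt_top hd0 he).ne
    exact (integrableOn_iff_comap_subtypeVal (RTHybrid.isClosed_hull e).measurableSet).1
      ((hu₀.mono_measure (Measure.restrict_mono_set _ heb)).integrable one_le_two)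
  have hex := RTHybrid.existsUnique_isHybridSolution (T := T) (k := k) hd0 hopen hreg
    hκi hpos hfi hui
  have hHG : ∀ (q : RTHybrid.Vh T k) (u : RTHybrid.Wh T k) (uhat : RTHybrid.Mh T k),
      RTHybrid.IsHybridSolution T k κ f u₀ q u uhat →
        RTHybrid.IsGalerkinSolution T k κ f u₀ q u := fun q u uhat h =>
    h.isGalerkinSolution hd0 hopen hreg hκi hfi hui
  refine ⟨hex, hHG, fun q u h => ?_⟩
  obtain ⟨s, hs, -⟩ := hex
  -- The given Galerkin solution equals the one induced by the hybrid solution, whose multiplier is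
  -- then the required one.
  obtain ⟨rfl, rfl⟩ := h.unique hd0 hopen hreg hκi hpos hfi (hHG _ _ _ hs)
  exact ⟨s.2.2, hs⟩
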